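/- Let $\Omega\subset\mathbb R^3$ be an open set with $\Omega=\operatorname{int}(\overline\Omega)$ (for example, a bounded polytopal Lipschitz domain), and let $\mathcal T$ be a finite face-to-face triangulation of $\overline\Omega$ into closed nondegenerate tetrahedra. Let $\ell\ge 5$ be an integer. $P_k(G)$ denotes the polynomial functions of degree at most $k$, restricted to $G$. **Shape functions.** For a tetrahedron $T$ with barycentric coordinates $\lambda_1,\dots,\lambda_4$ let $b_T=\lambda_1\lambda_2\lambda_3\lambda_4$, and for a face $F$ of $T$ with vertices $a_i,a_j,a_k$ let $b_F=\lambda_i\lambda_j\lambda_k$. Put $N=\dim P_{\ell-4}(F)$. For every $T$ and every face $F$ of $T$ choose * a basis $\phi_1,\dots,\phi_N$ of $P_{\ell-4}(F)$ and polynomials $\varphi_1,\dots,\varphi_{2\ell-3}\in P_{\ell-2}(F)$ that extend it to a basis of $P_{\ell-2}(F)$ and satisfy $\int_F b_F\,q\,\varphi_k\,dS=0$ for all $q\in P_{\ell-4}(F)$ and all $k$; * functions $\tilde\phi_1,\dots,\tilde\phi_N$ in the span $X_F$ of those Lagrange basis functions of $P_{\ell-2}(T)$ (for the principal lattice of order $\ell-2$)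 that do not vanish identically on $F$, with $\frac1{|F|}\int_F b_F^2\tilde\phi_i\phi_j\,dS=\delta_{ij}$ and $\int_F b_F^2\tilde\phi_i\varphi_k\,dS=0$ for all $i,j,k$; * functions $\tilde q_1,\dots,\tilde q_N\in b_T^2P_{\ell-4}(T)$ with $\int_T\tilde q_i\,q\,dx=\int_T b_Tb_F\tilde\phi_i\,q\,dx$ for all $q\in P_{\ell-4}(T)$ and all $i$. Set $\xi_i^F=b_Tb_F\tilde\phi_i-\tilde q_i$ and $$\mathcal P_{T,\ell}=P_\ell(T)+\operatorname{span}\{\xi_i^F:\ F\text{ a face of }T,\ i=1,\dots,N\}.$$ **Finite element space.** For an interior face $F$, shared by two elements $T_+,T_-\in\mathcal T$, with unit normal $n$ pointing from $T_+$ towards $T_-$, let $[\partial_nv]=\partial_n(v|_{T_+})-\partial_n(v|_{T_-})$ on $F$. Let $V^{(\ell)}_{\mathcal T}$ be the set of all $v\in H^1_0(\Omega)$ such that $v|_T\in\mathcal P_{T,\ell}$ for every $T\in\mathcal T$; $v,\nabla v,D^2v$ are continuous at all vertices of $\mathcal T$; $v,\nabla v$ are continuous at all edges of $\mathcal T$;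 and $\int_F[\partial_nv]\,q\,dS=0$ for all interior faces $F$ and all $q\in P_{\ell-4}(F)$. **Claim.** For every admissible choice of the functions above: 1. Every $v_h\in V^{(\ell)}_{\mathcal T}$ satisfies, on every interior face $F$, $$\int_F[\partial_nv_h]\,p\,dS=0\qquad\text{for all }p\in P_{\ell-2}(F).$$ 2. $V^{(\ell)}_{\mathcal T}$ has the strong discrete Miranda–Talenti property: for all $v_h\in V^{(\ell)}_{\mathcal T}$, $$\|D^2_{\mathcal T}v_h\|_{L^2(\Omega)}\le\|\Delta_{\mathcal T}v_h\|_{L^2(\Omega)},$$ where $D^2_{\mathcal T}$ and $\Delta_{\mathcal T}$ are the Hessian (measured in the Frobenius norm) and the Laplacian, evaluated separately on each element. -/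

import Mathlib

open MeasureTheory Filter Topology Set
open scoped ContDiff

noncomputable section

/-- Three-dimensional Euclidean space. -/
abbrev E3 : Type := EuclideanSpace ℝ (Fin 3)

/-! ### Polynomial functions -/

/-- `P_k`: the polynomial functions on `ℝ³` of total degree at most `k`. Since a tetrahedron has
nonempty interior, this is also `P_k(T)` for every tetrahedron `T`. -/
def polyFun (k : ℕ) : Submodule ℝ (E3 → ℝ) where
  carrier := {f | ∃ p : MvPolynomial (Fin 3) ℝ, p.totalDegree ≤ k ∧
    ∀ x : E3, f x = MvPolynomial.eval (fun i => x i) p}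
  zero_mem' := ⟨0, by simp, by simp⟩
  add_mem' := by
    rintro f g ⟨p, hp, hf⟩ ⟨q, hq, hg⟩
    exact ⟨p + q, (MvPolynomial.totalDegree_add p q).trans (max_le hp hq),
      fun x => by simp [hf x, hg x]⟩
  smul_mem' := by
    rintro c f ⟨p, hp, hf⟩
    exact ⟨c • p, (MvPolynomial.totalDegree_smul_le c p).trans hp, fun x => by simp [hf x]⟩

/-- Restriction of functions to a set, as a linear map. -/
def restrictTo (G : Set E3) : (E3 → ℝ) →ₗ[ℝ] (G → ℝ) :=
  LinearMap.funLeft ℝ ℝ (Subtype.val : G → E3)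

/-- `P_k(G)`: the restrictions to `G` of the polynomial functions of degree at most `k`. -/
def polyOn (k : ℕ) (G : Set E3) : Submodule ℝ (G → ℝ) :=
  (polyFun k).map (restrictTo G)

/-! ### Tetrahedra, faces, barycentric coordinates -/

/-- A nondegenerate tetrahedron, given by its set of four vertices. -/
structure Tet where
  verts : Finset E3
  card_verts : verts.card = 4
  indep : AffineIndependent ℝ (Subtype.val : verts → E3)

/-- The closed tetrahedron as a point set. -/
def Tet.carrier (T : Tet) : Set E3 := convexHull ℝ (T.verts : Set E3)

/-- The vertices of a tetrahedron form an affine basis of `ℝ³`. -/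
def Tet.basis (T : Tet) : AffineBasis T.verts ℝ E3 where
  toFun := Subtype.val
  ind' := T.indep
  tot' := by
    refine T.indep.affineSpan_eq_top_iff_card_eq_finrank_add_one.2 ?_
    simp [T.card_verts]

open Classical in
/-- The barycentric coordinate `λ_a` of the tetrahedron `T` belonging to its vertex `a`
(an affine function on all of `ℝ³`; by convention zero if `a` is not a vertex of `T`). -/
def Tet.bary (T : Tet) (a : E3) : E3 → ℝ :=
  fun x => if h : a ∈ T.verts then T.basis.coord ⟨a, h⟩ x else 0

/-- The faces of `T`, given by their sets of three vertices. -/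
def Tet.Face (T : Tet) : Type := {F : Finset E3 // F ⊆ T.verts ∧ F.card = 3}

/-- The closed triangle with the given vertices, as a point set. -/
def triangle (F : Finset E3) : Set E3 := convexHull ℝ (F : Set E3)

/-- The cubic face bubble `b_F = λ_i λ_j λ_k`. -/
def Tet.faceBubble (T : Tet) (F : Finset E3) : E3 → ℝ := fun x => ∏ a ∈ F, T.bary a x

/-- The quartic volume bubble `b_T = λ_1 λ_2 λ_3 λ_4`. -/
def Tet.volBubble (T : Tet) : E3 → ℝ := fun x => ∏ a ∈ T.verts, T.bary a x

/-! ### The face bubble functions `ξ_i^F` -/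

/-- The Lagrange nodes of order `m` in `T` (the principal lattice): all barycentric coordinates
are natural multiples of `1 / m`. -/
def Tet.lagrangeNodes (T : Tet) (m : ℕ) : Set E3 :=
  {x | ∀ a ∈ T.verts, ∃ j : ℕ, T.bary a x = (j : ℝ) / (m : ℝ)}

/-- `p` is the Lagrange basis function of `P_m(T)` belonging to the node `z`. -/
def Tet.IsLagrangeBasisFun (T : Tet) (m : ℕ) (z : E3) (p : E3 → ℝ) : Prop :=
  p ∈ polyFun m ∧ z ∈ T.lagrangeNodes m ∧ p z = 1 ∧ ∀ y ∈ T.lagrangeNodes m, y ≠ z → p y = 0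

/-- The span of those Lagrange basis functions of `P_m(T)` that do not vanish identically
on the face `F`. -/
def Tet.lagrangeSpan (T : Tet) (m : ℕ) (F : Finset E3) : Submodule ℝ (E3 → ℝ) :=
  Submodule.span ℝ {p | (∃ z, T.IsLagrangeBasisFun m z p) ∧ ∃ x ∈ triangle F, p x ≠ 0}

/-- `N_{ℓ-4} = dim P_{ℓ-4}(F)`. -/
def faceDim (ℓ : ℕ) (F : Finset E3) : ℕ := Module.finrank ℝ (polyOn (ℓ - 4) (triangle F))

/-- The functions chosen in the construction of the bubbles of a face `F` of `T`, with the relations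
they are required to satisfy. Polynomials on `F` are given by polynomial functions on `ℝ³`,
and `μHE[2]` is the surface measure. -/
structure FaceBubbleData (ℓ : ℕ) (T : Tet) (F : Finset E3) where
  /-- the basis `φ_1, …, φ_N` of `P_{ℓ-4}(F)` -/
  phi : Fin (faceDim ℓ F) → E3 → ℝ
  /-- the polynomials `ϕ_1, …, ϕ_{2ℓ-3}` that extend it to a basis of `P_{ℓ-2}(F)` -/
  vphi : Fin (2 * ℓ - 3) → E3 → ℝ
  /-- the functions `φ̃_1, …, φ̃_N` in `X_F` -/
  phiT : Fin (faceDim ℓ F) → E3 → ℝ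
  /-- the factors `r_i` in `P_{ℓ-4}(T)` of the volume corrections `q̃_i = b_T² r_i` -/
  r : Fin (faceDim ℓ F) → E3 → ℝ
  phi_mem : ∀ i, phi i ∈ polyFun (ℓ - 4)
  phi_indep : LinearIndependent ℝ (fun i => restrictTo (triangle F) (phi i))
  phi_span : Submodule.span ℝ (range fun i => restrictTo (triangle F) (phi i))
    = polyOn (ℓ - 4) (triangle F)
  vphi_mem : ∀ k, vphi k ∈ polyFun (ℓ - 2)
  basis_indep : LinearIndependent ℝ
    (Sum.elim (fun i => restrictTo (triangle F) (phi i))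
      (fun k => restrictTo (triangle F) (vphi k)))
  basis_span : Submodule.span ℝ
    (range (Sum.elim (fun i => restrictTo (triangle F) (phi i))
      (fun k => restrictTo (triangle F) (vphi k)))) = polyOn (ℓ - 2) (triangle F)
  vphi_orth : ∀ k, ∀ q ∈ polyFun (ℓ - 4),
    ∫ x in triangle F, T.faceBubble F x * q x * vphi k x ∂μHE[2] = 0
  phiT_mem : ∀ i, phiT i ∈ T.lagrangeSpan (ℓ - 2) F
  phiT_phi : ∀ i j,
    ⨍ x in triangle F, T.faceBubble F x ^ 2 * phiT i x * phi j x ∂μHE[2] = if i = j then 1 else 0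
  phiT_vphi : ∀ i k,
    ⨍ x in triangle F, T.faceBubble F x ^ 2 * phiT i x * vphi k x ∂μHE[2] = 0
  r_mem : ∀ i, r i ∈ polyFun (ℓ - 4)
  r_moment : ∀ i, ∀ q ∈ polyFun (ℓ - 4),
    ∫ x in T.carrier, (T.volBubble x ^ 2 * r i x) * q x
      = ∫ x in T.carrier, (T.volBubble x * T.faceBubble F x * phiT i x) * q x

/-- The bubble `ξ_i^F = b_T b_F φ̃_i - q̃_i`. -/
def FaceBubbleData.xi {ℓ : ℕ} {T : Tet} {F : Finset E3} (B : FaceBubbleData ℓ T F)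
    (i : Fin (faceDim ℓ F)) : E3 → ℝ :=
  fun x => T.volBubble x * T.faceBubble F x * B.phiT i x - T.volBubble x ^ 2 * B.r i x

/-- The shape function space `P_ℓ(T) + span {ξ_i^F : F a face of T, i = 1, …, N_{ℓ-4}}`. -/
def shapeSpace (ℓ : ℕ) (T : Tet) (B : ∀ F : T.Face, FaceBubbleData ℓ T F.1) :
    Submodule ℝ (E3 → ℝ) :=
  polyFun ℓ ⊔ Submodule.span ℝ {f | ∃ (F : T.Face) (i : Fin (faceDim ℓ F.1)), f = (B F).xi i}

/-! ### Triangulations and piecewise polynomial functions -/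

/-- `𝒯` is a (face-to-face) simplicial triangulation of `Ω`. -/
structure IsTriangulation (𝒯 : Finset Tet) (Ω : Set E3) : Prop where
  face_to_face : ∀ S ∈ 𝒯, ∀ T ∈ 𝒯,
    S.carrier ∩ T.carrier = convexHull ℝ ((S.verts : Set E3) ∩ (T.verts : Set E3))
  cover : ⋃ T ∈ 𝒯, T.carrier = closure Ω

open Classical in
/-- `v|_T`: the polynomial function that coincides with `v` in the interior of `T` (it is unique;
by convention zero if there is none). Its values and derivatives at boundary points of `T` are the
one-sided values and derivatives of `v` taken from `T`. -/
def Tet.piece (T : Tet) (v : E3 → ℝ) : E3 → ℝ :=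
  if h : ∃ p : E3 → ℝ, (∃ k, p ∈ polyFun k) ∧ EqOn v p (interior T.carrier) then h.choose else 0

/-- The unit normal `n` of the face `F` of `T` that points out of `T`. -/
def IsOuterUnitNormal (T : Tet) (F : Finset E3) (n : E3) : Prop :=
  ‖n‖ = 1 ∧ (∀ x ∈ F, ∀ y ∈ F, inner ℝ n (y - x) = 0) ∧
    ∀ x ∈ F, ∀ a ∈ T.verts, a ∉ F → inner ℝ n (a - x) < 0

/-- `F` is an interior face of `𝒯`, shared by the two elements `Tp` and `Tm`, and `n` is its unit
normal pointing from `Tp` towards `Tm`. -/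
def IsInteriorFace (𝒯 : Finset Tet) (F : Finset E3) (Tp Tm : Tet) (n : E3) : Prop :=
  Tp ∈ 𝒯 ∧ Tm ∈ 𝒯 ∧ Tp ≠ Tm ∧ F ⊆ Tp.verts ∧ F ⊆ Tm.verts ∧ F.card = 3 ∧
    IsOuterUnitNormal Tp F n

/-- The jump `[∂_n v] = ∂_n v|_{Tp} - ∂_n v|_{Tm}` of the normal derivative. -/
def normalJump (v : E3 → ℝ) (Tp Tm : Tet) (n : E3) : E3 → ℝ :=
  fun x => fderiv ℝ (Tp.piece v) x n - fderiv ℝ (Tm.piece v) x n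

/-- The normal derivative of `v` is continuous in the sense of moments of order `k` across all
interior faces `F`: `∫_F [∂_n v] q dS = 0` for all `q` in `P_k(F)`. -/
def NormalMomentContinuity (𝒯 : Finset Tet) (k : ℕ) (v : E3 → ℝ) : Prop :=
  ∀ (F : Finset E3) (Tp Tm : Tet) (n : E3), IsInteriorFace 𝒯 F Tp Tm n →
    ∀ q ∈ polyFun k, ∫ x in triangle F, normalJump v Tp Tm n x * q x ∂μHE[2] = 0

/-- `v`, `∇v` and `D²v` are continuous at all vertices. -/
def C2AtVertices (𝒯 : Finset Tet) (v : E3 → ℝ) : Prop :=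
  ∀ S ∈ 𝒯, ∀ T ∈ 𝒯, ∀ a ∈ S.verts, a ∈ T.verts →
    S.piece v a = T.piece v a ∧ fderiv ℝ (S.piece v) a = fderiv ℝ (T.piece v) a ∧
      fderiv ℝ (fderiv ℝ (S.piece v)) a = fderiv ℝ (fderiv ℝ (T.piece v)) a

/-- `v` and `∇v` are continuous at all edges. -/
def C1AtEdges (𝒯 : Finset Tet) (v : E3 → ℝ) : Prop :=
  ∀ S ∈ 𝒯, ∀ T ∈ 𝒯, ∀ a ∈ S.verts, a ∈ T.verts → ∀ b ∈ S.verts, b ∈ T.verts →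
    ∀ x ∈ segment ℝ a b,
      S.piece v x = T.piece v x ∧ fderiv ℝ (S.piece v) x = fderiv ℝ (T.piece v) x

/-- `v` belongs to `H¹₀(Ω)`, the closure of `C_c^∞(Ω)` in `H¹(Ω)`; the limit `g` of the gradients
is the weak gradient of `v`. -/
def MemH10 (Ω : Set E3) (v : E3 → ℝ) : Prop :=
  MemLp v 2 (volume.restrict Ω) ∧ ∃ g : E3 → E3, MemLp g 2 (volume.restrict Ω) ∧
    ∃ u : ℕ → E3 → ℝ,
      (∀ m, ContDiff ℝ ∞ (u m) ∧ HasCompactSupport (u m) ∧ tsupport (u m) ⊆ Ω) ∧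
      Tendsto (fun m => eLpNorm (fun x => u m x - v x) 2 (volume.restrict Ω)) atTop (𝓝 0) ∧
      Tendsto (fun m => eLpNorm (fun x => gradient (u m) x - g x) 2 (volume.restrict Ω))
        atTop (𝓝 0)

/-- The finite element space `V_𝒯^{(ℓ)}`. -/
def feSpace (ℓ : ℕ) (Ω : Set E3) (𝒯 : Finset Tet)
    (B : ∀ (T : Tet) (F : T.Face), FaceBubbleData ℓ T F.1) : Set (E3 → ℝ) :=
  {v | MemH10 Ω v ∧
    (∀ T ∈ 𝒯, ∃ p ∈ shapeSpace ℓ T (B T), EqOn v p (interior T.carrier)) ∧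
    C2AtVertices 𝒯 v ∧ C1AtEdges 𝒯 v ∧ NormalMomentContinuity 𝒯 (ℓ - 4) v}

/-! ### The strong discrete Miranda–Talenti property -/

/-- The second partial derivative `∂_i ∂_j v`. -/
def partial2 (v : E3 → ℝ) (i j : Fin 3) (x : E3) : ℝ :=
  fderiv ℝ (fun y => fderiv ℝ v y (EuclideanSpace.single j 1)) x (EuclideanSpace.single i 1)

/-- The piecewise Hessian `D²_𝒯 v`. Its nine entries are collected in a Euclidean space, so that the
pointwise norm is the Frobenius norm. -/
def pwHessian (𝒯 : Finset Tet) (v : E3 → ℝ) : E3 → EuclideanSpace ℝ (Fin 3 × Fin 3) :=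
  fun x => ∑ T ∈ 𝒯, (interior T.carrier).indicator
    (fun y => WithLp.toLp 2 fun ij : Fin 3 × Fin 3 => partial2 v ij.1 ij.2 y) x

/-- The piecewise Laplacian `Δ_𝒯 v`. -/
def pwLaplacian (𝒯 : Finset Tet) (v : E3 → ℝ) : E3 → ℝ :=
  fun x => ∑ T ∈ 𝒯, (interior T.carrier).indicator (fun y => ∑ i : Fin 3, partial2 v i i y) x

/-- `‖D²_𝒯 v‖_{L²(Ω)} ≤ ‖Δ_𝒯 v‖_{L²(Ω)}` for all `v` in `V`. -/
def StrongDiscreteMirandaTalenti (Ω : Set E3) (𝒯 : Finset Tet) (V : Set (E3 → ℝ)) : Prop :=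
  ∀ v ∈ V, eLpNorm (pwHessian 𝒯 v) 2 (volume.restrict Ω)
    ≤ eLpNorm (pwLaplacian 𝒯 v) 2 (volume.restrict Ω)

end

/-!
Write `b_F` and `b_T` for the bubbles and `ξ` for the bubble functions of an element.

**Moments of the normal derivative.** On an element, `v` is a polynomial `p` of degree `ℓ` plus a
combination of bubble functions. On a face `F`, the derivative of a bubble function is a multiple of
`b_F² φ̃_i` if it belongs to `F`, and zero otherwise (`Tet.pd_xi`). Hence it vanishes on the edges,
and it is orthogonal to every `ϕ_k`. The two elements that share `F` may come with different
functions `ϕ_k`, but these span the same space on `F`, namely the complement of `P_{ℓ-4}(F)` in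
`P_{ℓ-2}(F)` that is orthogonal for the weight `b_F` (`Tet.setIntegral_pd_bubble_orth`). The jump of
the normal derivative of `p` has degree `ℓ - 1` and vanishes on the edges of `F`, so it is `b_F`
times a polynomial of degree `ℓ - 4` (`Tet.exists_eq_faceBubble_mul`), and is orthogonal to the `ϕ_k`
as well.

**The Miranda–Talenti property.** On one element, `|D²v|² - (Δv)²` is the divergence of
`(D²v) ∇v - (Δv) ∇v`, and the divergence theorem turns its integral into fluxes through the faces
(`setIntegral_hessian_sub_laplacian`). Functions in `H¹₀(Ω)` are continuous across interior faces and
vanish on boundary faces, since a jump contradicts the Lipschitz continuity of translations in `L²`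
(`eq_of_translate_le`). So across an interior face with equation `L = 0` the polynomial changes by
`L g`, and the flux changes, up to a tangential divergence, by the normal derivative `g` times the
tangential Laplacian (`mtField_jump`). The tangential divergence has mean zero because `g` vanishes
on the edges, and the other term is a moment of order `ℓ - 2` of the jump. On a boundary face the
flux is zero. All fluxes cancel (`sum_mtFlux_eq_zero`), and the two norms are even equal.

**Divergence theorem.** It is proved for polynomial functions from Fubini's theorem on reference
simplices. All integrals are expressed by averages, which do not see the constants that relate
Hausdorff measure and Lebesgue measure on the reference simplices; the face opposite to a vertex `a`
of `T` then enters with the weight `-3 |T| ∇λ_a` (`Tet.setIntegral_pd`). For the two sides of a face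
these weights are opposite to each other (`Tet.IsOpposite.volume_smul_grad`).
-/

noncomputable section

/-! ### Polynomial functions -/

theorem polyFun_mono {k m : ℕ} (h : k ≤ m) : polyFun k ≤ polyFun m := by
  rintro f ⟨p, hp, hf⟩
  exact ⟨p, hp.trans h, hf⟩

theorem const_mem_polyFun (k : ℕ) (c : ℝ) : (fun _ => c) ∈ polyFun k :=
  ⟨MvPolynomial.C c, by simp, by simp⟩

theorem coord_mem_polyFun (i : Fin 3) : (fun x : E3 => x i) ∈ polyFun 1 :=
  ⟨MvPolynomial.X i, by simp, by simp⟩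

theorem mul_mem_polyFun {k m : ℕ} {f g : E3 → ℝ} (hf : f ∈ polyFun k) (hg : g ∈ polyFun m) :
    f * g ∈ polyFun (k + m) := by
  obtain ⟨p, hp, hf⟩ := hf
  obtain ⟨q, hq, hg⟩ := hg
  exact ⟨p * q, (MvPolynomial.totalDegree_mul p q).trans (add_le_add hp hq),
    fun x => by simp [hf x, hg x]⟩

/-- A property of polynomial functions and degree bounds that holds for constants and survives
sums and multiplication by a coordinate holds for all polynomial functions. -/
theorem polyFun_induction {P : ℕ → (E3 → ℝ) → Prop} (const : ∀ k c, P k fun _ => c)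
    (add : ∀ k f g, f ∈ polyFun k → g ∈ polyFun k → P k f → P k g → P k (f + g))
    (coord_mul : ∀ k f i, f ∈ polyFun k → P k f → P (k + 1) ((fun x => x i) * f)) :
    ∀ k f, f ∈ polyFun k → P k f := by
  have mono : ∀ (n : ℕ) (m : Fin 3 →₀ ℕ) (c : ℝ) (k : ℕ), m.degree = n → m.degree ≤ k →
      P k fun x : E3 => MvPolynomial.eval (fun i => x i) (MvPolynomial.monomial m c) := by
    intro n
    induction n with
    | zero =>
      intro m c k hm _
      obtain rfl : m = 0 := m.degree_eq_zero_iff.1 hm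
      simpa using const k c
    | succ n ih =>
      intro m c k hm hk
      obtain ⟨i, hi⟩ : ∃ i, m i ≠ 0 := by
        by_contra! h
        have : m = 0 := Finsupp.ext h
        simp [this] at hm
      obtain ⟨m', rfl⟩ : ∃ m', m = Finsupp.single i 1 + m' :=
        ⟨m - Finsupp.single i 1, (add_tsub_cancel_of_le
          (by simpa [Finsupp.single_le_iff] using Nat.one_le_iff_ne_zero.2 hi)).symm⟩
      obtain ⟨k, rfl⟩ : ∃ k', k = k' + 1 := ⟨k - 1, by omega⟩
      simp only [map_add, Finsupp.degree_single] at hm hk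
      have := coord_mul k _ i ⟨MvPolynomial.monomial m' c,
        (MvPolynomial.totalDegree_monomial_le _ _).trans ?_, fun x => rfl⟩
        (ih m' c k (by omega) (by omega))
      · convert this using 1
        ext x
        simp only [Pi.mul_apply]
        rw [← one_mul c, ← MvPolynomial.monomial_mul, map_mul]
        simp [MvPolynomial.eval_monomial]
      · change m'.degree ≤ k
        omega
  rintro k f ⟨p, hp, hf⟩
  obtain rfl : f = fun x : E3 => MvPolynomial.eval (fun i => x i) p := funext hf
  have key : ∀ s ⊆ p.support,
      (fun x : E3 => MvPolynomial.eval (fun i => x i)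
        (∑ m ∈ s, MvPolynomial.monomial m (p.coeff m))) ∈ polyFun k ∧
      P k fun x : E3 => MvPolynomial.eval (fun i => x i)
        (∑ m ∈ s, MvPolynomial.monomial m (p.coeff m)) := by
    intro s
    induction s using Finset.induction_on with
    | empty => intro _; simpa using ⟨const_mem_polyFun k 0, const k 0⟩
    | insert m s hm ih =>
      intro hs
      obtain ⟨h1, h2⟩ := ih ((Finset.subset_insert _ _).trans hs)
      have hd : m.degree ≤ k :=
        (MvPolynomial.le_totalDegree (hs (Finset.mem_insert_self _ _))).trans hp
      have h3 : (fun x : E3 => MvPolynomial.eval (fun i => x i)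
          (MvPolynomial.monomial m (p.coeff m))) ∈ polyFun k :=
        ⟨_, (MvPolynomial.totalDegree_monomial_le _ _).trans hd, fun x => rfl⟩
      simp only [Finset.sum_insert hm, map_add]
      exact ⟨add_mem h3 h1, add k _ _ h3 h1 (mono _ m _ k rfl hd) h2⟩
  have := (key p.support subset_rfl).2
  rwa [← MvPolynomial.as_sum] at this

theorem analyticOnNhd_of_mem_polyFun {k : ℕ} {f : E3 → ℝ} (hf : f ∈ polyFun k) :
    AnalyticOnNhd ℝ f univ := by
  obtain ⟨p, -, hf⟩ := hf
  obtain rfl : f = fun x : E3 => MvPolynomial.eval (fun i => x i) p := funext hf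
  exact AnalyticOnNhd.eval_continuousLinearMap
    (EuclideanSpace.equiv (Fin 3) ℝ : E3 →L[ℝ] (Fin 3 → ℝ)) p

theorem affine_mem_polyFun (L : E3 →ᵃ[ℝ] ℝ) : (L : E3 → ℝ) ∈ polyFun 1 := by
  have : (L : E3 → ℝ) = (fun _ => L 0) +
      ∑ i : Fin 3, L.linear (EuclideanSpace.single i 1) • fun x : E3 => x i := by
    ext x
    have h1 : L x = L 0 + L.linear x := by
      have := L.map_vadd 0 x
      simp at this
      rw [this, add_comm]
    have h2 : x = ∑ i : Fin 3, x i • EuclideanSpace.single i (1 : ℝ) := by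
      ext j
      simp [Fin.sum_univ_three]
      fin_cases j <;> simp
    rw [h1]
    conv_lhs => rw [h2]
    simp [map_sum, mul_comm]
  rw [this]
  exact add_mem (const_mem_polyFun _ _)
    (Submodule.sum_mem _ fun i _ => Submodule.smul_mem _ _ (coord_mem_polyFun i))

theorem comp_affine_mem_polyFun (A : E3 →ᵃ[ℝ] E3) {k : ℕ} {f : E3 → ℝ} (hf : f ∈ polyFun k) :
    (fun x => f (A x)) ∈ polyFun k := by
  refine polyFun_induction (P := fun k f => (fun x => f (A x)) ∈ polyFun k)
    const_mem_polyFun (fun k f g _ _ h1 h2 => add_mem h1 h2) (fun k f i _ h => ?_) k f hf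
  have := mul_mem_polyFun (affine_mem_polyFun
    (((EuclideanSpace.proj i : E3 →L[ℝ] ℝ) : E3 →ₗ[ℝ] ℝ).toAffineMap.comp A)) h
  rwa [add_comm] at this

/-- Being a polynomial function, with no bound on the degree. -/
def IsPolyFun (f : E3 → ℝ) : Prop := ∃ k, f ∈ polyFun k

namespace IsPolyFun

variable {f g : E3 → ℝ}

theorem const (c : ℝ) : IsPolyFun fun _ => c := ⟨0, const_mem_polyFun 0 c⟩

theorem affine (L : E3 →ᵃ[ℝ] ℝ) : IsPolyFun L := ⟨1, affine_mem_polyFun L⟩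

theorem add (hf : IsPolyFun f) (hg : IsPolyFun g) : IsPolyFun (f + g) := by
  obtain ⟨k, hf⟩ := hf
  obtain ⟨m, hg⟩ := hg
  exact ⟨max k m, add_mem (polyFun_mono (le_max_left k m) hf) (polyFun_mono (le_max_right k m) hg)⟩

theorem smul (c : ℝ) (hf : IsPolyFun f) : IsPolyFun (c • f) := hf.imp fun _ h => Submodule.smul_mem _ c h

theorem mul (hf : IsPolyFun f) (hg : IsPolyFun g) : IsPolyFun (f * g) := by
  obtain ⟨k, hf⟩ := hf
  obtain ⟨m, hg⟩ := hg
  exact ⟨_, mul_mem_polyFun hf hg⟩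

theorem neg (hf : IsPolyFun f) : IsPolyFun (-f) := hf.imp fun _ h => neg_mem h

theorem sub (hf : IsPolyFun f) (hg : IsPolyFun g) : IsPolyFun (f - g) := sub_eq_add_neg f g ▸ hf.add hg.neg

theorem sum {ι : Type*} {s : Finset ι} {f : ι → E3 → ℝ} (h : ∀ i ∈ s, IsPolyFun (f i)) :
    IsPolyFun (∑ i ∈ s, f i) :=
  Finset.sum_induction _ IsPolyFun (fun _ _ => add) (const 0) h

theorem prod {ι : Type*} {s : Finset ι} {f : ι → E3 → ℝ} (h : ∀ i ∈ s, IsPolyFun (f i)) :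
    IsPolyFun (∏ i ∈ s, f i) :=
  Finset.prod_induction _ IsPolyFun (fun _ _ => mul) (const 1) h

theorem comp_affine (hf : IsPolyFun f) (A : E3 →ᵃ[ℝ] E3) : IsPolyFun fun x => f (A x) :=
  hf.imp fun _ => comp_affine_mem_polyFun A

theorem analyticOnNhd (hf : IsPolyFun f) : AnalyticOnNhd ℝ f univ :=
  hf.elim fun _ => analyticOnNhd_of_mem_polyFun

theorem contDiff (hf : IsPolyFun f) {n : WithTop ℕ∞} : ContDiff ℝ n f :=
  hf.analyticOnNhd.contDiff

theorem continuous (hf : IsPolyFun f) : Continuous f := (hf.contDiff (n := 0)).continuous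

theorem differentiableAt (hf : IsPolyFun f) {x : E3} : DifferentiableAt ℝ f x :=
  (hf.contDiff (n := 1)).differentiable one_ne_zero x

/-- Polynomial functions that agree on a nonempty open set are equal. -/
theorem eq_of_eqOn (hf : IsPolyFun f) (hg : IsPolyFun g) {U : Set E3} (hU : IsOpen U)
    (hne : U.Nonempty) (h : EqOn f g U) : f = g := by
  obtain ⟨x, hx⟩ := hne
  exact hf.analyticOnNhd.eq_of_eventuallyEq hg.analyticOnNhd
    (Filter.eventuallyEq_of_mem (hU.mem_nhds hx) h)

end IsPolyFun

/-! ### Directional derivatives -/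

/-- The derivative of `f` in the direction `w`. -/
def pd (w : E3) (f : E3 → ℝ) : E3 → ℝ := fun x => fderiv ℝ f x w

theorem pd_const (w : E3) (c : ℝ) : pd w (fun _ => c) = 0 := by
  ext x; simp [pd]

theorem pd_zero (w : E3) : pd w 0 = 0 := pd_const w 0

theorem pd_affine (w : E3) (L : E3 →ᵃ[ℝ] ℝ) : pd w L = fun _ => L.linear w := by
  ext x
  have : HasFDerivAt (L : E3 → ℝ) (L.linear.toContinuousLinearMap) x := by
    have h := (L.linear.toContinuousLinearMap).hasFDerivAt (x := x) |>.add_const (L 0)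
    have hL : (L : E3 → ℝ) = fun y => L.linear.toContinuousLinearMap y + L 0 := by
      ext y
      simpa using L.map_vadd 0 y
    rwa [← hL] at h
  simp [pd, this.fderiv]

section

variable {f g : E3 → ℝ} (w : E3)

theorem pd_add (hf : IsPolyFun f) (hg : IsPolyFun g) : pd w (f + g) = pd w f + pd w g := by
  ext x; simp [pd, fderiv_add hf.differentiableAt hg.differentiableAt]

theorem pd_sub (hf : IsPolyFun f) (hg : IsPolyFun g) : pd w (f - g) = pd w f - pd w g := by
  ext x; simp [pd, fderiv_sub hf.differentiableAt hg.differentiableAt]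

theorem pd_smul (c : ℝ) (hf : IsPolyFun f) : pd w (c • f) = c • pd w f := by
  ext x; simp [pd, fderiv_const_smul hf.differentiableAt]

theorem pd_mul (hf : IsPolyFun f) (hg : IsPolyFun g) : pd w (f * g) = pd w f * g + f * pd w g := by
  ext x
  simp [pd, fderiv_mul hf.differentiableAt hg.differentiableAt]
  ring

theorem pd_sub_dir (v : E3) (f : E3 → ℝ) : pd (v - w) f = pd v f - pd w f := by
  ext x; simp [pd]

theorem pd_smul_dir (c : ℝ) (f : E3 → ℝ) : pd (c • w) f = c • pd w f := by
  ext x; simp [pd]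

theorem pd_comm (v : E3) (hf : IsPolyFun f) : pd v (pd w f) = pd w (pd v f) := by
  ext x
  have h2 : ContDiff ℝ 2 f := hf.contDiff
  have hd : DifferentiableAt ℝ (fderiv ℝ f) x :=
    (h2.fderiv_right (m := 1) (by norm_num)).differentiable one_ne_zero x
  have hs := h2.contDiffAt.isSymmSndFDerivAt (x := x) (by simp)
  have e : ∀ v w : E3, pd v (pd w f) x = fderiv ℝ (fderiv ℝ f) x v w := by
    intro v w
    unfold pd
    rw [fderiv_clm_apply hd (differentiableAt_const w)]
    simp
  rw [e, e, hs.eq]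

/-- Differentiation lowers the degree. -/
theorem pd_mem_polyFun {k : ℕ} (hf : f ∈ polyFun k) : pd w f ∈ polyFun (k - 1) := by
  refine (polyFun_induction (P := fun k f => pd w f ∈ polyFun (k - 1) ∧ (k = 0 → pd w f = 0))
    (fun k c => ?_) (fun k f g hf hg h1 h2 => ?_) (fun k f i hf h => ?_) k f hf).1
  · rw [pd_const]
    exact ⟨zero_mem _, fun _ => rfl⟩
  · rw [pd_add w ⟨k, hf⟩ ⟨k, hg⟩]
    exact ⟨add_mem h1.1 h2.1, fun h => by rw [h1.2 h, h2.2 h, add_zero]⟩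
  · refine ⟨?_, by simp⟩
    have hc := pd_affine w ((EuclideanSpace.proj i : E3 →L[ℝ] ℝ) : E3 →ₗ[ℝ] ℝ).toAffineMap
    change pd w (fun x => x i) = _ at hc
    rw [pd_mul w ⟨1, coord_mem_polyFun i⟩ ⟨k, hf⟩, hc, Nat.add_sub_cancel]
    refine add_mem (Submodule.smul_mem _ (w i) hf) ?_
    rcases k with _ | k
    · rw [h.2 rfl, mul_zero]
      exact zero_mem _
    · rw [add_comm]
      exact mul_mem_polyFun (coord_mem_polyFun i) h.1

theorem IsPolyFun.pd (hf : IsPolyFun f) : IsPolyFun (pd w f) := hf.elim fun _ h => ⟨_, pd_mem_polyFun w h⟩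

end

/-! ### Division by an affine function -/

/-- The projection onto the plane `L = 0` along a direction `e` with `L.linear e = 1`. -/
def planeProj (L : E3 →ᵃ[ℝ] ℝ) (e : E3) : E3 →ᵃ[ℝ] E3 :=
  AffineMap.id ℝ E3 - (LinearMap.toSpanSingleton ℝ E3 e).toAffineMap.comp L

theorem planeProj_apply (L : E3 →ᵃ[ℝ] ℝ) (e x : E3) : planeProj L e x = x - L x • e := by
  simp [planeProj]

theorem map_sub_smul (M : E3 →ᵃ[ℝ] ℝ) (e x : E3) (c : ℝ) :
    M (x - c • e) = M x - c * M.linear e := by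
  have := M.map_vadd x (-c • e)
  simp only [vadd_eq_add, map_smul, smul_eq_mul] at this
  rw [show x - c • e = -c • e + x by rw [neg_smul]; abel, this]
  ring

theorem apply_planeProj {L : E3 →ᵃ[ℝ] ℝ} {e : E3} (he : L.linear e = 1) (x : E3) :
    L (planeProj L e x) = 0 := by
  rw [planeProj_apply, map_sub_smul, he]; ring

/-- A polynomial function minus its values on the plane `L = 0`, prolonged along `e`, is a multiple
of `L`. -/
theorem sub_planeProj_eq_mul (L : E3 →ᵃ[ℝ] ℝ) (e : E3) {k : ℕ} {f : E3 → ℝ}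
    (hf : f ∈ polyFun k) :
    ∃ g ∈ polyFun (k - 1), ∀ x, f x - f (planeProj L e x) = L x * g x := by
  suffices H : ∃ g ∈ polyFun (k - 1), (k = 0 → g = 0) ∧
      ∀ x, f x - f (planeProj L e x) = L x * g x from H.imp fun g h => ⟨h.1, h.2.2⟩
  refine polyFun_induction
    (P := fun k f => ∃ g ∈ polyFun (k - 1), (k = 0 → g = 0) ∧
      ∀ x, f x - f (planeProj L e x) = L x * g x)
    (fun k c => ⟨0, zero_mem _, fun _ => rfl, by simp⟩)
    (fun k f g _ _ h1 h2 => ?_) (fun k f i hf h => ?_) k f hf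
  · obtain ⟨a, ha, ha0, h1⟩ := h1
    obtain ⟨b, hb, hb0, h2⟩ := h2
    refine ⟨a + b, add_mem ha hb, fun h => by rw [ha0 h, hb0 h, add_zero], fun x => ?_⟩
    simp only [Pi.add_apply]
    linear_combination h1 x + h2 x
  · obtain ⟨g, hg, h0, h⟩ := h
    refine ⟨(fun x => x i) * g + e i • fun x => f (planeProj L e x), ?_, by simp, fun x => ?_⟩
    · rw [Nat.add_sub_cancel]
      refine add_mem ?_ (Submodule.smul_mem _ _ (comp_affine_mem_polyFun _ hf))
      rcases k with _ | k
      · rw [h0 rfl, mul_zero]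
        exact zero_mem _
      · rw [add_comm k]
        exact mul_mem_polyFun (coord_mem_polyFun i) hg
    · have hi : (planeProj L e x) i = x i - L x * e i := by simp [planeProj_apply]
      simp only [Pi.mul_apply, Pi.add_apply, Pi.smul_apply, smul_eq_mul, hi]
      linear_combination x i * h x

/-- A polynomial function that vanishes on the plane `L = 0` is divisible by `L`. -/
theorem exists_eq_mul_of_eq_zero {L : E3 →ᵃ[ℝ] ℝ} {e : E3} (he : L.linear e = 1) {k : ℕ}
    {f : E3 → ℝ} (hf : f ∈ polyFun k) (h0 : ∀ x, L x = 0 → f x = 0) :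
    ∃ g ∈ polyFun (k - 1), ∀ x, f x = L x * g x := by
  obtain ⟨g, hg, h⟩ := sub_planeProj_eq_mul L e hf
  exact ⟨g, hg, fun x => by rw [← h x, h0 _ (apply_planeProj he x), sub_zero]⟩

/-! ### Integrals over simplices -/

/-- The part of `B × ℝ` between the zero section and the graph of `h`. -/
def subgraph {α : Type*} (B : Set α) (h : α → ℝ) : Set (α × ℝ) :=
  {z | z.1 ∈ B ∧ 0 ≤ z.2 ∧ z.2 ≤ h z.1}

theorem measurableSet_subgraph {α : Type*} [MeasurableSpace α] {B : Set α} {h : α → ℝ}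
    (hB : MeasurableSet B) (hh : Measurable h) : MeasurableSet (subgraph B h) :=
  (measurable_fst hB).inter ((measurableSet_le measurable_const measurable_snd).inter
    (measurableSet_le measurable_snd (hh.comp measurable_fst)))

theorem setIntegral_subgraph {α : Type*} [MeasureSpace α] [SFinite (volume : Measure α)]
    {B : Set α} {h : α → ℝ} (hB : MeasurableSet B) (hh : Measurable h) (h0 : ∀ x ∈ B, 0 ≤ h x)
    {f : α × ℝ → ℝ} (hf : IntegrableOn f (subgraph B h)) :
    ∫ z in subgraph B h, f z = ∫ x in B, ∫ t in 0..h x, f (x, t) := by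
  have hS := measurableSet_subgraph hB hh
  rw [← integral_indicator hS, Measure.volume_eq_prod,
    integral_prod _ ((integrable_indicator_iff hS).2 hf), ← integral_indicator hB]
  congr 1
  ext x
  by_cases hx : x ∈ B
  · rw [indicator_of_mem hx, intervalIntegral.integral_of_le (h0 x hx),
      ← integral_Icc_eq_integral_Ioc, ← integral_indicator measurableSet_Icc]
    congr 1
    ext t
    simp [indicator, subgraph, hx]
  · simp [indicator, subgraph, hx]

/-- The fundamental theorem of calculus in the last variable. -/
theorem setIntegral_subgraph_deriv {α : Type*} [MeasureSpace α] [SFinite (volume : Measure α)]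
    [TopologicalSpace α] {B : Set α} {h : α → ℝ} (hB : MeasurableSet B) (hh : Measurable h)
    (h0 : ∀ x ∈ B, 0 ≤ h x) {f f' : α × ℝ → ℝ} (hf' : Continuous f')
    (hi : IntegrableOn f' (subgraph B h))
    (hd : ∀ x t, HasDerivAt (fun t => f (x, t)) (f' (x, t)) t) :
    ∫ z in subgraph B h, f' z = ∫ x in B, (f (x, h x) - f (x, 0)) := by
  rw [setIntegral_subgraph hB hh h0 hi]
  congr 1
  ext x
  exact intervalIntegral.integral_eq_sub_of_hasDerivAt (fun t _ => hd x t)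
    ((hf'.comp (by fun_prop : Continuous fun t => (x, t))).intervalIntegrable _ _)

/-- The reference triangle. -/
def refTri : Set (ℝ × ℝ) := subgraph (Icc 0 1) fun s => 1 - s

/-- The reference tetrahedron. -/
def refTet : Set ((ℝ × ℝ) × ℝ) := subgraph refTri fun z => 1 - z.1 - z.2

theorem mem_refTri {z : ℝ × ℝ} : z ∈ refTri ↔ 0 ≤ z.1 ∧ 0 ≤ z.2 ∧ z.1 + z.2 ≤ 1 := by
  simp only [refTri, subgraph, mem_ofPred_eq, mem_Icc]
  constructor
  · rintro ⟨⟨h1, h2⟩, h3, h4⟩; exact ⟨h1, h3, by linarith⟩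
  · rintro ⟨h1, h2, h3⟩; exact ⟨⟨h1, by linarith⟩, h2, by linarith⟩

theorem mem_refTet {z : (ℝ × ℝ) × ℝ} :
    z ∈ refTet ↔ 0 ≤ z.1.1 ∧ 0 ≤ z.1.2 ∧ 0 ≤ z.2 ∧ z.1.1 + z.1.2 + z.2 ≤ 1 := by
  simp only [refTet, subgraph, mem_ofPred_eq, mem_refTri]
  constructor
  · rintro ⟨⟨h1, h2, h3⟩, h4, h5⟩; exact ⟨h1, h2, h4, by linarith⟩
  · rintro ⟨h1, h2, h3, h4⟩; exact ⟨⟨h1, h2, by linarith⟩, h3, by linarith⟩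

theorem isCompact_refTri : IsCompact refTri := by
  refine (isCompact_Icc (a := ((0, 0) : ℝ × ℝ)) (b := (1, 1))).of_isClosed_subset ?_ ?_
  · have : refTri = {z : ℝ × ℝ | 0 ≤ z.1} ∩ ({z | 0 ≤ z.2} ∩ {z | z.1 + z.2 ≤ 1}) := by
      ext z; exact mem_refTri
    rw [this]
    exact (isClosed_le (by fun_prop) (by fun_prop)).inter
      ((isClosed_le (by fun_prop) (by fun_prop)).inter (isClosed_le (by fun_prop) (by fun_prop)))
  · intro z hz
    obtain ⟨h1, h2, h3⟩ := mem_refTri.1 hz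
    exact ⟨⟨h1, h2⟩, ⟨by simp; linarith, by simp; linarith⟩⟩

theorem isCompact_refTet : IsCompact refTet := by
  refine (isCompact_Icc (a := (((0, 0), 0) : (ℝ × ℝ) × ℝ)) (b := ((1, 1), 1))).of_isClosed_subset
    ?_ ?_
  · have : refTet = {z : (ℝ × ℝ) × ℝ | 0 ≤ z.1.1} ∩ ({z | 0 ≤ z.1.2} ∩
        ({z | 0 ≤ z.2} ∩ {z | z.1.1 + z.1.2 + z.2 ≤ 1})) := by
      ext z; exact mem_refTet
    rw [this]
    exact (isClosed_le (by fun_prop) (by fun_prop)).inter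
      ((isClosed_le (by fun_prop) (by fun_prop)).inter
      ((isClosed_le (by fun_prop) (by fun_prop)).inter (isClosed_le (by fun_prop) (by fun_prop))))
  · intro z hz
    obtain ⟨h1, h2, h3, h4⟩ := mem_refTet.1 hz
    exact ⟨⟨⟨h1, h2⟩, h3⟩, ⟨⟨by simp; linarith, by simp; linarith⟩, by simp; linarith⟩⟩

theorem setIntegral_refTri_deriv {f f' : ℝ × ℝ → ℝ} (hf' : Continuous f')
    (hd : ∀ s t, HasDerivAt (fun t => f (s, t)) (f' (s, t)) t) :
    ∫ z in refTri, f' z = ∫ s in Icc 0 1, (f (s, 1 - s) - f (s, 0)) :=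
  setIntegral_subgraph_deriv measurableSet_Icc (by fun_prop) (fun s hs => by simpa using hs.2) hf'
    (hf'.continuousOn.integrableOn_compact isCompact_refTri) hd

theorem setIntegral_refTet_deriv {f f' : (ℝ × ℝ) × ℝ → ℝ} (hf' : Continuous f')
    (hd : ∀ z t, HasDerivAt (fun t => f (z, t)) (f' (z, t)) t) :
    ∫ z in refTet, f' z = ∫ z in refTri, (f (z, 1 - z.1 - z.2) - f (z, 0)) :=
  setIntegral_subgraph_deriv isCompact_refTri.measurableSet (by fun_prop)
    (fun z hz => by have := mem_refTri.1 hz; linarith) hf'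
    (hf'.continuousOn.integrableOn_compact isCompact_refTet) hd

theorem volume_real_refTri : volume.real refTri = 1 / 2 := by
  have h := setIntegral_refTri_deriv (f := fun z => z.2) (f' := fun _ => 1) continuous_const
    (fun s t => hasDerivAt_id t)
  simp only [integral_const, smul_eq_mul, mul_one, sub_zero] at h
  rw [measureReal_restrict_apply_univ] at h
  rw [h, integral_Icc_eq_integral_Ioc, ← intervalIntegral.integral_of_le zero_le_one,
    intervalIntegral.integral_sub (by simp) (by simp)]
  norm_num

theorem volume_real_refTet : volume.real refTet = 1 / 6 := by
  have h := setIntegral_refTet_deriv (f := fun z => z.2) (f' := fun _ => 1) continuous_const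
    (fun s t => hasDerivAt_id t)
  simp only [integral_const, smul_eq_mul, mul_one, sub_zero] at h
  rw [measureReal_restrict_apply_univ] at h
  have h2 := setIntegral_refTri_deriv (f := fun z => (1 - z.1) * z.2 - z.2 ^ 2 / 2)
    (f' := fun z => 1 - z.1 - z.2) (by fun_prop) (fun s t =>
      (((hasDerivAt_id t).const_mul (1 - s)).sub
        (((hasDerivAt_id t).pow 2).div_const 2)).congr_deriv (by simp))
  rw [h, h2, integral_Icc_eq_integral_Ioc, ← intervalIntegral.integral_of_le zero_le_one]
  have : ∀ s : ℝ, (1 - s) * (1 - s) - (1 - s) ^ 2 / 2 - ((1 - s) * 0 - 0 ^ 2 / 2)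
      = (1 - s) ^ 2 / 2 := fun s => by ring
  simp only [this]
  rw [intervalIntegral.integral_comp_sub_left (fun s => s ^ 2 / 2) 1]
  norm_num

theorem setAverage_refTri (f : ℝ × ℝ → ℝ) : ⨍ z in refTri, f z = 2 * ∫ z in refTri, f z := by
  rw [setAverage_eq, volume_real_refTri]; norm_num

theorem setAverage_refTet (f : (ℝ × ℝ) × ℝ → ℝ) :
    ⨍ z in refTet, f z = 6 * ∫ z in refTet, f z := by
  rw [setAverage_eq, volume_real_refTet]; norm_num

/-- An injective affine map transports Lebesgue measure to a multiple of the Hausdorff measure of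
its image. -/
theorem exists_restrict_image_eq_smul_map {D : Type*} [NormedAddCommGroup D] [NormedSpace ℝ D]
    [FiniteDimensional ℝ D] [MeasureSpace D] [BorelSpace D] [StandardBorelSpace D]
    [(volume : Measure D).IsAddHaarMeasure] {d : ℕ} (hd : Module.finrank ℝ D = d)
    (A : D →ᵃ[ℝ] E3) (hA : Function.Injective A) :
    MeasurableEmbedding A ∧ ∃ c : ENNReal, c ≠ 0 ∧ c ≠ ⊤ ∧ ∀ S : Set D,
      (μHE[d] : Measure E3).restrict (A '' S) = c • (volume.restrict S).map A := by
  have hcont : Continuous A := A.continuous_of_finiteDimensional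
  have hme : MeasurableEmbedding A := hcont.measurableEmbedding hA
  refine ⟨hme, ?_⟩
  let e : EuclideanSpace ℝ (Fin d) ≃L[ℝ] D := ContinuousLinearEquiv.ofFinrankEq (by simp [hd])
  set c₁ := Measure.addHaarScalarFactor ((volume : Measure D).map e.symm)
    (volume : Measure (EuclideanSpace ℝ (Fin d))) with hc₁
  have hvol : (volume : Measure D).map e.symm = c₁ • volume :=
    Measure.isAddLeftInvariant_eq_smul _ _
  have hc₁0 : c₁ ≠ 0 := (Measure.addHaarScalarFactor_pos_of_isAddHaarMeasure _ _).ne'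
  let f : EuclideanSpace ℝ (Fin d) →ₗ[ℝ] E3 := A.linear ∘ₗ (e : EuclideanSpace ℝ (Fin d) →ₗ[ℝ] D)
  have hf : Function.Injective f :=
    (A.linear_injective_iff.2 hA).comp e.injective
  have hdet : f.normDet ≠ 0 := by
    rw [Ne, LinearMap.normDet_eq_zero_iff_ker_ne_bot, not_not]
    exact LinearMap.ker_eq_bot.2 hf
  have hdet' : 0 < f.normDet := lt_of_le_of_ne f.normDet_nonneg hdet.symm
  have himg : ∀ S : Set D, μHE[d] (A '' S) = ENNReal.ofReal f.normDet * ((c₁ : ENNReal)⁻¹ * volume S) := by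
    intro S
    have h1 : A '' S = IsometryEquiv.addLeft (A 0) '' (f '' (e ⁻¹' S)) := by
      have h := e.symm.image_eq_preimage_symm S
      rw [e.symm_symm] at h
      rw [image_image, ← h, image_image]
      refine image_congr fun z _ => ?_
      have := A.map_vadd 0 z
      simp only [vadd_eq_add, add_zero] at this
      simp [f, this, add_comm]
    have h2 := f.euclideanHausdorffMeasure_image_eq_normDet_mul_volume (e ⁻¹' S)
    rw [finrank_euclideanSpace_fin] at h2
    rw [h1, (IsometryEquiv.addLeft (A 0)).isometry.euclideanHausdorffMeasure_image, h2]
    congr 1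
    have h3 : volume S = c₁ * volume (e ⁻¹' S) := by
      have h : (volume : Measure D).map e.symm (e ⁻¹' S) = volume S := by
        rw [show (e.symm : D → _) = e.symm.toHomeomorph from rfl,
          e.symm.toHomeomorph.measurableEmbedding.map_apply]
        congr 1
        ext z
        simp
      rw [← h, hvol]
      rfl
    rw [h3, ← mul_assoc, ENNReal.inv_mul_cancel (by simpa using hc₁0) (by simp), one_mul]
  refine ⟨ENNReal.ofReal f.normDet * (c₁ : ENNReal)⁻¹, ?_, ?_, fun S => ?_⟩
  · simp [hdet']
  · exact ENNReal.mul_ne_top (by simp) (by simp [hc₁0])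
  · ext U hU
    rw [Measure.restrict_apply hU, Measure.smul_apply, hme.map_apply,
      Measure.restrict_apply (hme.measurable hU), inter_comm, ← image_inter_preimage, himg,
      inter_comm, smul_eq_mul, mul_assoc]

/-- Averages over the image of an affine map are averages over its domain. -/
theorem setAverage_image {D : Type*} [NormedAddCommGroup D] [NormedSpace ℝ D]
    [FiniteDimensional ℝ D] [MeasureSpace D] [BorelSpace D] [StandardBorelSpace D]
    [(volume : Measure D).IsAddHaarMeasure] {d : ℕ} (hd : Module.finrank ℝ D = d)
    (A : D →ᵃ[ℝ] E3) (hA : Function.Injective A) (S : Set D) (f : E3 → ℝ) :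
    ⨍ x in A '' S, f x ∂μHE[d] = ⨍ z in S, f (A z) := by
  obtain ⟨hme, c, h0, h1, h⟩ := exists_restrict_image_eq_smul_map hd A hA
  have hc : c.toReal ≠ 0 := ENNReal.toReal_ne_zero.2 ⟨h0, h1⟩
  rw [average_eq, average_eq, h S, integral_smul_measure, hme.integral_map, measureReal_ennreal_smul_apply,
    measureReal_def, hme.map_apply, preimage_univ, ← measureReal_def, smul_smul, mul_inv, mul_comm,
    ← mul_assoc, mul_inv_cancel₀ hc, one_mul]

/-! ### Barycentric coordinates -/

namespace Tet

variable (T : Tet)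

open Classical in
/-- The barycentric coordinate `T.bary a` as an affine map. -/
def baryAff (a : E3) : E3 →ᵃ[ℝ] ℝ := if h : a ∈ T.verts then T.basis.coord ⟨a, h⟩ else 0

theorem coe_baryAff (a : E3) : ⇑(T.baryAff a) = T.bary a := by
  ext x
  unfold baryAff bary
  split_ifs <;> rfl

theorem bary_of_mem {a : E3} (ha : a ∈ T.verts) (x : E3) :
    T.bary a x = T.basis.coord ⟨a, ha⟩ x := by simp [bary, ha]

theorem bary_self {a : E3} (ha : a ∈ T.verts) : T.bary a a = 1 := by
  rw [bary_of_mem T ha]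
  exact T.basis.coord_apply_eq ⟨a, ha⟩

theorem bary_of_ne {a b : E3} (hb : b ∈ T.verts) (h : a ≠ b) : T.bary a b = 0 := by
  by_cases ha : a ∈ T.verts
  · rw [bary_of_mem T ha]
    exact T.basis.coord_apply_ne (i := ⟨a, ha⟩) (j := ⟨b, hb⟩) (by simpa using h)
  · simp [bary, ha]

theorem sum_bary (x : E3) : ∑ a ∈ T.verts, T.bary a x = 1 := by
  rw [← T.basis.sum_coord_apply_eq_one x, ← Finset.sum_coe_sort]
  exact Finset.sum_congr rfl fun a _ => T.bary_of_mem a.2 x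

theorem sum_bary_smul (x : E3) : ∑ a ∈ T.verts, T.bary a x • a = x := by
  conv_rhs => rw [← T.basis.linear_combination_coord_eq_self x]
  rw [← Finset.sum_coe_sort]
  exact Finset.sum_congr rfl fun a _ => by rw [T.bary_of_mem a.2 x]; rfl

theorem range_basis : range T.basis = (T.verts : Set E3) := Subtype.range_coe

theorem mem_carrier {x : E3} : x ∈ T.carrier ↔ ∀ a ∈ T.verts, 0 ≤ T.bary a x := by
  rw [carrier, ← range_basis, T.basis.convexHull_eq_nonneg_coord]
  simp only [mem_ofPred_eq, Subtype.forall]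
  exact forall₂_congr fun a ha => by rw [T.bary_of_mem ha]

theorem mem_interior {x : E3} : x ∈ interior T.carrier ↔ ∀ a ∈ T.verts, 0 < T.bary a x := by
  rw [carrier, ← range_basis, T.basis.interior_convexHull]
  simp only [mem_ofPred_eq, Subtype.forall]
  exact forall₂_congr fun a ha => by rw [T.bary_of_mem ha]

theorem isPolyFun_bary (a : E3) : IsPolyFun (T.bary a) := T.coe_baryAff a ▸ .affine _

theorem isCompact_carrier : IsCompact T.carrier := T.verts.finite_toSet.isCompact_convexHull ℝ

theorem convex_carrier : Convex ℝ T.carrier := convex_convexHull _ _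

theorem nonempty_interior : (interior T.carrier).Nonempty := by
  refine ⟨∑ a ∈ T.verts, (1 / 4 : ℝ) • a, T.mem_interior.2 fun a ha => ?_⟩
  have h : ∀ x, T.bary a x = T.baryAff a x := fun x => by rw [coe_baryAff]
  have h2 := Finset.map_affineCombination T.verts id (fun _ => (1 / 4 : ℝ)) (by simp [T.card_verts])
    (T.baryAff a)
  rw [Finset.affineCombination_eq_linear_combination _ _ _ (by simp [T.card_verts]),
    Finset.affineCombination_eq_linear_combination _ _ _ (by simp [T.card_verts])] at h2
  simp only [id, Function.comp_apply] at h2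
  rw [h, h2, ← Finset.smul_sum, coe_baryAff, Finset.sum_eq_single a
    (fun b hb hab => T.bary_of_ne hb hab.symm) (fun h => absurd ha h), T.bary_self ha]
  norm_num

theorem affine_eq_sum (M : E3 →ᵃ[ℝ] ℝ) (x : E3) : M x = ∑ a ∈ T.verts, T.bary a x * M a := by
  have h2 := Finset.map_affineCombination T.verts id (fun a => T.bary a x) (T.sum_bary x) M
  rw [Finset.affineCombination_eq_linear_combination _ _ _ (T.sum_bary x),
    Finset.affineCombination_eq_linear_combination _ _ _ (T.sum_bary x)] at h2
  simpa [T.sum_bary_smul] using h2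

/-- The gradient of a barycentric coordinate. -/
def grad (a : E3) : E3 :=
  (InnerProductSpace.toDual ℝ E3).symm (T.baryAff a).linear.toContinuousLinearMap

theorem inner_grad (a w : E3) : inner ℝ (T.grad a) w = (T.baryAff a).linear w := by
  simp [grad]

theorem inner_grad_sub (a x y : E3) : inner ℝ (T.grad a) (x - y) = T.bary a x - T.bary a y := by
  rw [inner_grad, ← coe_baryAff, ← vsub_eq_sub x, AffineMap.linearMap_vsub, vsub_eq_sub]

theorem pd_bary (w a : E3) : pd w (T.bary a) = fun _ => inner ℝ (T.grad a) w := by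
  rw [← coe_baryAff, pd_affine, inner_grad]

theorem inner_grad_sub_vertex {a b : E3} (ha : a ∈ T.verts) (hb : b ∈ T.verts) (hab : a ≠ b) :
    inner ℝ (T.grad a) (a - b) = 1 := by
  rw [inner_grad_sub, T.bary_self ha, T.bary_of_ne hb hab, sub_zero]

theorem exists_ne (a : E3) : ∃ b ∈ T.verts, a ≠ b := by
  have := Finset.exists_mem_ne (s := T.verts) (by rw [T.card_verts]; norm_num) a
  exact this.imp fun b h => ⟨h.1, h.2.symm⟩

theorem grad_ne_zero {a : E3} (ha : a ∈ T.verts) : T.grad a ≠ 0 := by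
  intro h
  obtain ⟨b, hb, hab⟩ := T.exists_ne a
  have := T.inner_grad_sub_vertex ha hb hab
  simp [h] at this

theorem bary_add (a x w : E3) : T.bary a (x + w) = T.bary a x + inner ℝ (T.grad a) w := by
  have := T.inner_grad_sub a (x + w) x
  rw [add_sub_cancel_left] at this
  linarith

theorem sum_inner_grad (w : E3) : ∑ a ∈ T.verts, inner ℝ (T.grad a) w = 0 := by
  have h := T.sum_bary (0 + w)
  simp only [T.bary_add, Finset.sum_add_distrib, T.sum_bary] at h
  linarith

theorem sum_inner_grad_smul (w : E3) : ∑ a ∈ T.verts, inner ℝ (T.grad a) w • a = w := by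
  have h := T.sum_bary_smul (0 + w)
  simp only [T.bary_add, add_smul, Finset.sum_add_distrib, T.sum_bary_smul] at h
  simpa using h

/-- Every vector is a combination of the edges that start at a given vertex. -/
theorem sum_inner_grad_smul_sub (w b : E3) :
    ∑ a ∈ T.verts, inner ℝ (T.grad a) w • (a - b) = w := by
  simp only [smul_sub, Finset.sum_sub_distrib, T.sum_inner_grad_smul, ← Finset.sum_smul,
    T.sum_inner_grad, zero_smul, sub_zero]

end Tet

/-! ### Averages over triangles and tetrahedra -/

/-- The affine map from the reference triangle to the triangle with vertices `a`, `b`, `c`. -/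
def triMap (a b c : E3) : (ℝ × ℝ) →ᵃ[ℝ] E3 :=
  ((LinearMap.fst ℝ ℝ ℝ).smulRight (b - a) + (LinearMap.snd ℝ ℝ ℝ).smulRight (c - a)).toAffineMap +
    AffineMap.const ℝ (ℝ × ℝ) a

/-- The affine map from the reference tetrahedron to the tetrahedron with vertices
`a`, `b`, `c`, `d`. -/
def tetMap (a b c d : E3) : ((ℝ × ℝ) × ℝ) →ᵃ[ℝ] E3 :=
  ((LinearMap.fst ℝ ℝ ℝ ∘ₗ LinearMap.fst ℝ (ℝ × ℝ) ℝ).smulRight (b - a) +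
    (LinearMap.snd ℝ ℝ ℝ ∘ₗ LinearMap.fst ℝ (ℝ × ℝ) ℝ).smulRight (c - a) +
    (LinearMap.snd ℝ (ℝ × ℝ) ℝ).smulRight (d - a)).toAffineMap +
    AffineMap.const ℝ ((ℝ × ℝ) × ℝ) a

theorem triMap_apply (a b c : E3) (z : ℝ × ℝ) :
    triMap a b c z = a + z.1 • (b - a) + z.2 • (c - a) := by
  simp [triMap]; abel

theorem tetMap_apply (a b c d : E3) (z : (ℝ × ℝ) × ℝ) :
    tetMap a b c d z = a + z.1.1 • (b - a) + z.1.2 • (c - a) + z.2 • (d - a) := by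
  simp [tetMap]; abel

theorem image_triMap (a b c : E3) : triMap a b c '' refTri = convexHull ℝ {a, b, c} := by
  apply Subset.antisymm
  · rintro _ ⟨z, hz, rfl⟩
    obtain ⟨h1, h2, h3⟩ := mem_refTri.1 hz
    have := (convex_convexHull ℝ ({a, b, c} : Set E3)).sum_mem (t := Finset.univ)
      (w := ![1 - z.1 - z.2, z.1, z.2]) (z := ![a, b, c]) (fun i _ => by
        fin_cases i <;> simp <;> linarith) (by simp [Fin.sum_univ_three]; ring) (fun i _ =>
        subset_convexHull ℝ _ (by fin_cases i <;> simp))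
    convert this using 1
    simp [Fin.sum_univ_three, triMap_apply, smul_sub, sub_smul]
    abel
  · refine convexHull_min ?_ ?_
    · rintro x (rfl | rfl | rfl)
      · exact ⟨(0, 0), mem_refTri.2 (by norm_num), by simp [triMap_apply]⟩
      · exact ⟨(1, 0), mem_refTri.2 (by norm_num), by simp [triMap_apply]⟩
      · exact ⟨(0, 1), mem_refTri.2 (by norm_num), by simp [triMap_apply]⟩
    · refine Convex.affine_image (triMap a b c) ?_
      intro x hx y hy s t hs ht hst
      obtain ⟨h1, h2, h3⟩ := mem_refTri.1 hx
      obtain ⟨h4, h5, h6⟩ := mem_refTri.1 hy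
      refine mem_refTri.2 ⟨?_, ?_, ?_⟩
      · simp; positivity
      · simp; positivity
      · simp; nlinarith

theorem image_tetMap (a b c d : E3) : tetMap a b c d '' refTet = convexHull ℝ {a, b, c, d} := by
  apply Subset.antisymm
  · rintro _ ⟨z, hz, rfl⟩
    obtain ⟨h1, h2, h3, h4⟩ := mem_refTet.1 hz
    have := (convex_convexHull ℝ ({a, b, c, d} : Set E3)).sum_mem (t := Finset.univ)
      (w := ![1 - z.1.1 - z.1.2 - z.2, z.1.1, z.1.2, z.2]) (z := ![a, b, c, d]) (fun i _ => by
        fin_cases i <;> simp <;> linarith) (by simp [Fin.sum_univ_four]; ring) (fun i _ =>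
        subset_convexHull ℝ _ (by fin_cases i <;> simp))
    convert this using 1
    simp [Fin.sum_univ_four, tetMap_apply, smul_sub, sub_smul]
    abel
  · refine convexHull_min ?_ ?_
    · rintro x (rfl | rfl | rfl | rfl)
      · exact ⟨((0, 0), 0), mem_refTet.2 (by norm_num), by simp [tetMap_apply]⟩
      · exact ⟨((1, 0), 0), mem_refTet.2 (by norm_num), by simp [tetMap_apply]⟩
      · exact ⟨((0, 1), 0), mem_refTet.2 (by norm_num), by simp [tetMap_apply]⟩
      · exact ⟨((0, 0), 1), mem_refTet.2 (by norm_num), by simp [tetMap_apply]⟩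
    · refine Convex.affine_image (tetMap a b c d) ?_
      intro x hx y hy s t hs ht hst
      obtain ⟨h1, h2, h3, h4⟩ := mem_refTet.1 hx
      obtain ⟨h5, h6, h7, h8⟩ := mem_refTet.1 hy
      refine mem_refTet.2 ⟨?_, ?_, ?_, ?_⟩
      · simp; positivity
      · simp; positivity
      · simp; positivity
      · simp; nlinarith

namespace Tet

variable (T : Tet)

/-- Three distinct vertices of a tetrahedron. -/
def IsTriple (a b c : E3) : Prop :=
  a ∈ T.verts ∧ b ∈ T.verts ∧ c ∈ T.verts ∧ a ≠ b ∧ a ≠ c ∧ b ≠ c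

variable {T}

theorem IsTriple.bary_triMap {a b c : E3} (h : T.IsTriple a b c) (z : ℝ × ℝ) :
    T.bary b (triMap a b c z) = z.1 ∧ T.bary c (triMap a b c z) = z.2 := by
  obtain ⟨ha, hb, hc, hab, hac, hbc⟩ := h
  simp only [triMap_apply, T.bary_add, inner_smul_right, inner_grad_sub, T.bary_self, hb, hc,
    T.bary_of_ne ha hab.symm, T.bary_of_ne ha hac.symm, T.bary_of_ne hb hbc.symm,
    T.bary_of_ne hc hbc]
  exact ⟨by ring, by ring⟩

theorem IsTriple.injective_triMap {a b c : E3} (h : T.IsTriple a b c) :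
    Function.Injective (triMap a b c) := fun y z hyz => by
  have h1 := h.bary_triMap y
  have h2 := h.bary_triMap z
  rw [hyz] at h1
  exact Prod.ext (h1.1.symm.trans h2.1) (h1.2.symm.trans h2.2)

theorem injective_tetMap {a b c d : E3} (hv : T.verts = {a, b, c, d}) (hab : a ≠ b) (hac : a ≠ c)
    (had : a ≠ d) (hbc : b ≠ c) (hbd : b ≠ d) (hcd : c ≠ d) :
    Function.Injective (tetMap a b c d) := by
  have ha : a ∈ T.verts := by simp [hv]
  have hb : b ∈ T.verts := by simp [hv]
  have hc : c ∈ T.verts := by simp [hv]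
  have hd : d ∈ T.verts := by simp [hv]
  have key : ∀ z, T.bary b (tetMap a b c d z) = z.1.1 ∧ T.bary c (tetMap a b c d z) = z.1.2 ∧
      T.bary d (tetMap a b c d z) = z.2 := by
    intro z
    simp only [tetMap_apply, T.bary_add, inner_smul_right, inner_grad_sub, T.bary_self, hb, hc, hd,
      T.bary_of_ne ha hab.symm, T.bary_of_ne ha hac.symm, T.bary_of_ne ha had.symm,
      T.bary_of_ne hb hbc.symm, T.bary_of_ne hb hbd.symm, T.bary_of_ne hc hbc,
      T.bary_of_ne hc hcd.symm, T.bary_of_ne hd hbd, T.bary_of_ne hd hcd]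
    exact ⟨by ring, by ring, by ring⟩
  intro y z hyz
  have h1 := key y
  have h2 := key z
  rw [hyz] at h1
  exact Prod.ext (Prod.ext (h1.1.symm.trans h2.1) (h1.2.1.symm.trans h2.2.1))
    (h1.2.2.symm.trans h2.2.2)

theorem image_triMap_eq_triangle {a b c : E3} :
    triMap a b c '' refTri = triangle ({a, b, c} : Finset E3) := by
  rw [_root_.image_triMap, triangle]
  simp

theorem IsTriple.setAverage_triangle {a b c : E3} (h : T.IsTriple a b c) (f : E3 → ℝ) :
    ⨍ x in triangle ({a, b, c} : Finset E3), f x ∂μHE[2] = ⨍ z in refTri, f (triMap a b c z) := by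
  rw [← image_triMap_eq_triangle]
  exact setAverage_image (by simp) _ h.injective_triMap _ _

theorem euclideanHausdorffMeasure_three : (μHE[3] : Measure E3) = volume :=
  EuclideanSpace.euclideanHausdorffMeasure_eq_volume 3

theorem setAverage_carrier {a b c d : E3} (hv : T.verts = {a, b, c, d}) (hab : a ≠ b) (hac : a ≠ c)
    (had : a ≠ d) (hbc : b ≠ c) (hbd : b ≠ d) (hcd : c ≠ d) (f : E3 → ℝ) :
    ⨍ x in T.carrier, f x = ⨍ z in refTet, f (tetMap a b c d z) := by
  have : T.carrier = tetMap a b c d '' refTet := by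
    rw [image_tetMap, carrier, hv]
    simp
  have : (volume : Measure ((ℝ × ℝ) × ℝ)).IsAddHaarMeasure :=
    inferInstanceAs (volume.prod volume).IsAddHaarMeasure
  rw [‹T.carrier = _›, ← euclideanHausdorffMeasure_three]
  exact setAverage_image (by simp) _ (injective_tetMap hv hab hac had hbc hbd hcd) _ _

theorem exists_isTriple {F : Finset E3} (hF : F ⊆ T.verts) (hc : F.card = 3) :
    ∃ a b c, T.IsTriple a b c ∧ F = {a, b, c} := by
  obtain ⟨a, b, c, hab, hac, hbc, rfl⟩ := Finset.card_eq_three.1 hc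
  exact ⟨a, b, c, ⟨hF (by simp), hF (by simp), hF (by simp), hab, hac, hbc⟩, rfl⟩

theorem isCompact_triangle (F : Finset E3) : IsCompact (triangle F) :=
  F.finite_toSet.isCompact_convexHull ℝ

theorem measure_triangle_lt_top {F : Finset E3} (hF : F ⊆ T.verts) (hc : F.card = 3) :
    (μHE[2] : Measure E3) (triangle F) < ⊤ := by
  obtain ⟨a, b, c, h, rfl⟩ := exists_isTriple hF hc
  obtain ⟨hme, k, -, hk, hm⟩ :=
    exists_restrict_image_eq_smul_map (d := 2) (by simp) _ h.injective_triMap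
  rw [← image_triMap_eq_triangle, ← Measure.restrict_apply_univ, hm, Measure.smul_apply,
    hme.map_apply, preimage_univ, Measure.restrict_apply_univ]
  exact ENNReal.mul_lt_top hk.lt_top isCompact_refTri.measure_lt_top

theorem integrableOn_triangle {F : Finset E3} (hF : F ⊆ T.verts) (hc : F.card = 3) {f : E3 → ℝ}
    (hf : Continuous f) : IntegrableOn f (triangle F) μHE[2] :=
  hf.continuousOn.integrableOn_of_subset_isCompact (isCompact_triangle F)
    (isCompact_triangle F).measurableSet subset_rfl (measure_triangle_lt_top hF hc).ne


theorem hasDerivAt_comp_line {f : E3 → ℝ} (hf : IsPolyFun f) (p w : E3) (t : ℝ) :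
    HasDerivAt (fun t : ℝ => f (p + t • w)) (pd w f (p + t • w)) t := by
  have h1 : HasDerivAt (fun t : ℝ => p + t • w) w t := by
    simpa using ((hasDerivAt_id t).smul_const w).const_add p
  exact hf.differentiableAt.hasFDerivAt.comp_hasDerivAt t h1

/-- On a face, the tangential derivative along an edge of a function that vanishes on the edges has
mean zero. -/
theorem IsTriple.setAverage_pd_edge {a b c : E3} (h : T.IsTriple a b c) {f : E3 → ℝ}
    (hf : IsPolyFun f) (h1 : ∀ x ∈ segment ℝ a b, f x = 0) (h2 : ∀ x ∈ segment ℝ b c, f x = 0) :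
    ⨍ x in triangle ({a, b, c} : Finset E3), pd (c - a) f x ∂μHE[2] = 0 := by
  rw [h.setAverage_triangle, setAverage_refTri,
    setIntegral_refTri_deriv (f := fun z => f (triMap a b c z))]
  · rw [setIntegral_eq_zero_of_forall_eq_zero, mul_zero]
    intro s hs
    have e1 : f (triMap a b c (s, 1 - s)) = 0 := by
      refine h2 _ ⟨s, 1 - s, hs.1, by linarith [hs.2], by ring, ?_⟩
      rw [triMap_apply]
      module
    have e2 : f (triMap a b c (s, 0)) = 0 := by
      refine h1 _ ⟨1 - s, s, by linarith [hs.2], hs.1, by ring, ?_⟩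
      rw [triMap_apply]
      module
    rw [e1, e2, sub_zero]
  · exact (hf.pd _).continuous.comp (triMap a b c).continuous_of_finiteDimensional
  · intro s t
    simp only [triMap_apply]
    exact hasDerivAt_comp_line hf _ _ t

/-- On a face, the derivative in a tangential direction of a function that vanishes on the edges has
mean zero. -/
theorem setIntegral_pd_face {a : E3} (ha : a ∈ T.verts) {w : E3} (hw : inner ℝ (T.grad a) w = 0)
    {f : E3 → ℝ} (hf : IsPolyFun f)
    (h0 : ∀ b ∈ T.verts.erase a, ∀ c ∈ T.verts.erase a, ∀ x ∈ segment ℝ b c, f x = 0) :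
    ∫ x in triangle (T.verts.erase a), pd w f x ∂μHE[2] = 0 := by
  have hF : T.verts.erase a ⊆ T.verts := Finset.erase_subset _ _
  have hcard : (T.verts.erase a).card = 3 := by rw [Finset.card_erase_of_mem ha, T.card_verts]
  obtain ⟨p, q, r, h, hv⟩ := exists_isTriple hF hcard
  have key : ∀ b ∈ T.verts.erase a, ∀ c ∈ T.verts.erase a,
      ∫ x in triangle (T.verts.erase a), pd (b - c) f x ∂μHE[2] = 0 := by
    intro b hb c hc
    by_cases hbc : b = c
    · simp [hbc, pd]
    obtain ⟨d, hd, hdb, hdc⟩ : ∃ d ∈ T.verts.erase a, d ≠ b ∧ d ≠ c := by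
      have : ((T.verts.erase a).erase b).erase c |>.Nonempty := by
        rw [← Finset.card_pos, Finset.card_erase_of_mem (Finset.mem_erase.2 ⟨Ne.symm hbc, hc⟩),
          Finset.card_erase_of_mem hb, hcard]
        norm_num
      obtain ⟨d, hd⟩ := this
      simp only [Finset.mem_erase] at hd
      exact ⟨d, Finset.mem_erase.2 hd.2.2, hd.2.1, hd.1⟩
    have ht : T.IsTriple c d b := ⟨hF hc, hF hd, hF hb, hdc.symm, Ne.symm hbc, hdb⟩
    have hcard' : ({c, d, b} : Finset E3).card = 3 :=
      Finset.card_eq_three.2 ⟨c, d, b, hdc.symm, Ne.symm hbc, hdb, rfl⟩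
    have hv' : T.verts.erase a = {c, d, b} := by
      refine (Finset.eq_of_subset_of_card_le ?_ (by rw [hcard, hcard'])).symm
      intro x hx
      simp only [Finset.mem_insert, Finset.mem_singleton] at hx
      rcases hx with rfl | rfl | rfl <;> assumption
    have := ht.setAverage_pd_edge hf (h0 c hc d hd) (h0 d hd b hb)
    rw [hv']
    rw [setAverage_eq, smul_eq_mul, mul_eq_zero] at this
    rcases this with h' | h'
    · rw [inv_eq_zero, measureReal_def, ENNReal.toReal_eq_zero_iff, ← hv',
        or_iff_left (measure_triangle_lt_top hF hcard).ne] at h'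
      rw [← hv', Measure.restrict_eq_zero.2 h', integral_zero_measure]
    · exact h'
  have hp : p ∈ T.verts.erase a := by simp [hv]
  have hsum : pd w f = ∑ b ∈ T.verts.erase a, inner ℝ (T.grad b) w • pd (b - p) f := by
    have h1 := T.sum_inner_grad_smul_sub w p
    rw [← Finset.add_sum_erase _ _ ha, hw, zero_smul, zero_add] at h1
    ext x
    conv_lhs => rw [← h1]
    simp [pd]
  rw [hsum]
  simp only [Finset.sum_apply, Pi.smul_apply, smul_eq_mul]
  rw [integral_finsetSum]
  · refine Finset.sum_eq_zero fun b hb => ?_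
    rw [integral_const_mul, key b hb p hp, mul_zero]
  · intro b _
    exact (integrableOn_triangle hF hcard (hf.pd (b - p)).continuous).const_mul _

theorem setAverage_pd_edge {a b : E3} (ha : a ∈ T.verts) (hb : b ∈ T.verts) {f : E3 → ℝ}
    (hf : IsPolyFun f) :
    ⨍ x in T.carrier, pd (a - b) f x = 3 * (⨍ x in triangle (T.verts.erase b), f x ∂μHE[2] -
      ⨍ x in triangle (T.verts.erase a), f x ∂μHE[2]) := by
  by_cases hab : a = b
  · simp [hab, pd]
  obtain ⟨c, d, hcd, hcd'⟩ : ∃ c d, c ≠ d ∧ (T.verts.erase a).erase b = {c, d} := by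
    rw [← Finset.card_eq_two, Finset.card_erase_of_mem (Finset.mem_erase.2 ⟨Ne.symm hab, hb⟩),
      Finset.card_erase_of_mem ha, T.card_verts]
  have hc : c ∈ (T.verts.erase a).erase b := by simp [hcd']
  have hd : d ∈ (T.verts.erase a).erase b := by simp [hcd']
  simp only [Finset.mem_erase] at hc hd
  have e1 : T.verts.erase a = {b, c, d} := by
    rw [← hcd', Finset.insert_erase (Finset.mem_erase.2 ⟨Ne.symm hab, hb⟩)]
  have e2 : T.verts.erase b = {a, c, d} := by
    rw [← hcd', Finset.erase_right_comm, Finset.insert_erase (Finset.mem_erase.2 ⟨hab, ha⟩)]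
  have e3 : T.verts = {b, c, d, a} := by
    rw [← Finset.insert_erase ha, e1]
    ext x
    simp only [Finset.mem_insert, Finset.mem_singleton]
    tauto
  have t1 : T.IsTriple b c d := ⟨hb, hc.2.2, hd.2.2, Ne.symm hc.1, Ne.symm hd.1, hcd⟩
  have t2 : T.IsTriple a c d := ⟨ha, hc.2.2, hd.2.2, Ne.symm hc.2.1, Ne.symm hd.2.1, hcd⟩
  have hcont := hf.continuous
  have c1 := (triMap b c d).continuous_of_finiteDimensional
  have c2 := (triMap a c d).continuous_of_finiteDimensional
  rw [setAverage_carrier e3 t1.2.2.2.1 t1.2.2.2.2.1 (Ne.symm hab) hcd hc.2.1 hd.2.1, e1, e2,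
    t1.setAverage_triangle, t2.setAverage_triangle, setAverage_refTet, setAverage_refTri,
    setAverage_refTri, setIntegral_refTet_deriv (f := fun z => f (tetMap b c d a z))]
  · rw [← mul_sub, ← integral_sub, ← mul_assoc]
    · norm_num
      congr 1
      ext z
      congr 2
      · rw [tetMap_apply, triMap_apply]
        module
      · rw [tetMap_apply, triMap_apply]
        module
    · exact (hcont.comp c2).continuousOn.integrableOn_compact isCompact_refTri
    · exact (hcont.comp c1).continuousOn.integrableOn_compact isCompact_refTri
  · exact (hf.pd _).continuous.comp (tetMap b c d a).continuous_of_finiteDimensional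
  · intro z t
    simp only [tetMap_apply]
    exact hasDerivAt_comp_line hf _ _ t

/-- The divergence theorem on a tetrahedron, for polynomial functions: the outer normal of the face
opposite to `a`, scaled by the area of the face, is `-3 |T|` times the gradient of `T.bary a`. -/
theorem setIntegral_pd {f : E3 → ℝ} (hf : IsPolyFun f) (w : E3) :
    ∫ x in T.carrier, pd w f x = -3 * volume.real T.carrier * ∑ a ∈ T.verts,
      inner ℝ (T.grad a) w * ⨍ x in triangle (T.verts.erase a), f x ∂μHE[2] := by
  obtain ⟨b, hb, -⟩ := T.exists_ne 0
  have hfin : volume T.carrier ≠ ⊤ := T.isCompact_carrier.measure_lt_top.ne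
  have hsum : pd w f = ∑ a ∈ T.verts, inner ℝ (T.grad a) w • pd (a - b) f := by
    ext x
    conv_lhs => rw [← T.sum_inner_grad_smul_sub w b]
    simp [pd]
  have hvol : ∀ a ∈ T.verts, ∫ x in T.carrier, pd (a - b) f x =
      volume.real T.carrier * (3 * (⨍ x in triangle (T.verts.erase b), f x ∂μHE[2] -
      ⨍ x in triangle (T.verts.erase a), f x ∂μHE[2])) := fun a ha => by
    rw [← setAverage_pd_edge ha hb hf, ← smul_eq_mul, measure_smul_setAverage _ hfin]
  rw [hsum]
  simp only [Finset.sum_apply, Pi.smul_apply, smul_eq_mul]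
  rw [integral_finsetSum]
  · have h0 := T.sum_inner_grad w
    have h1 : ∑ a ∈ T.verts, ∫ x in T.carrier, inner ℝ (T.grad a) w * pd (a - b) f x =
        (∑ a ∈ T.verts, inner ℝ (T.grad a) w) * (3 * volume.real T.carrier *
          ⨍ x in triangle (T.verts.erase b), f x ∂μHE[2]) +
        -3 * volume.real T.carrier * ∑ a ∈ T.verts,
      inner ℝ (T.grad a) w * ⨍ x in triangle (T.verts.erase a), f x ∂μHE[2] := by
      rw [Finset.sum_mul, Finset.mul_sum, ← Finset.sum_add_distrib]
      refine Finset.sum_congr rfl fun a ha => ?_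
      rw [integral_const_mul, hvol a ha]
      ring
    rw [h1, h0, zero_mul, zero_add]
  · intro a _
    exact ((hf.pd (a - b)).continuous.continuousOn.integrableOn_compact
      T.isCompact_carrier).const_mul _

end Tet

namespace Tet

variable {T : Tet}

/-! ### Faces -/

theorem exists_eq_erase {F : Finset E3} (hF : F ⊆ T.verts) (hc : F.card = 3) :
    ∃ a ∈ T.verts, a ∉ F ∧ F = T.verts.erase a := by
  obtain ⟨a, ha, haF⟩ := Finset.exists_mem_notMem_of_card_lt_card
    (s := F) (t := T.verts) (by rw [hc, T.card_verts]; norm_num)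
  refine ⟨a, ha, haF, Finset.eq_of_subset_of_card_le (Finset.subset_erase.2 ⟨hF, haF⟩) ?_⟩
  rw [Finset.card_erase_of_mem ha, T.card_verts, hc]

theorem card_erase {a : E3} (ha : a ∈ T.verts) : (T.verts.erase a).card = 3 := by
  rw [Finset.card_erase_of_mem ha, T.card_verts]

theorem mem_triangle {a : E3} (ha : a ∈ T.verts) {x : E3} :
    x ∈ triangle (T.verts.erase a) ↔ T.bary a x = 0 ∧ ∀ b ∈ T.verts.erase a, 0 ≤ T.bary b x := by
  constructor
  · intro hx
    have h1 : x ∈ T.carrier :=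
      convexHull_mono (by exact_mod_cast Finset.erase_subset a T.verts) hx
    refine ⟨?_, fun b hb => T.mem_carrier.1 h1 b (Finset.mem_of_mem_erase hb)⟩
    have h2 : triangle (T.verts.erase a) ⊆ T.baryAff a ⁻¹' {0} := by
      refine convexHull_min (fun b hb => ?_) ((convex_singleton 0).affine_preimage _)
      rw [Finset.mem_coe, Finset.mem_erase] at hb
      simp [coe_baryAff, T.bary_of_ne hb.2 hb.1.symm]
    simpa [coe_baryAff] using h2 hx
  · rintro ⟨h0, h⟩
    have h1 := T.sum_bary_smul x
    have h2 := T.sum_bary x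
    rw [← Finset.add_sum_erase _ _ ha, h0] at h1 h2
    rw [zero_smul, zero_add] at h1
    rw [zero_add] at h2
    rw [← h1]
    exact (convex_convexHull ℝ _).sum_mem h h2 fun b hb => subset_convexHull ℝ _ hb

theorem volBubble_eq {a : E3} (ha : a ∈ T.verts) :
    T.volBubble = T.bary a * T.faceBubble (T.verts.erase a) := by
  ext x
  exact (Finset.mul_prod_erase _ _ ha).symm

theorem isPolyFun_faceBubble (F : Finset E3) : IsPolyFun (T.faceBubble F) := by
  have : T.faceBubble F = ∏ a ∈ F, T.bary a := by ext x; simp [faceBubble]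
  rw [this]
  exact .prod fun a _ => T.isPolyFun_bary a

theorem isPolyFun_volBubble : IsPolyFun T.volBubble := T.isPolyFun_faceBubble T.verts

theorem faceBubble_eq_zero {F : Finset E3} {a : E3} (ha : a ∈ F) {x : E3} (h : T.bary a x = 0) :
    T.faceBubble F x = 0 := Finset.prod_eq_zero ha h

/-- On a common face of two tetrahedra, the barycentric coordinates agree. -/
theorem bary_eq_of_common_face {S : Tet} {F : Finset E3} (hS : F ⊆ S.verts) (hT : F ⊆ T.verts)
    (hc : F.card = 3) {x : E3} (hx : x ∈ triangle F) {b : E3} (hb : b ∈ F) :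
    S.bary b x = T.bary b x := by
  obtain ⟨a, ha, haF, rfl⟩ := S.exists_eq_erase hS hc
  have h0 := ((S.mem_triangle ha).1 hx).1
  have h := S.affine_eq_sum (T.baryAff b) x
  rw [coe_baryAff, ← Finset.add_sum_erase _ _ ha, h0, zero_mul, zero_add,
    Finset.sum_eq_single b (fun c hc hcb => by rw [T.bary_of_ne (hT hc) hcb.symm, mul_zero])
    (fun h => absurd hb h), T.bary_self (hT hb), mul_one] at h
  exact h.symm

theorem faceBubble_eq_of_common_face {S : Tet} {F : Finset E3} (hS : F ⊆ S.verts)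
    (hT : F ⊆ T.verts) (hc : F.card = 3) {x : E3} (hx : x ∈ triangle F) :
    S.faceBubble F x = T.faceBubble F x :=
  Finset.prod_congr rfl fun _ hb => bary_eq_of_common_face hS hT hc hx hb

/-! ### Functions that vanish on the edges of a face -/

theorem _root_.IsPolyFun.eq_zero_on_line {f : E3 → ℝ} (hf : IsPolyFun f) {b c : E3}
    (h : ∀ x ∈ segment ℝ b c, f x = 0) (t : ℝ) : f (b + t • (c - b)) = 0 := by
  have ha : AnalyticOnNhd ℝ (fun t : ℝ => f (b + t • (c - b))) univ := by
    have h1 : AnalyticOnNhd ℝ (fun t : ℝ => b + t • (c - b)) univ :=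
      analyticOnNhd_const.add (analyticOnNhd_id.smul analyticOnNhd_const)
    exact hf.analyticOnNhd.comp h1 (mapsTo_univ _ _)
  have := ha.eq_of_eventuallyEq (g := 0) analyticOnNhd_const (z₀ := 1 / 2) ?_
  · exact congrFun this t
  · filter_upwards [Ioo_mem_nhds (a := (0 : ℝ)) (b := 1) (by norm_num) (by norm_num)] with s hs
    exact h _ ⟨1 - s, s, by linarith [hs.2], hs.1.le, by ring, by module⟩

/-- If `M * g` vanishes along a line on which the affine function `M` is not constant, then so does
the continuous function `g`. -/
theorem eq_zero_of_mul_line {M : E3 →ᵃ[ℝ] ℝ} {g : E3 → ℝ} (hg : Continuous g) {e x : E3}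
    (he : M.linear e ≠ 0) (h : ∀ t : ℝ, M (x + t • e) * g (x + t • e) = 0) : g x = 0 := by
  have h1 : ∀ t : ℝ, M (x + t • e) = M x + t * M.linear e := fun t => by
    have := map_sub_smul M e x (-t)
    rw [neg_smul, sub_neg_eq_add] at this
    rw [this]; ring
  have h2 : ∀ᶠ t : ℝ in 𝓝[≠] 0, g (x + t • e) = 0 := by
    have h3 : ∀ᶠ t : ℝ in 𝓝[≠] 0, M x + t * M.linear e ≠ 0 := by
      by_cases h0 : M x = 0
      · filter_upwards [self_mem_nhdsWithin] with t ht
        rw [h0, zero_add]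
        exact mul_ne_zero ht he
      · refine nhdsWithin_le_nhds (ContinuousAt.eventually_ne (by fun_prop) (by simpa using h0))
    filter_upwards [h3] with t ht
    exact (mul_eq_zero.1 (h t)).resolve_left (by rwa [h1])
  have h4 : Tendsto (fun t : ℝ => g (x + t • e)) (𝓝[≠] 0) (𝓝 (g x)) := by
    have : Continuous fun t : ℝ => g (x + t • e) := by fun_prop
    have := this.tendsto 0
    simp only [zero_smul, add_zero] at this
    exact this.mono_left nhdsWithin_le_nhds
  exact tendsto_nhds_unique (h4.congr' h2) tendsto_const_nhds |>.symm ▸ rfl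

/-- A polynomial function of degree `k + 3` that vanishes on the edges of a face is, on this face,
a multiple of the face bubble. -/
theorem exists_eq_faceBubble_mul {a : E3} (ha : a ∈ T.verts) {k : ℕ} {f : E3 → ℝ}
    (hf : f ∈ polyFun (k + 3))
    (h0 : ∀ b ∈ T.verts.erase a, ∀ c ∈ T.verts.erase a, ∀ x ∈ segment ℝ b c, f x = 0) :
    ∃ g ∈ polyFun k, ∀ x, T.bary a x = 0 →
      f x = T.faceBubble (T.verts.erase a) x * g x := by
  obtain ⟨p, q, r, ⟨hp, hq, hr, hpq, hpr, hqr⟩, hv⟩ :=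
    exists_isTriple (T.verts.erase_subset a) (card_erase ha)
  have hpF : p ∈ T.verts.erase a := by simp [hv]
  have hqF : q ∈ T.verts.erase a := by simp [hv]
  have hrF : r ∈ T.verts.erase a := by simp [hv]
  have hpa : a ≠ p := (Finset.ne_of_mem_erase hpF).symm
  have hqa : a ≠ q := (Finset.ne_of_mem_erase hqF).symm
  have hra : a ≠ r := (Finset.ne_of_mem_erase hrF).symm
  set π := planeProj (T.baryAff a) (a - p) with hπ
  have hπ0 : ∀ x, T.bary a (π x) = 0 := fun x => by
    rw [← coe_baryAff]
    exact apply_planeProj (by rw [← inner_grad, T.inner_grad_sub_vertex ha hp hpa]) x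
  set M : E3 → E3 →ᵃ[ℝ] ℝ := fun b => (T.baryAff b).comp π with hM
  have hMx : ∀ b x, M b x = T.bary b (π x) := fun b x => by simp [hM, coe_baryAff]
  -- tangential directions are not changed by the projection
  have hMlin : ∀ b, ∀ c ∈ T.verts.erase a, ∀ d ∈ T.verts.erase a,
      (M b).linear (c - d) = T.bary b c - T.bary b d := by
    intro b c hc d hd
    have h1 : ∀ c ∈ T.verts.erase a, π c = c := fun c hc => by
      rw [hπ, planeProj_apply, coe_baryAff,
        T.bary_of_ne (Finset.mem_of_mem_erase hc) (Finset.ne_of_mem_erase hc).symm]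
      simp
    rw [← vsub_eq_sub c d, AffineMap.linearMap_vsub, vsub_eq_sub, hMx, hMx, h1 c hc, h1 d hd]
  have hzero : ∀ b c d : E3, T.verts.erase a = {b, c, d} → b ≠ c → b ≠ d → c ≠ d →
      ∀ x, M b x = 0 → f (π x) = 0 := by
    intro b c d hbcd hbc hbd hcd x hx
    have hc : c ∈ T.verts.erase a := by simp [hbcd]
    have hd : d ∈ T.verts.erase a := by simp [hbcd]
    have h1 := T.sum_bary_smul (π x)
    have h2 := T.sum_bary (π x)
    rw [← Finset.add_sum_erase _ _ ha, hπ0, hbcd, Finset.sum_insert (by simp [hbc, hbd]),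
      Finset.sum_pair hcd, ← hMx b, hx] at h1 h2
    have h3 := IsPolyFun.eq_zero_on_line ⟨_, hf⟩ (h0 c hc d hd) (T.bary d (π x))
    have h4 : c + T.bary d (π x) • (d - c) = π x := by
      have h5 : T.bary c (π x) = 1 - T.bary d (π x) := by linarith
      rw [h5] at h1
      conv_rhs => rw [← h1]
      module
    rwa [h4] at h3
  have s1 : T.bary p p = 1 := T.bary_self hp
  have s2 : T.bary q q = 1 := T.bary_self hq
  have s3 : T.bary r r = 1 := T.bary_self hr
  have s4 : T.bary p q = 0 := T.bary_of_ne hq hpq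
  have s5 : T.bary p r = 0 := T.bary_of_ne hr hpr
  have s6 : T.bary q p = 0 := T.bary_of_ne hp hpq.symm
  have s7 : T.bary q r = 0 := T.bary_of_ne hr hqr
  have s8 : T.bary r p = 0 := T.bary_of_ne hp hpr.symm
  have s9 : T.bary r q = 0 := T.bary_of_ne hq hqr.symm
  have hline : ∀ (b : E3) (x e : E3) (t : ℝ), (M b).linear e = 0 → M b (x + t • e) = M b x := by
    intro b x e t h
    have := map_sub_smul (M b) e x (-t)
    rw [neg_smul, sub_neg_eq_add, h] at this
    rw [this]; ring
  obtain ⟨g₁, hg₁, e₁⟩ := exists_eq_mul_of_eq_zero (L := M p) (e := p - q)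
    (by rw [hMlin p p hpF q hqF, s1, s4, sub_zero]) (comp_affine_mem_polyFun π hf)
    (hzero p q r hv hpq hpr hqr)
  obtain ⟨g₂, hg₂, e₂⟩ := exists_eq_mul_of_eq_zero (L := M q) (e := q - r)
    (by rw [hMlin q q hqF r hrF, s2, s7, sub_zero]) hg₁ (fun x hx => by
      refine eq_zero_of_mul_line (M := M p) (e := p - r) (IsPolyFun.continuous ⟨_, hg₁⟩)
        (by rw [hMlin p p hpF r hrF, s1, s5]; norm_num) fun t => ?_
      rw [← e₁]
      refine hzero q p r ?_ hpq.symm hqr hpr _ ?_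
      · rw [hv, Finset.insert_comm]
      · rw [hline, hx]
        rw [hMlin q p hpF r hrF, s6, s7, sub_zero])
  obtain ⟨g₃, hg₃, e₃⟩ := exists_eq_mul_of_eq_zero (L := M r) (e := r - p)
    (by rw [hMlin r r hrF p hpF, s3, s8, sub_zero]) hg₂ (fun x hx => by
      refine eq_zero_of_mul_line (M := M q) (e := q - p) (IsPolyFun.continuous ⟨_, hg₂⟩)
        (by rw [hMlin q q hqF p hpF, s2, s6]; norm_num) fun t => ?_
      rw [← e₂]
      refine eq_zero_of_mul_line (M := M p) (e := p - q) (IsPolyFun.continuous ⟨_, hg₁⟩)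
        (by rw [hMlin p p hpF q hqF, s1, s4]; norm_num) fun t' => ?_
      rw [← e₁]
      refine hzero r p q ?_ hpr.symm hqr.symm hpq _ ?_
      · rw [hv, Finset.insert_comm, Finset.pair_comm, Finset.insert_comm]
        ext x; simp; tauto
      · rw [hline, hline, hx]
        · rw [hMlin r q hqF p hpF, s8, s9, sub_zero]
        · rw [hMlin r p hpF q hqF, s8, s9, sub_zero])
  refine ⟨g₃, hg₃, fun x hx => ?_⟩
  have hx' : π x = x := by rw [hπ, planeProj_apply, coe_baryAff, hx, zero_smul, sub_zero]
  have h1 := e₁ x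
  rw [e₂, e₃, hMx, hMx, hMx, hx'] at h1
  rw [h1, hv, faceBubble, Finset.prod_insert (by simp [hpq, hpr]), Finset.prod_pair hqr]
  ring

/-! ### The bubble functions -/

theorem lagrangeSpan_le (m : ℕ) (F : Finset E3) : T.lagrangeSpan m F ≤ polyFun m :=
  Submodule.span_le.2 fun _ ⟨⟨_, h⟩, _⟩ => h.1

/-- The span of the bubble functions `ξ_i^F` of all faces of `T`. -/
def bubbleSpan (ℓ : ℕ) (T : Tet) (B : ∀ F : T.Face, FaceBubbleData ℓ T F.1) :
    Submodule ℝ (E3 → ℝ) :=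
  Submodule.span ℝ {f | ∃ (F : T.Face) (i : Fin (faceDim ℓ F.1)), f = (B F).xi i}

variable {ℓ : ℕ}

theorem xi_eq {F : Finset E3} (B : FaceBubbleData ℓ T F) (i : Fin (faceDim ℓ F)) {a : E3}
    (ha : a ∈ T.verts) : B.xi i = T.bary a * (T.faceBubble (T.verts.erase a) *
      (T.faceBubble F * B.phiT i - T.volBubble * B.r i)) := by
  rw [← mul_assoc, ← volBubble_eq ha]
  ext x
  simp [FaceBubbleData.xi]
  ring

theorem isPolyFun_phiT {F : Finset E3} (B : FaceBubbleData ℓ T F) (i : Fin (faceDim ℓ F)) :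
    IsPolyFun (B.phiT i) := ⟨_, lagrangeSpan_le _ _ (B.phiT_mem i)⟩

theorem isPolyFun_xi_factor {F : Finset E3} (B : FaceBubbleData ℓ T F) (i : Fin (faceDim ℓ F)) :
    IsPolyFun (T.faceBubble F * B.phiT i - T.volBubble * B.r i) :=
  ((isPolyFun_faceBubble F).mul (isPolyFun_phiT B i)).sub (isPolyFun_volBubble.mul ⟨_, B.r_mem i⟩)

theorem isPolyFun_xi {F : Finset E3} (B : FaceBubbleData ℓ T F) (i : Fin (faceDim ℓ F)) :
    IsPolyFun (B.xi i) := by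
  obtain ⟨a, ha, -⟩ := T.exists_ne 0
  rw [xi_eq B i ha]
  exact (T.isPolyFun_bary a).mul ((isPolyFun_faceBubble _).mul (isPolyFun_xi_factor B i))

theorem pd_xi {F : Finset E3} (B : FaceBubbleData ℓ T F) (i : Fin (faceDim ℓ F)) {a : E3}
    (ha : a ∈ T.verts) (w : E3) {x : E3} (hx : T.bary a x = 0) :
    pd w (B.xi i) x = inner ℝ (T.grad a) w *
      (T.faceBubble (T.verts.erase a) x * (T.faceBubble F x * B.phiT i x)) := by
  rw [xi_eq B i ha, pd_mul w (T.isPolyFun_bary a)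
    ((isPolyFun_faceBubble _).mul (isPolyFun_xi_factor B i)), pd_bary]
  simp [hx, volBubble_eq ha]

variable {B : ∀ F : T.Face, FaceBubbleData ℓ T F.1} {f : E3 → ℝ}

theorem isPolyFun_of_mem_bubbleSpan (hf : f ∈ bubbleSpan ℓ T B) : IsPolyFun f := by
  refine Submodule.span_induction ?_ (.const 0) (fun _ _ _ _ => .add) (fun c _ _ => .smul c) hf
  rintro _ ⟨F, i, rfl⟩
  exact isPolyFun_xi _ _

theorem bubble_eq_zero (hf : f ∈ bubbleSpan ℓ T B) {a : E3} (ha : a ∈ T.verts) {x : E3}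
    (hx : T.bary a x = 0) : f x = 0 := by
  refine Submodule.span_induction (p := fun f _ => f x = 0) ?_ rfl
    (fun f g _ _ h1 h2 => by simp [h1, h2]) (fun c f _ h => by simp [h]) hf
  rintro _ ⟨F, i, rfl⟩
  simp [xi_eq _ _ ha, hx]

/-- On a face, the derivatives of the bubble functions vanish where the face bubble does; in
particular this holds on the edges. -/
theorem pd_bubble_eq_zero (hf : f ∈ bubbleSpan ℓ T B) {a : E3} (ha : a ∈ T.verts) {x : E3}
    (hx : T.bary a x = 0) (hx' : T.faceBubble (T.verts.erase a) x = 0) (w : E3) :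
    pd w f x = 0 := by
  refine Submodule.span_induction (p := fun f _ => pd w f x = 0) ?_ ?_ ?_ ?_ hf
  · rintro _ ⟨F, i, rfl⟩
    simp [pd_xi _ _ ha w hx, hx']
  · simp [pd_zero]
  · intro f g hf hg h1 h2
    simp [pd_add w (isPolyFun_of_mem_bubbleSpan hf) (isPolyFun_of_mem_bubbleSpan hg), h1, h2]
  · intro c f hf h
    simp [pd_smul w c (isPolyFun_of_mem_bubbleSpan hf), h]

theorem face_eq_erase (F : T.Face) {a : E3} (ha : a ∈ T.verts) (haF : a ∉ F.1) :
    F.1 = T.verts.erase a := by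
  obtain ⟨b, hb, hbF, h⟩ := T.exists_eq_erase F.2.1 F.2.2
  have : a = b := by
    by_contra hab
    exact haF (h ▸ Finset.mem_erase.2 ⟨hab, ha⟩)
  rw [h, this]

/-- The normal derivatives of the bubble functions have vanishing moments against the functions
`ϕ_k` chosen for the face. -/
theorem setIntegral_pd_bubble_vphi (hf : f ∈ bubbleSpan ℓ T B) (F : T.Face) (w : E3)
    (k : Fin (2 * ℓ - 3)) :
    ∫ x in triangle F.1, pd w f x * (B F).vphi k x ∂μHE[2] = 0 := by
  obtain ⟨a, ha, haF, hF⟩ := T.exists_eq_erase F.2.1 F.2.2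
  have hvphi : Continuous ((B F).vphi k) := IsPolyFun.continuous ⟨_, (B F).vphi_mem k⟩
  have hint : ∀ f, IsPolyFun f → IntegrableOn (fun x => pd w f x * (B F).vphi k x)
      (triangle F.1) μHE[2] := fun f hf =>
    integrableOn_triangle F.2.1 F.2.2 ((hf.pd w).continuous.mul hvphi)
  have hmeas : MeasurableSet (triangle F.1) := (isCompact_triangle F.1).measurableSet
  have hx0 : ∀ x ∈ triangle F.1, T.bary a x = 0 := fun x hx =>
    ((T.mem_triangle ha).1 (hF ▸ hx)).1
  refine Submodule.span_induction
    (p := fun f _ => ∫ x in triangle F.1, pd w f x * (B F).vphi k x ∂μHE[2] = 0) ?_ ?_ ?_ ?_ hf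
  · rintro _ ⟨G, i, rfl⟩
    by_cases haG : a ∈ G.1
    · refine setIntegral_eq_zero_of_forall_eq_zero fun x hx => ?_
      rw [pd_xi _ _ ha w (hx0 x hx), faceBubble_eq_zero haG (hx0 x hx)]
      ring
    · obtain rfl : G = F := Subtype.ext ((face_eq_erase G ha haG).trans hF.symm)
      have h1 : ∫ x in triangle G.1, pd w ((B G).xi i) x * (B G).vphi k x ∂μHE[2] =
          inner ℝ (T.grad a) w * ∫ x in triangle G.1,
            T.faceBubble G.1 x ^ 2 * (B G).phiT i x * (B G).vphi k x ∂μHE[2] := by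
        rw [← integral_const_mul]
        refine setIntegral_congr_fun hmeas fun x hx => ?_
        simp only [pd_xi _ _ ha w (hx0 x hx)]
        rw [← hF]
        ring
      have h2 := (B G).phiT_vphi i k
      rw [setAverage_eq, smul_eq_mul, mul_eq_zero] at h2
      rcases h2 with h2 | h2
      · rw [inv_eq_zero, measureReal_def, ENNReal.toReal_eq_zero_iff,
          or_iff_left (measure_triangle_lt_top G.2.1 G.2.2).ne] at h2
        rw [Measure.restrict_eq_zero.2 h2, integral_zero_measure]
      · rw [h1, h2, mul_zero]
  · simp [pd_zero]
  · intro f g hf hg h1 h2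
    have hf := isPolyFun_of_mem_bubbleSpan hf
    have hg := isPolyFun_of_mem_bubbleSpan hg
    simp only [pd_add w hf hg, Pi.add_apply, add_mul]
    rw [integral_add (hint f hf) (hint g hg), h1, h2, add_zero]
  · intro c f hf h
    simp only [pd_smul w c (isPolyFun_of_mem_bubbleSpan hf), Pi.smul_apply, smul_eq_mul, mul_assoc]
    rw [integral_const_mul, h, mul_zero]

end Tet

/-- Polynomial functions of degree `ℓ - 2` on a face are combinations of the chosen basis. -/
theorem FaceBubbleData.exists_eq_add {ℓ : ℕ} {T : Tet} {F : Finset E3} (B : FaceBubbleData ℓ T F)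
    {u : E3 → ℝ} (hu : u ∈ polyFun (ℓ - 2)) :
    ∃ q ∈ polyFun (ℓ - 4), ∃ c : Fin (2 * ℓ - 3) → ℝ,
      ∀ x ∈ triangle F, u x = q x + ∑ k, c k * B.vphi k x := by
  have h : restrictTo (triangle F) u ∈ polyOn (ℓ - 2) (triangle F) := ⟨u, hu, rfl⟩
  rw [← B.basis_span, Submodule.mem_span_range_iff_exists_fun] at h
  obtain ⟨c, hc⟩ := h
  refine ⟨∑ i, c (.inl i) • B.phi i,
    Submodule.sum_mem _ fun i _ => Submodule.smul_mem _ _ (B.phi_mem i), fun k => c (.inr k),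
    fun x hx => ?_⟩
  have := congrFun hc ⟨x, hx⟩
  simpa [restrictTo, LinearMap.funLeft_apply] using this.symm

namespace Tet

variable {T : Tet} {ℓ : ℕ} {B : ∀ F : T.Face, FaceBubbleData ℓ T F.1} {f : E3 → ℝ}

/-- The normal derivatives of the bubble functions have vanishing moments against all functions in
`P_{ℓ-2}(F)` that are orthogonal to `P_{ℓ-4}(F)` with the weight `b_F`. Hence the choice of the
complement `ϕ_1, …, ϕ_{2ℓ-3}` does not matter, and the two sides of a face need not agree on it. -/
theorem setIntegral_pd_bubble_orth (hf : f ∈ bubbleSpan ℓ T B) (F : T.Face) (w : E3) {u : E3 → ℝ}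
    (hu : u ∈ polyFun (ℓ - 2))
    (ho : ∀ q ∈ polyFun (ℓ - 4), ∫ x in triangle F.1, T.faceBubble F.1 x * q x * u x ∂μHE[2] = 0) :
    ∫ x in triangle F.1, pd w f x * u x ∂μHE[2] = 0 := by
  obtain ⟨a, ha, haF, hF⟩ := T.exists_eq_erase F.2.1 F.2.2
  have hmeas : MeasurableSet (triangle F.1) := (isCompact_triangle F.1).measurableSet
  obtain ⟨q, hq, c, huq⟩ := (B F).exists_eq_add hu
  have hvphi : ∀ k, Continuous ((B F).vphi k) := fun k => IsPolyFun.continuous ⟨_, (B F).vphi_mem k⟩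
  have hqc : Continuous q := IsPolyFun.continuous ⟨_, hq⟩
  have hfc : Continuous (pd w f) := ((isPolyFun_of_mem_bubbleSpan hf).pd w).continuous
  have hb : Continuous (T.faceBubble F.1) := (isPolyFun_faceBubble F.1).continuous
  have hint : ∀ g : E3 → ℝ, Continuous g → IntegrableOn g (triangle F.1) μHE[2] :=
    fun g hg => integrableOn_triangle F.2.1 F.2.2 hg
  -- `q` is orthogonal to itself
  have h1 : ∫ x in triangle F.1, T.faceBubble F.1 x * q x ^ 2 ∂μHE[2] = 0 := by
    have h2 := ho q hq
    rw [setIntegral_congr_fun (g := fun x => T.faceBubble F.1 x * q x ^ 2 +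
      ∑ k, c k * (T.faceBubble F.1 x * q x * (B F).vphi k x)) hmeas] at h2
    · rw [integral_add (hint _ (by fun_prop)) (hint _ (by fun_prop)),
        integral_finsetSum _ (fun k _ => hint _ (by fun_prop))] at h2
      simpa only [integral_const_mul, (B F).vphi_orth _ q hq, mul_zero, Finset.sum_const_zero,
        add_zero] using h2
    · intro x hx
      simp only [huq x hx, mul_add, Finset.mul_sum]
      congr 1
      · ring
      · exact Finset.sum_congr rfl fun k _ => by ring
  have h2 : ∀ᵐ x ∂(μHE[2] : Measure E3).restrict (triangle F.1),
      T.faceBubble F.1 x * q x ^ 2 = 0 := by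
    refine (setIntegral_eq_zero_iff_of_nonneg_ae ?_ (hint _ (by fun_prop))).1 h1
    filter_upwards [ae_restrict_mem hmeas] with x hx
    exact mul_nonneg (Finset.prod_nonneg fun b hb =>
      ((T.mem_triangle ha).1 (hF ▸ hx)).2 b (hF ▸ hb)) (sq_nonneg _)
  have h3 : ∀ᵐ x ∂(μHE[2] : Measure E3).restrict (triangle F.1),
      pd w f x * u x = ∑ k, c k * (pd w f x * (B F).vphi k x) := by
    filter_upwards [h2, ae_restrict_mem hmeas] with x hx hxF
    have h4 : pd w f x * q x = 0 := by
      rcases mul_eq_zero.1 hx with h | h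
      · rw [pd_bubble_eq_zero hf ha ((T.mem_triangle ha).1 (hF ▸ hxF)).1 (hF ▸ h), zero_mul]
      · rw [pow_eq_zero_iff two_ne_zero] at h
        rw [h, mul_zero]
    rw [huq x hxF, mul_add, h4, zero_add, Finset.mul_sum]
    exact Finset.sum_congr rfl fun k _ => by ring
  rw [integral_congr_ae h3, integral_finsetSum _ (fun k _ => hint _ (by fun_prop))]
  simp only [integral_const_mul, setIntegral_pd_bubble_vphi hf F w, mul_zero,
    Finset.sum_const_zero]

/-! ### Continuity of the moments of the normal derivative -/

theorem piece_eq {v p : E3 → ℝ} (hp : IsPolyFun p) (h : EqOn v p (interior T.carrier)) :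
    T.piece v = p := by
  have hex : ∃ p : E3 → ℝ, (∃ k, p ∈ polyFun k) ∧ EqOn v p (interior T.carrier) := ⟨p, hp, h⟩
  rw [piece, dif_pos hex]
  exact IsPolyFun.eq_of_eqOn hex.choose_spec.1 hp isOpen_interior T.nonempty_interior
    (hex.choose_spec.2.symm.trans h)

/-- The restriction of a finite element function to an element is a polynomial function of degree
`ℓ` plus bubble functions. -/
theorem exists_piece_eq_add {v : E3 → ℝ}
    (hv : ∃ p ∈ shapeSpace ℓ T B, EqOn v p (interior T.carrier)) :
    EqOn v (T.piece v) (interior T.carrier) ∧ IsPolyFun (T.piece v) ∧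
      ∃ p ∈ polyFun ℓ, ∃ q ∈ bubbleSpan ℓ T B, T.piece v = p + q := by
  obtain ⟨s, hs, hvs⟩ := hv
  obtain ⟨p, hp, q, hq, rfl⟩ := Submodule.mem_sup.1 hs
  have hpoly : IsPolyFun (p + q) := .add ⟨_, hp⟩ (isPolyFun_of_mem_bubbleSpan hq)
  rw [T.piece_eq hpoly hvs]
  exact ⟨hvs, hpoly, p, hp, q, hq, rfl⟩

end Tet

theorem triangle_segment {F : Finset E3} {b c x : E3} (hb : b ∈ F) (hc : c ∈ F)
    (hx : x ∈ segment ℝ b c) : x ∈ triangle F :=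
  (convex_convexHull ℝ _).segment_subset (subset_convexHull ℝ _ hb) (subset_convexHull ℝ _ hc) hx

theorem Tet.faceBubble_segment {T : Tet} {F : Finset E3} (hF : F ⊆ T.verts) (hc : F.card = 3)
    {b c x : E3} (hb : b ∈ F) (hc : c ∈ F) (hx : x ∈ segment ℝ b c) : T.faceBubble F x = 0 := by
  obtain ⟨d, hd, hdb, hdc⟩ : ∃ d ∈ F, d ≠ b ∧ d ≠ c := by
    by_contra! h
    have : F ⊆ {b, c} := fun d hd => by
      by_cases hdb : d = b
      · simp [hdb]
      · simp [h d hd hdb]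
    have := (Finset.card_le_card this).trans Finset.card_le_two
    omega
  refine faceBubble_eq_zero hd ?_
  have h : segment ℝ b c ⊆ T.baryAff d ⁻¹' {0} := by
    rw [← convexHull_pair]
    refine convexHull_min ?_ ((convex_singleton 0).affine_preimage _)
    rintro y (rfl | rfl)
    · simp [coe_baryAff, T.bary_of_ne (hF hb) hdb]
    · simp [coe_baryAff, T.bary_of_ne (hF hc) hdc]
  simpa [coe_baryAff] using h hx

/-- The moments of order `ℓ - 2` of the normal derivative are continuous. Of the conditions on
continuity, only those on the gradient at the edges and on the moments of order `ℓ - 4` are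
needed. -/
theorem normalMomentContinuity_of_pieces {𝒯 : Finset Tet} {ℓ : ℕ} (hℓ : 5 ≤ ℓ)
    {B : ∀ (T : Tet) (F : T.Face), FaceBubbleData ℓ T F.1} {v : E3 → ℝ}
    (hv : ∀ T ∈ 𝒯, ∃ p ∈ shapeSpace ℓ T (B T), EqOn v p (interior T.carrier))
    (hE : C1AtEdges 𝒯 v) (hM : NormalMomentContinuity 𝒯 (ℓ - 4) v) :
    NormalMomentContinuity 𝒯 (ℓ - 2) v := by
  intro F S T n hF u hu
  have hM' := hM F S T n hF
  obtain ⟨hS, hT, -, hFS, hFT, hc, -⟩ := hF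
  obtain ⟨-, hSp, p, hp, q, hq, hpq⟩ := S.exists_piece_eq_add (hv S hS)
  obtain ⟨-, hTp, p', hp', q', hq', hpq'⟩ := T.exists_piece_eq_add (hv T hT)
  obtain ⟨a, ha, haF, hFa⟩ := S.exists_eq_erase hFS hc
  obtain ⟨a', ha', haF', hFa'⟩ := T.exists_eq_erase hFT hc
  have hqp := Tet.isPolyFun_of_mem_bubbleSpan hq
  have hqp' := Tet.isPolyFun_of_mem_bubbleSpan hq'
  have hmeas : MeasurableSet (triangle F) := (Tet.isCompact_triangle F).measurableSet
  have hint : ∀ g : E3 → ℝ, Continuous g → IntegrableOn g (triangle F) μHE[2] :=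
    fun g hg => S.integrableOn_triangle hFS hc hg
  have hjump : normalJump v S T n = pd n (p - p') + (pd n q - pd n q') := by
    have : normalJump v S T n = pd n (S.piece v) - pd n (T.piece v) := rfl
    rw [this, hpq, hpq', pd_add n ⟨_, hp⟩ hqp, pd_add n ⟨_, hp'⟩ hqp', pd_sub n ⟨_, hp⟩ ⟨_, hp'⟩]
    abel
  have hd : pd n (p - p') ∈ polyFun ((ℓ - 4) + 3) := by
    have := pd_mem_polyFun n (sub_mem hp hp')
    rwa [show ℓ - 1 = (ℓ - 4) + 3 by omega] at this
  have hd0 : ∀ b ∈ S.verts.erase a, ∀ c ∈ S.verts.erase a, ∀ x ∈ segment ℝ b c,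
      pd n (p - p') x = 0 := by
    intro b hb c hcF x hx
    rw [← hFa] at hb hcF
    have hxF := triangle_segment hb hcF hx
    have h1 := congrArg (fun L => L n)
      (hE S hS T hT b (hFS hb) (hFT hb) c (hFS hcF) (hFT hcF) x hx).2
    have h2 : normalJump v S T n x = 0 := sub_eq_zero.2 h1
    rw [hjump] at h2
    have h3 : pd n q x = 0 := Tet.pd_bubble_eq_zero hq ha ((S.mem_triangle ha).1 (hFa ▸ hxF)).1
      (hFa ▸ S.faceBubble_segment hFS hc hb hcF hx) n
    have h4 : pd n q' x = 0 := Tet.pd_bubble_eq_zero hq' ha'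
      ((T.mem_triangle ha').1 (hFa' ▸ hxF)).1 (hFa' ▸ T.faceBubble_segment hFT hc hb hcF hx) n
    simpa [h3, h4] using h2
  obtain ⟨g, hg, hdg⟩ := S.exists_eq_faceBubble_mul ha hd hd0
  let FS : S.Face := ⟨F, hFS, hc⟩
  let FT : T.Face := ⟨F, hFT, hc⟩
  have hvphi : ∀ k, ∫ x in triangle F, normalJump v S T n x * (B S FS).vphi k x ∂μHE[2] = 0 := by
    intro k
    have hk : Continuous ((B S FS).vphi k) := IsPolyFun.continuous ⟨_, (B S FS).vphi_mem k⟩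
    have h1 : ∫ x in triangle F, pd n (p - p') x * (B S FS).vphi k x ∂μHE[2] = 0 := by
      rw [← (B S FS).vphi_orth k g hg]
      refine setIntegral_congr_fun hmeas fun x hx => ?_
      simp only [hdg x ((S.mem_triangle ha).1 (hFa ▸ hx)).1]
      rw [← hFa]
    have h2 : ∫ x in triangle F, pd n q x * (B S FS).vphi k x ∂μHE[2] = 0 :=
      Tet.setIntegral_pd_bubble_orth hq FS n ((B S FS).vphi_mem k) ((B S FS).vphi_orth k)
    have h3 : ∫ x in triangle F, pd n q' x * (B S FS).vphi k x ∂μHE[2] = 0 := by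
      refine Tet.setIntegral_pd_bubble_orth hq' FT n ((B S FS).vphi_mem k) fun r hr => ?_
      rw [← (B S FS).vphi_orth k r hr]
      refine setIntegral_congr_fun hmeas fun x hx => ?_
      simp only [FS, FT, Tet.faceBubble_eq_of_common_face hFT hFS hc hx]
    have c1 : Continuous (pd n (p - p')) := IsPolyFun.continuous ⟨_, hd⟩
    have c2 := (hqp.pd n).continuous
    have c3 := (hqp'.pd n).continuous
    simp only [hjump, Pi.add_apply, Pi.sub_apply, add_mul, sub_mul]
    rw [integral_add (hint _ (by fun_prop)) (hint _ (by fun_prop)),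
      integral_sub (hint _ (by fun_prop)) (hint _ (by fun_prop)), h1, h2, h3]
    norm_num
  obtain ⟨r, hr, c, hur⟩ := (B S FS).exists_eq_add hu
  have hJ : Continuous (normalJump v S T n) :=
    ((hSp.pd n).sub (hTp.pd n)).continuous
  have hk : ∀ k, Continuous ((B S FS).vphi k) :=
    fun k => IsPolyFun.continuous ⟨_, (B S FS).vphi_mem k⟩
  have hrc : Continuous r := IsPolyFun.continuous ⟨_, hr⟩
  rw [setIntegral_congr_fun (g := fun x => normalJump v S T n x * r x +
    ∑ k, c k * (normalJump v S T n x * (B S FS).vphi k x)) hmeas]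
  · rw [integral_add (hint _ (by fun_prop)) (hint _ (by fun_prop)),
      integral_finsetSum _ (fun k _ => hint _ (by fun_prop))]
    simp only [integral_const_mul, hM' r hr, hvphi, mul_zero, Finset.sum_const_zero, add_zero]
  · intro x hx
    simp only [hur x hx, mul_add, Finset.mul_sum]
    congr 1
    exact Finset.sum_congr rfl fun k _ => by ring

/-! ### Two tetrahedra with a common face -/

namespace Tet

theorem eq_of_verts_eq {S T : Tet} (h : S.verts = T.verts) : S = T := by
  cases S; cases T; congr

/-- `a` and `c` are the vertices of `S` and `T` opposite to a common face, and the two tetrahedra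
lie on different sides of this face: the barycentric coordinate of `T` that vanishes on the face is
negative at `a`. -/
structure IsOpposite (S T : Tet) (a c : E3) : Prop where
  left_mem : a ∈ S.verts
  right_mem : c ∈ T.verts
  erase_eq : S.verts.erase a = T.verts.erase c
  neg : T.bary c a < 0

section

variable {S T : Tet} {a c : E3}

theorem IsOpposite.bary_eq (h : IsOpposite S T a c) (x : E3) :
    T.bary c x = T.bary c a * S.bary a x := by
  have h1 := S.affine_eq_sum (T.baryAff c) x
  rw [coe_baryAff, ← Finset.add_sum_erase _ _ h.left_mem, Finset.sum_eq_zero, add_zero] at h1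
  · rw [h1, mul_comm]
  · intro b hb
    rw [h.erase_eq, Finset.mem_erase] at hb
    rw [T.bary_of_ne hb.2 hb.1.symm, mul_zero]

theorem IsOpposite.grad_eq (h : IsOpposite S T a c) :
    T.grad c = T.bary c a • S.grad a := by
  refine ext_inner_right ℝ fun w => ?_
  have h1 := T.inner_grad_sub c w 0
  have h2 := S.inner_grad_sub a w 0
  rw [sub_zero] at h1 h2
  rw [real_inner_smul_left, h1, h2, h.bary_eq w, h.bary_eq 0]
  ring

/-- The outer normals of a common face, scaled by its area, are opposite to each other. -/
theorem IsOpposite.volume_smul_grad (h : IsOpposite S T a c) :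
    volume.real S.carrier • S.grad a = -(volume.real T.carrier • T.grad c) := by
  -- a shear that fixes the common face maps `T` to `S`
  set f : E3 →ₗ[ℝ] E3 := LinearMap.transvection (T.baryAff c).linear (a - c) with hf
  have hdet : LinearMap.det f = T.bary c a := by
    have h1 := T.inner_grad_sub c a c
    rw [T.bary_self h.right_mem, inner_grad] at h1
    rw [hf, LinearMap.transvection.det, h1]
    ring
  set A : E3 →ᵃ[ℝ] E3 := f.toAffineMap + AffineMap.const ℝ E3 (T.bary c 0 • (a - c)) with hA
  have hAx : ∀ x, A x = x + T.bary c x • (a - c) := by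
    intro x
    have h1 := T.inner_grad_sub c x 0
    rw [sub_zero, inner_grad] at h1
    simp only [hA, hf, AffineMap.coe_add, LinearMap.coe_toAffineMap, Pi.add_apply,
      AffineMap.const_apply, LinearMap.transvection.apply, h1]
    module
  have himg : A '' T.carrier = S.carrier := by
    rw [carrier, carrier, AffineMap.image_convexHull]
    congr 1
    rw [← Finset.insert_erase h.left_mem, h.erase_eq]
    conv_lhs => rw [← Finset.insert_erase h.right_mem]
    rw [Finset.coe_insert, Finset.coe_insert, image_insert_eq, hAx, T.bary_self h.right_mem,
      one_smul, add_sub_cancel]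
    congr 1
    conv_rhs => rw [← image_id ((T.verts.erase c : Finset E3) : Set E3)]
    refine image_congr fun b hb => ?_
    rw [Finset.mem_coe, Finset.mem_erase] at hb
    rw [hAx, T.bary_of_ne hb.2 hb.1.symm, zero_smul, add_zero, id]
  have hvol : volume.real S.carrier = -T.bary c a * volume.real T.carrier := by
    have h1 : S.carrier = (fun x => x + T.bary c 0 • (a - c)) '' (f '' T.carrier) := by
      rw [← himg, image_image]
      rfl
    rw [measureReal_def, h1, image_add_right, measure_preimage_add_right,
      Measure.addHaar_image_linearMap, hdet, abs_of_neg h.neg, ENNReal.toReal_mul,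
      ENNReal.toReal_ofReal (by linarith [h.neg]), measureReal_def]
  rw [hvol, h.grad_eq, smul_smul, ← neg_smul]
  congr 1
  ring

end

end Tet

/-- The barycentre of a triangle. -/
def faceCenter (F : Finset E3) : E3 := ∑ b ∈ F, (1 / 3 : ℝ) • b

open Classical in
theorem Tet.bary_faceCenter {T : Tet} {F : Finset E3} (hF : F ⊆ T.verts) (hc : F.card = 3)
    (b : E3) : T.bary b (faceCenter F) = if b ∈ F then 1 / 3 else 0 := by
  have h2 := Finset.map_affineCombination F id (fun _ => (1 / 3 : ℝ)) (by simp [hc])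
    (T.baryAff b)
  rw [Finset.affineCombination_eq_linear_combination _ _ _ (by simp [hc]),
    Finset.affineCombination_eq_linear_combination _ _ _ (by simp [hc])] at h2
  simp only [id, coe_baryAff, Function.comp_apply, smul_eq_mul] at h2
  rw [faceCenter, h2]
  split_ifs with hb
  · rw [Finset.sum_eq_single b (fun d hd hdb => by
      rw [T.bary_of_ne (hF hd) hdb.symm, mul_zero]) (fun h => absurd hb h), T.bary_self (hF hb),
      mul_one]
  · exact Finset.sum_eq_zero fun d hd => by
      rw [T.bary_of_ne (hF hd) (ne_of_mem_of_not_mem hd hb).symm, mul_zero]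

namespace IsTriangulation

variable {𝒯 : Finset Tet} {Ω : Set E3} {S T : Tet}

theorem inter_verts (hST : S ≠ T) {F : Finset E3} (hFS : F ⊆ S.verts)
    (hFT : F ⊆ T.verts) (hc : F.card = 3) : (S.verts : Set E3) ∩ T.verts = F := by
  classical
  rw [← Finset.coe_inter, Finset.coe_inj]
  refine (Finset.eq_of_subset_of_card_le (Finset.subset_inter hFS hFT) ?_).symm
  by_contra! hlt
  have h1 : S.verts ∩ T.verts = S.verts :=
    Finset.eq_of_subset_of_card_le Finset.inter_subset_left (by rw [S.card_verts]; omega)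
  have h2 : S.verts ∩ T.verts = T.verts :=
    Finset.eq_of_subset_of_card_le Finset.inter_subset_right (by rw [T.card_verts]; omega)
  exact hST (Tet.eq_of_verts_eq (h1.symm.trans h2))

theorem disjoint_interior (h𝒯 : IsTriangulation 𝒯 Ω) (hS : S ∈ 𝒯) (hT : T ∈ 𝒯) (hST : S ≠ T) :
    Disjoint (interior S.carrier) (interior T.carrier) := by
  obtain ⟨a, haS, haT⟩ : ∃ a ∈ S.verts, a ∉ T.verts := by
    by_contra! h
    exact hST (Tet.eq_of_verts_eq (Finset.eq_of_subset_of_card_le h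
      (by rw [S.card_verts, T.card_verts])))
  rw [Set.disjoint_left]
  intro x hxS hxT
  have h1 : x ∈ S.carrier ∩ T.carrier := ⟨interior_subset hxS, interior_subset hxT⟩
  rw [h𝒯.face_to_face S hS T hT] at h1
  have h2 : x ∈ triangle (S.verts.erase a) := by
    refine convexHull_mono (fun b hb => ?_) h1
    rw [Finset.coe_erase]
    exact ⟨hb.1, fun h => haT (h ▸ hb.2)⟩
  exact (S.mem_interior.1 hxS a haS).ne' ((S.mem_triangle haS).1 h2).1

theorem isOpposite (h𝒯 : IsTriangulation 𝒯 Ω) (hS : S ∈ 𝒯) (hT : T ∈ 𝒯) (hST : S ≠ T) {a c : E3}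
    (ha : a ∈ S.verts) (hc : c ∈ T.verts) (h : S.verts.erase a = T.verts.erase c) :
    S.IsOpposite T a c := by
  refine ⟨ha, hc, h, ?_⟩
  by_contra! hneg
  set F := S.verts.erase a with hF
  have hcard : F.card = 3 := Tet.card_erase ha
  have hFS : F ⊆ S.verts := Finset.erase_subset _ _
  have hFT : F ⊆ T.verts := h ▸ Finset.erase_subset _ _
  -- a point of `S` close to the barycentre of the common face lies in `T`
  set m : E3 := faceCenter F with hm
  have hbm1 : ∀ (R : Tet), F ⊆ R.verts → ∀ b ∈ F, R.bary b m = 1 / 3 := by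
    intro R hR b hb
    rw [hm, R.bary_faceCenter hR hcard, if_pos hb]
  have hbm0 : ∀ (R : Tet), F ⊆ R.verts → ∀ b ∉ F, R.bary b m = 0 := by
    intro R hR b hb
    rw [hm, R.bary_faceCenter hR hcard, if_neg hb]
  have hline : ∀ (R : Tet) (b : E3) (t : ℝ), R.bary b (m + t • (a - m)) =
      R.bary b m + t * (R.bary b a - R.bary b m) := by
    intro R b t
    rw [R.bary_add, inner_smul_right, R.inner_grad_sub]
  have hcF : c ∉ F := by rw [h]; simp
  have haF : a ∉ F := by simp [hF]
  obtain ⟨t, ht0, ht1, ht⟩ : ∃ t : ℝ, 0 < t ∧ t ≤ 1 ∧ m + t • (a - m) ∈ T.carrier := by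
    have h1 : ∀ᶠ t : ℝ in 𝓝 0, ∀ b ∈ F, 0 < T.bary b (m + t • (a - m)) := by
      rw [Filter.eventually_all_finset]
      intro b hb
      have : ContinuousAt (fun t : ℝ => T.bary b (m + t • (a - m))) 0 := by
        simp only [hline]
        fun_prop
      refine this.eventually (p := fun y => 0 < y) (Ioi_mem_nhds ?_)
      simp only [hline, hbm1 T hFT b hb]
      norm_num
    obtain ⟨ε, hε, h2⟩ := Metric.eventually_nhds_iff.1 h1
    have hmin : 0 < min (ε / 2) 1 := by positivity
    refine ⟨min (ε / 2) 1, hmin, min_le_right _ _, T.mem_carrier.2 fun b hb => ?_⟩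
    by_cases hbc : b = c
    · rw [hbc, hline, hbm0 T hFT c hcF]
      simp only [zero_add, sub_zero]
      positivity
    · refine (h2 ?_ b (h ▸ Finset.mem_erase.2 ⟨hbc, hb⟩)).le
      rw [Real.dist_eq, sub_zero, abs_of_pos hmin]
      linarith [min_le_left (ε / 2) 1]
  have hmS : m ∈ S.carrier := S.mem_carrier.2 fun b hb => by
    by_cases hbF : b ∈ F
    · rw [hbm1 S hFS b hbF]; norm_num
    · rw [hbm0 S hFS b hbF]
  have hxS : m + t • (a - m) ∈ S.carrier :=
    S.convex_carrier.add_smul_sub_mem hmS (subset_convexHull ℝ _ ha) ⟨ht0.le, ht1⟩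
  have h3 : m + t • (a - m) ∈ S.carrier ∩ T.carrier := ⟨hxS, ht⟩
  rw [h𝒯.face_to_face S hS T hT, inter_verts hST hFS hFT hcard] at h3
  have h4 := ((S.mem_triangle ha).1 h3).1
  rw [hline, hbm0 S hFS a haF, S.bary_self ha] at h4
  simp at h4
  exact ht0.ne' h4

end IsTriangulation

/-! ### The Miranda–Talenti identity on one element -/

/-- The standard basis vectors. -/
abbrev stdVec (i : Fin 3) : E3 := EuclideanSpace.single i 1

theorem inner_stdVec (N : E3) (i : Fin 3) : inner ℝ N (stdVec i) = N i := by
  simp [stdVec, EuclideanSpace.inner_single_right]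

theorem eq_sum_stdVec (w : E3) : w = ∑ i, w i • stdVec i := by
  ext j
  fin_cases j <;> simp [Fin.sum_univ_three]

theorem pd_eq_sum (w : E3) (f : E3 → ℝ) : pd w f = ∑ i, w i • pd (stdVec i) f := by
  ext x
  conv_lhs => rw [eq_sum_stdVec w]
  simp [pd]

/-- The vector field `(D²p) ∇p - (Δp) ∇p`, whose divergence is `|D²p|² - (Δp)²`. -/
def mtField (p : E3 → ℝ) (i : Fin 3) : E3 → ℝ :=
  ∑ j, (pd (stdVec i) (pd (stdVec j) p) * pd (stdVec j) p -
    pd (stdVec i) p * pd (stdVec j) (pd (stdVec j) p))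

theorem isPolyFun_mtField {p : E3 → ℝ} (hp : IsPolyFun p) (i : Fin 3) : IsPolyFun (mtField p i) :=
  .sum fun _ _ => (((hp.pd _).pd _).mul (hp.pd _)).sub ((hp.pd _).mul ((hp.pd _).pd _))

theorem sum_pd_mtField {p : E3 → ℝ} (hp : IsPolyFun p) (x : E3) :
    ∑ i, pd (stdVec i) (mtField p i) x =
      ∑ i, ∑ j, partial2 p i j x ^ 2 - (∑ i, partial2 p i i x) ^ 2 := by
  have e : ∀ i j, partial2 p i j x = pd (stdVec i) (pd (stdVec j) p) x := fun _ _ => rfl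
  have hd : ∀ i, IsPolyFun (pd (stdVec i) p) := fun i => hp.pd _
  have h1 : ∀ i, pd (stdVec i) (mtField p i) x = ∑ j,
      (pd (stdVec j) (pd (stdVec i) (pd (stdVec i) p)) x * pd (stdVec j) p x +
        pd (stdVec i) (pd (stdVec j) p) x ^ 2 -
        pd (stdVec i) (pd (stdVec i) p) x * pd (stdVec j) (pd (stdVec j) p) x -
        pd (stdVec i) p x * pd (stdVec i) (pd (stdVec j) (pd (stdVec j) p)) x) := by
    intro i
    have hs : pd (stdVec i) (mtField p i) = ∑ j, pd (stdVec i)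
        (pd (stdVec i) (pd (stdVec j) p) * pd (stdVec j) p -
          pd (stdVec i) p * pd (stdVec j) (pd (stdVec j) p)) := by
      have hj : ∀ j, IsPolyFun (pd (stdVec i) (pd (stdVec j) p) * pd (stdVec j) p -
          pd (stdVec i) p * pd (stdVec j) (pd (stdVec j) p)) := fun j =>
        (((hp.pd _).pd _).mul (hp.pd _)).sub ((hp.pd _).mul ((hp.pd _).pd _))
      rw [mtField, Fin.sum_univ_three, Fin.sum_univ_three, pd_add _ ((hj 0).add (hj 1)) (hj 2),
        pd_add _ (hj 0) (hj 1)]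
    rw [hs, Finset.sum_apply]
    refine Finset.sum_congr rfl fun j _ => ?_
    rw [pd_sub _ (((hd j).pd _).mul (hd j)) ((hd i).mul ((hd j).pd _)),
      pd_mul _ ((hd j).pd _) (hd j), pd_mul _ (hd i) ((hd j).pd _),
      pd_comm (stdVec j) (stdVec i) hp, pd_comm (stdVec j) (stdVec i) (hd i)]
    simp only [Pi.sub_apply, Pi.add_apply, Pi.mul_apply]
    ring
  simp only [h1, e, Fin.sum_univ_three]
  ring

theorem setIntegral_hessian_sub_laplacian (T : Tet) {p : E3 → ℝ} (hp : IsPolyFun p) :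
    ∫ x in T.carrier, (∑ i, ∑ j, partial2 p i j x ^ 2 - (∑ i, partial2 p i i x) ^ 2) =
      -3 * volume.real T.carrier * ∑ a ∈ T.verts,
        ⨍ x in triangle (T.verts.erase a), ∑ i, T.grad a i * mtField p i x ∂μHE[2] := by
  simp only [← sum_pd_mtField hp]
  rw [integral_finsetSum]
  · simp only [T.setIntegral_pd (isPolyFun_mtField hp _), ← Finset.mul_sum]
    rw [Finset.sum_comm]
    congr 1
    refine Finset.sum_congr rfl fun a ha => ?_
    simp only [inner_stdVec]
    rw [setAverage_eq, integral_finsetSum, smul_eq_mul, Finset.mul_sum]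
    · refine Finset.sum_congr rfl fun i _ => ?_
      rw [setAverage_eq, integral_const_mul, smul_eq_mul]
      ring
    · intro i _
      exact (T.integrableOn_triangle (Finset.erase_subset _ _) (T.card_erase ha)
        (isPolyFun_mtField hp i).continuous).const_mul _
  · intro i _
    exact ((isPolyFun_mtField hp i).pd _).continuous.continuousOn.integrableOn_compact
      T.isCompact_carrier

/-! ### The jump of the flux across a face -/

section

variable {L g p : E3 → ℝ} {N : E3}

theorem pd_mul_of_eq_zero (hLp : IsPolyFun L) (hg : IsPolyFun g)
    (hL : ∀ w, pd w L = fun _ => inner ℝ N w) (w : E3) {x : E3} (hx : L x = 0) :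
    pd w (L * g) x = inner ℝ N w * g x := by
  rw [pd_mul w hLp hg, hL]
  simp [hx]

theorem pd_pd_mul_of_eq_zero (hLp : IsPolyFun L) (hg : IsPolyFun g)
    (hL : ∀ w, pd w L = fun _ => inner ℝ N w) (v w : E3) {x : E3} (hx : L x = 0) :
    pd v (pd w (L * g)) x = inner ℝ N w * pd v g x + inner ℝ N v * pd w g x := by
  rw [pd_mul w hLp hg, pd_add v ((hLp.pd w).mul hg) (hLp.mul (hg.pd w)),
    pd_mul v (hLp.pd w) hg, pd_mul v hLp (hg.pd w), hL, hL, pd_const]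
  simp [hx]

/-- `|N|²` times the orthogonal projection of the `j`-th basis vector to the plane orthogonal
to `N`. -/
def tangentVec (N : E3) (j : Fin 3) : E3 := inner ℝ N N • stdVec j - N j • N

theorem inner_tangentVec (N : E3) (j : Fin 3) : inner ℝ N (tangentVec N j) = 0 := by
  rw [tangentVec, inner_sub_right, inner_smul_right, inner_smul_right, inner_stdVec]
  ring

theorem pd_tangentVec (N : E3) (j : Fin 3) (f : E3 → ℝ) (x : E3) :
    pd (tangentVec N j) f x =
      inner ℝ N N * pd (stdVec j) f x - N j * ∑ i, N i * pd (stdVec i) f x := by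
  rw [tangentVec, pd_sub_dir, pd_smul_dir, pd_smul_dir, pd_eq_sum N f]
  simp

/-- `|N|²` times the Laplacian in the directions orthogonal to `N`. -/
def tangentLaplacian (N : E3) (p : E3 → ℝ) : E3 → ℝ :=
  ∑ j, pd (tangentVec N j) (pd (stdVec j) p)

/-- If `p` changes by `L g` across the plane `L = 0`, the normal component of its Miranda–Talenti
field changes, up to a tangential divergence, by the normal derivative times the tangential
Laplacian. The terms of second order in `g` cancel. -/
theorem mtField_jump (hLp : IsPolyFun L) (hg : IsPolyFun g) (hp : IsPolyFun p)
    (hL : ∀ w, pd w L = fun _ => inner ℝ N w) {x : E3} (hx : L x = 0) :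
    ∑ i, N i * mtField (p + L * g) i x - ∑ i, N i * mtField p i x =
      ∑ j, pd (tangentVec N j) (g * pd (stdVec j) p) x - 2 * (g x * tangentLaplacian N p x) := by
  have hLg := hLp.mul hg
  have e1 : ∀ i, pd (stdVec i) (p + L * g) x = pd (stdVec i) p x + N i * g x := fun i => by
    rw [pd_add _ hp hLg, Pi.add_apply, pd_mul_of_eq_zero hLp hg hL _ hx, inner_stdVec]
  have e2 : ∀ i j, pd (stdVec i) (pd (stdVec j) (p + L * g)) x =
      pd (stdVec i) (pd (stdVec j) p) x +
        (N j * pd (stdVec i) g x + N i * pd (stdVec j) g x) := fun i j => by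
    rw [pd_add _ hp hLg, pd_add _ (hp.pd _) (hLg.pd _), Pi.add_apply,
      pd_pd_mul_of_eq_zero hLp hg hL _ _ hx, inner_stdVec, inner_stdVec]
  have e3 : ∀ i j, pd (stdVec i) (g * pd (stdVec j) p) x =
      pd (stdVec i) g x * pd (stdVec j) p x + g x * pd (stdVec i) (pd (stdVec j) p) x :=
    fun i j => by rw [pd_mul _ hg (hp.pd _)]; rfl
  have e4 : ∀ f : E3 → ℝ, ∀ i, mtField f i x = ∑ j, (pd (stdVec i) (pd (stdVec j) f) x *
      pd (stdVec j) f x - pd (stdVec i) f x * pd (stdVec j) (pd (stdVec j) f) x) := fun f i => by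
    rw [mtField, Finset.sum_apply]; rfl
  have hN : inner ℝ N N = N 0 ^ 2 + N 1 ^ 2 + N 2 ^ 2 := by
    rw [PiLp.inner_apply, Fin.sum_univ_three]
    simp
  have h10 := congrFun (pd_comm (stdVec 1) (stdVec 0) hp) x
  have h20 := congrFun (pd_comm (stdVec 2) (stdVec 0) hp) x
  have h21 := congrFun (pd_comm (stdVec 2) (stdVec 1) hp) x
  simp only [tangentLaplacian, Finset.sum_apply, e4, e1, e2, pd_tangentVec, e3, hN]
  simp only [Fin.sum_univ_three, h10, h20, h21]
  ring

/-- The tangential Laplacian of a function that vanishes on a plane vanishes there. -/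
theorem tangentLaplacian_mul_eq_zero (hLp : IsPolyFun L) (hg : IsPolyFun g)
    (hL : ∀ w, pd w L = fun _ => inner ℝ N w) {x : E3} (hx : L x = 0) :
    tangentLaplacian N (L * g) x = 0 := by
  have hN : inner ℝ N N = N 0 ^ 2 + N 1 ^ 2 + N 2 ^ 2 := by
    rw [PiLp.inner_apply, Fin.sum_univ_three]
    simp
  simp only [tangentLaplacian, Finset.sum_apply, pd_pd_mul_of_eq_zero hLp hg hL _ _ hx,
    inner_tangentVec, pd_tangentVec, inner_stdVec, hN, Fin.sum_univ_three]
  ring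

theorem tangentLaplacian_mem_polyFun (N : E3) {k : ℕ} (hp : p ∈ polyFun k) :
    tangentLaplacian N p ∈ polyFun (k - 2) :=
  Submodule.sum_mem _ fun _ _ => pd_mem_polyFun _ (pd_mem_polyFun _ hp)

theorem tangentLaplacian_add {q : E3 → ℝ} (hp : IsPolyFun p) (hq : IsPolyFun q) :
    tangentLaplacian N (p + q) = tangentLaplacian N p + tangentLaplacian N q := by
  simp only [tangentLaplacian, ← Finset.sum_add_distrib]
  exact Finset.sum_congr rfl fun j _ => by rw [pd_add _ hp hq, pd_add _ (hp.pd _) (hq.pd _)]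

end

/-! ### Traces of functions in `H¹₀(Ω)` -/

theorem lintegral_enorm_sq_eq (f : E3 → ℝ) (μ : Measure E3) :
    ∫⁻ x, ‖f x‖ₑ ^ 2 ∂μ = eLpNorm f 2 μ ^ 2 := by
  have := eLpNorm_nnreal_pow_eq_lintegral (f := f) (μ := μ) (p := 2) two_ne_zero
  simpa using this.symm

/-- Translations of a smooth function differ from it by at most the norm of its gradient. -/
theorem eLpNorm_translate_sub_le {u : E3 → ℝ} (hu : ContDiff ℝ ∞ u) (h : E3) :
    eLpNorm (fun y => u (y + h) - u y) 2 volume ≤ ‖h‖ₑ * eLpNorm (gradient u) 2 volume := by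
  have hd : ContDiff ℝ 1 u := hu.of_le (by exact_mod_cast le_top)
  have hfd : Continuous (fderiv ℝ u) := hd.continuous_fderiv one_ne_zero
  have hgrad : ∀ x, ‖gradient u x‖ₑ = ‖fderiv ℝ u x‖ₑ := fun x => by
    rw [gradient, ← ofReal_norm, ← ofReal_norm, LinearIsometryEquiv.norm_map]
  have hcurve : Continuous fun z : E3 × ℝ => z.1 + z.2 • h := by fun_prop
  -- the fundamental theorem of calculus and Jensen's inequality on each segment
  have key : ∀ y, ‖u (y + h) - u y‖ₑ ^ 2 ≤
      ∫⁻ t in Ioc (0 : ℝ) 1, ‖h‖ₑ ^ 2 * ‖gradient u (y + t • h)‖ₑ ^ 2 := by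
    intro y
    have hc : Continuous fun t : ℝ => fderiv ℝ u (y + t • h) h :=
      (hfd.comp (by fun_prop)).clm_apply continuous_const
    have h1 : u (y + h) - u y = ∫ t in Ioc (0 : ℝ) 1, fderiv ℝ u (y + t • h) h := by
      rw [← intervalIntegral.integral_of_le zero_le_one,
        intervalIntegral.integral_eq_sub_of_hasDerivAt (f := fun t : ℝ => u (y + t • h))]
      · simp
      · intro t _
        have h2 : HasDerivAt (fun t : ℝ => y + t • h) h t := by
          simpa using ((hasDerivAt_id t).smul_const h).const_add y
        exact (hd.differentiable one_ne_zero _).hasFDerivAt.comp_hasDerivAt t h2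
      · exact hc.intervalIntegrable _ _
    have hprob : IsProbabilityMeasure ((volume : Measure ℝ).restrict (Ioc 0 1)) :=
      ⟨by simp⟩
    have h2 : ‖u (y + h) - u y‖ₑ ≤
        eLpNorm (fun t : ℝ => fderiv ℝ u (y + t • h) h) 1 (volume.restrict (Ioc 0 1)) := by
      rw [h1, eLpNorm_one_eq_lintegral_enorm]
      exact enorm_integral_le_lintegral_enorm _
    have h3 := h2.trans (eLpNorm_le_eLpNorm_of_exponent_le (p := 1) (q := 2) (by norm_num)
      hc.aestronglyMeasurable)
    have h4 := eLpNorm_nnreal_pow_eq_lintegral (f := fun t : ℝ => fderiv ℝ u (y + t • h) h)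
      (μ := volume.restrict (Ioc 0 1)) (p := 2) two_ne_zero
    calc ‖u (y + h) - u y‖ₑ ^ 2
        ≤ eLpNorm (fun t : ℝ => fderiv ℝ u (y + t • h) h) 2 (volume.restrict (Ioc 0 1)) ^ 2 := by
          gcongr
      _ = ∫⁻ t in Ioc (0 : ℝ) 1, ‖fderiv ℝ u (y + t • h) h‖ₑ ^ 2 := by simpa using h4
      _ ≤ _ := by
          refine lintegral_mono fun t => ?_
          rw [hgrad, mul_comm, ← mul_pow]
          gcongr
          exact ContinuousLinearMap.le_opENorm _ _
  have hm : Measurable fun z : E3 × ℝ => ‖h‖ₑ ^ 2 * ‖gradient u (z.1 + z.2 • h)‖ₑ ^ 2 := by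
    simp only [hgrad]
    exact (((hfd.comp hcurve).measurable.enorm).pow_const 2).const_mul _
  have hsq : eLpNorm (fun y => u (y + h) - u y) 2 volume ^ 2 ≤
      (‖h‖ₑ * eLpNorm (gradient u) 2 volume) ^ 2 := by
    have h5 := eLpNorm_nnreal_pow_eq_lintegral (f := gradient u) (μ := volume) (p := 2) two_ne_zero
    calc eLpNorm (fun y => u (y + h) - u y) 2 volume ^ 2
        = ∫⁻ y, ‖u (y + h) - u y‖ₑ ^ 2 := (lintegral_enorm_sq_eq _ _).symm
      _ ≤ ∫⁻ y, ∫⁻ t in Ioc (0 : ℝ) 1, ‖h‖ₑ ^ 2 * ‖gradient u (y + t • h)‖ₑ ^ 2 :=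
          lintegral_mono key
      _ = ∫⁻ t in Ioc (0 : ℝ) 1, ∫⁻ y, ‖h‖ₑ ^ 2 * ‖gradient u (y + t • h)‖ₑ ^ 2 :=
          lintegral_lintegral_swap hm.aemeasurable
      _ = ∫⁻ t in Ioc (0 : ℝ) 1, ∫⁻ y, ‖h‖ₑ ^ 2 * ‖gradient u y‖ₑ ^ 2 := by
          congr 1
          ext t
          exact lintegral_add_right_eq_self (fun y => ‖h‖ₑ ^ 2 * ‖gradient u y‖ₑ ^ 2) (t • h)
      _ = ‖h‖ₑ ^ 2 * ∫⁻ y, ‖gradient u y‖ₑ ^ 2 := by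
          rw [setLIntegral_const]
          simp only [Real.volume_Ioc, sub_zero, ENNReal.ofReal_one, mul_one]
          refine lintegral_const_mul _ ?_
          simp only [hgrad]
          exact (hfd.measurable.enorm).pow_const 2
      _ = (‖h‖ₑ * eLpNorm (gradient u) 2 volume) ^ 2 := by
          rw [mul_pow]
          congr 1
          simpa using h5.symm
  exact (ENNReal.pow_le_pow_left_iff two_ne_zero).1 hsq

/-- Functions in `H¹₀(Ω)`, prolonged by zero, are Lipschitz continuous under translations
in `L²`. -/
theorem MemH10.exists_translate_le {Ω : Set E3} (hΩ : MeasurableSet Ω) {v : E3 → ℝ}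
    (hv : MemH10 Ω v) : ∃ C : ENNReal, C ≠ ⊤ ∧ ∀ h : E3,
      eLpNorm (fun y => Ω.indicator v (y + h) - Ω.indicator v y) 2 volume ≤ ‖h‖ₑ * C := by
  obtain ⟨hv2, g, hg, u, hu, hlim, hglim⟩ := hv
  refine ⟨eLpNorm g 2 (volume.restrict Ω), hg.eLpNorm_ne_top, fun h => ?_⟩
  set w := Ω.indicator v with hw
  have hwm : AEStronglyMeasurable w volume :=
    (aestronglyMeasurable_indicator_iff hΩ).2 hv2.aestronglyMeasurable
  set ε := fun m => eLpNorm (fun x => u m x - v x) 2 (volume.restrict Ω) with hε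
  set δ := fun m => eLpNorm (fun x => gradient (u m) x - g x) 2 (volume.restrict Ω) with hδ
  have hmp : MeasurePreserving (fun y : E3 => y + h) volume volume :=
    measurePreserving_add_right volume h
  have bound : ∀ m, eLpNorm (fun y => w (y + h) - w y) 2 volume ≤
      ε m + (‖h‖ₑ * (δ m + eLpNorm g 2 (volume.restrict Ω)) + ε m) := by
    intro m
    obtain ⟨hsm, -, hsup⟩ := hu m
    have hum : AEStronglyMeasurable (u m) volume := hsm.continuous.aestronglyMeasurable
    have hd : ContDiff ℝ 1 (u m) := hsm.of_le (by exact_mod_cast le_top)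
    have hgm : Continuous (gradient (u m)) :=
      (InnerProductSpace.toDual ℝ E3).symm.continuous.comp (hd.continuous_fderiv one_ne_zero)
    have e1 : eLpNorm (u m - w) 2 volume = ε m := by
      rw [hε]
      simp only
      rw [← eLpNorm_indicator_eq_eLpNorm_restrict hΩ]
      congr 1
      ext x
      by_cases hx : x ∈ Ω
      · simp [hw, hx]
      · simp [hw, hx, image_eq_zero_of_notMem_tsupport fun h => hx (hsup h)]
    have e2 : eLpNorm (gradient (u m)) 2 volume ≤
        δ m + eLpNorm g 2 (volume.restrict Ω) := by
      have h1 : eLpNorm (gradient (u m)) 2 volume =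
          eLpNorm (gradient (u m)) 2 (volume.restrict Ω) := by
        rw [← eLpNorm_indicator_eq_eLpNorm_restrict hΩ]
        congr 1
        ext1 x
        by_cases hx : x ∈ Ω
        · simp [hx]
        · have h2 : fderiv ℝ (u m) x = 0 := by
            by_contra h0
            exact hx (hsup (support_fderiv_subset ℝ h0))
          simp [hx, gradient, h2]
      rw [h1]
      have h3 : gradient (u m) = (fun x => gradient (u m) x - g x) + g := by ext1 x; simp
      conv_lhs => rw [h3]
      exact eLpNorm_add_le (hgm.aestronglyMeasurable.sub hg.aestronglyMeasurable)
        hg.aestronglyMeasurable (by norm_num)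
    have e3 : eLpNorm (fun y => w (y + h) - u m (y + h)) 2 volume = ε m := by
      have : (fun y => w (y + h) - u m (y + h)) = (w - u m) ∘ fun y => y + h := rfl
      rw [this, eLpNorm_comp_measurePreserving (hwm.sub hum) hmp, eLpNorm_sub_comm, e1]
    have hsplit : (fun y => w (y + h) - w y) = (fun y => w (y + h) - u m (y + h)) +
        ((fun y => u m (y + h) - u m y) + (u m - w)) := by
      ext y
      simp
    have huh : AEStronglyMeasurable (fun y => u m (y + h)) volume :=
      (hsm.continuous.comp (by fun_prop)).aestronglyMeasurable
    have hwh : AEStronglyMeasurable (fun y => w (y + h)) volume :=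
      hwm.comp_measurePreserving hmp
    rw [hsplit]
    refine (eLpNorm_add_le (hwh.sub huh) ((huh.sub hum).add (hum.sub hwm)) (by norm_num)).trans ?_
    refine add_le_add e3.le ?_
    refine (eLpNorm_add_le (huh.sub hum) (hum.sub hwm) (by norm_num)).trans ?_
    refine add_le_add ((eLpNorm_translate_sub_le hsm h).trans ?_) e1.le
    gcongr
  have hT : Tendsto (fun m => ε m + (‖h‖ₑ * (δ m + eLpNorm g 2 (volume.restrict Ω)) + ε m)) atTop
      (𝓝 (0 + (‖h‖ₑ * (0 + eLpNorm g 2 (volume.restrict Ω)) + 0))) :=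
    hlim.add ((ENNReal.Tendsto.const_mul (hglim.add tendsto_const_nhds)
      (Or.inr enorm_ne_top)).add hlim)
  simp only [zero_add, add_zero] at hT
  exact ge_of_tendsto' hT bound

/-- A function that is Lipschitz continuous under translations in `L²` has no jump across a plane:
for a translation of length `t`, a jump would contribute at least a multiple of `t` to the square of
the norm of the difference, which is at most a multiple of `t²`. -/
theorem eq_of_translate_le {w : E3 → ℝ} {C : ENNReal} (hC : C ≠ ⊤)
    (hw : ∀ h : E3, eLpNorm (fun y => w (y + h) - w y) 2 volume ≤ ‖h‖ₑ * C)
    {L : E3 →ᵃ[ℝ] ℝ} {e : E3} (he : L.linear e = 1) {p q : E3 → ℝ} (hp : Continuous p)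
    (hq : Continuous q) {x : E3} (hx : L x = 0)
    (hpos : ∀ᶠ y in 𝓝 x, 0 < L y → w y = p y) (hneg : ∀ᶠ y in 𝓝 x, L y < 0 → w y = q y) :
    p x = q x := by
  by_contra hne
  set j := |p x - q x| with hj
  have hj0 : 0 < j := abs_pos.2 (sub_ne_zero.2 hne)
  have hLc : Continuous L := L.continuous_of_finiteDimensional
  have hLt : ∀ (y : E3) (t : ℝ), L (y + t • e) = L y + t := fun y t => by
    have := map_sub_smul L e y (-t)
    rw [neg_smul, sub_neg_eq_add, he] at this
    rw [this]; ring
  have hev : ∀ᶠ y in 𝓝 x, |p y - p x| < j / 4 ∧ |q y - q x| < j / 4 ∧ (0 < L y → w y = p y) ∧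
      (L y < 0 → w y = q y) := by
    have h1 := hp.tendsto x (Metric.ball_mem_nhds _ (show 0 < j / 4 by positivity))
    have h2 := hq.tendsto x (Metric.ball_mem_nhds _ (show 0 < j / 4 by positivity))
    filter_upwards [h1, h2, hpos, hneg] with y a b c d
    exact ⟨a, b, c, d⟩
  obtain ⟨r, hr, hball⟩ := Metric.eventually_nhds_iff_ball.1 hev
  have he0 : e ≠ 0 := by rintro rfl; simp at he
  have hen : 0 < ‖e‖ := norm_pos_iff.2 he0
  set s := r / (4 * ‖e‖) with hs
  have hs0 : 0 < s := by positivity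
  have hse : s * ‖e‖ = r / 4 := by rw [hs]; field_simp
  -- the wall `K` is covered by `n` translates of a slab of thickness `s / n`
  set K : Set E3 := Metric.ball x (r / 4) ∩ L ⁻¹' Ioo (-s) 0 with hK
  have hKo : IsOpen K := Metric.isOpen_ball.inter (isOpen_Ioo.preimage hLc)
  have hKne : K.Nonempty := by
    refine ⟨x + (-(s / 2)) • e, ?_, ?_⟩
    · rw [Metric.mem_ball, dist_eq_norm, add_sub_cancel_left, norm_smul, Real.norm_eq_abs, abs_neg,
        abs_of_pos (by positivity)]
      nlinarith
    · rw [mem_preimage, hLt, hx]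
      exact ⟨by linarith, by linarith⟩
  have hV : 0 < volume K := hKo.measure_pos _ hKne
  set J : ENNReal := ENNReal.ofReal (j / 2) with hJ
  have hJ0 : J ≠ 0 := by simp [hJ, hj0]
  set D : ENNReal := (‖(2 * s) • e‖ₑ * C) ^ 2 with hD
  have hDtop : D ≠ ⊤ := ENNReal.pow_ne_top (ENNReal.mul_ne_top enorm_ne_top hC)
  have main : ∀ n : ℕ, n ≠ 0 → (n : ENNReal) * (J ^ 2 * volume K) ≤ D := by
    intro n hn
    have hn0 : (0 : ℝ) < n := by exact_mod_cast Nat.pos_of_ne_zero hn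
    set t := s / n with ht
    have ht0 : 0 < t := by positivity
    have hnt : n * t = s := by rw [ht]; field_simp
    have hts : t ≤ s := div_le_self hs0.le (by exact_mod_cast Nat.one_le_iff_ne_zero.2 hn)
    set S : Set E3 := Metric.ball x (r / 2) ∩ L ⁻¹' Ico (-t) 0 with hS
    have hSm : MeasurableSet S := measurableSet_ball.inter (hLc.measurable measurableSet_Ico)
    have hcover : K ⊆ ⋃ k ∈ Finset.range n, (fun y => y + ((k : ℝ) * t) • e) ⁻¹' S := by
      rintro y ⟨hy1, hy2, hy3⟩
      set k := ⌈-L y / t⌉₊ - 1 with hk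
      have hpos : 0 < -L y / t := by
        have : 0 < -L y := by linarith
        positivity
      have hceil : ⌈-L y / t⌉₊ = k + 1 := by
        have := Nat.ceil_pos.2 hpos
        omega
      have h1 : (k : ℝ) * t < -L y := by
        rw [← lt_div_iff₀ ht0]
        exact Nat.lt_ceil.1 (by omega)
      have h2 : -L y ≤ (k + 1 : ℝ) * t := by
        rw [← div_le_iff₀ ht0]
        have := Nat.le_ceil (-L y / t)
        rw [hceil] at this
        exact_mod_cast this
      have hks : (k : ℝ) * t < s := by linarith
      have hkn : k < n := by
        have : (k : ℝ) < n := by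
          rw [← hnt] at hks
          exact lt_of_mul_lt_mul_right hks ht0.le
        exact_mod_cast this
      refine mem_iUnion₂.2 ⟨k, Finset.mem_range.2 hkn, ?_, ?_⟩
      · rw [Metric.mem_ball, dist_eq_norm] at hy1 ⊢
        have hk0 : 0 ≤ (k : ℝ) * t := by positivity
        calc ‖y + ((k : ℝ) * t) • e - x‖ = ‖(y - x) + ((k : ℝ) * t) • e‖ := by congr 1; abel
          _ ≤ ‖y - x‖ + ‖((k : ℝ) * t) • e‖ := norm_add_le _ _
          _ = ‖y - x‖ + (k : ℝ) * t * ‖e‖ := by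
              rw [norm_smul, Real.norm_eq_abs, abs_of_nonneg hk0]
          _ < r / 2 := by nlinarith
      · rw [mem_preimage, hLt]
        exact ⟨by linarith, by linarith⟩
    have hvol : volume K ≤ n * volume S := by
      refine (measure_mono hcover).trans ((measure_biUnion_finset_le _ _).trans ?_)
      simp [measure_preimage_add_right]
    set h : E3 := (2 * t) • e with hh
    have hjump : ∀ y ∈ S, J ^ 2 ≤ ‖w (y + h) - w y‖ₑ ^ 2 := by
      rintro y ⟨hy1, hy2, hy3⟩
      have hyr : y ∈ Metric.ball x r := Metric.ball_subset_ball (by linarith) hy1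
      have hyr' : y + h ∈ Metric.ball x r := by
        rw [Metric.mem_ball, dist_eq_norm] at hy1 ⊢
        calc ‖y + h - x‖ = ‖(y - x) + h‖ := by congr 1; abel
          _ ≤ ‖y - x‖ + ‖h‖ := norm_add_le _ _
          _ = ‖y - x‖ + 2 * t * ‖e‖ := by
              rw [hh, norm_smul, Real.norm_eq_abs, abs_of_pos (by positivity)]
          _ < r := by nlinarith
      obtain ⟨-, a1, -, a2⟩ := hball y hyr
      obtain ⟨b1, -, b2, -⟩ := hball (y + h) hyr'
      rw [a2 hy3, b2 (by rw [hh, hLt]; linarith)]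
      gcongr
      rw [hJ, ← ofReal_norm, Real.norm_eq_abs]
      refine ENNReal.ofReal_le_ofReal ?_
      have h1 : j ≤ |p (y + h) - q y| + |p (y + h) - p x| + |q y - q x| := by
        have : p x - q x = (p (y + h) - q y) - (p (y + h) - p x) + (q y - q x) := by ring
        rw [hj, this]
        refine (abs_add_le _ _).trans ?_
        gcongr
        exact abs_sub _ _
      linarith
    have hslab : J ^ 2 * volume S ≤ (‖h‖ₑ * C) ^ 2 := by
      calc J ^ 2 * volume S = ∫⁻ _ in S, J ^ 2 := (setLIntegral_const _ _).symm
        _ ≤ ∫⁻ y in S, ‖w (y + h) - w y‖ₑ ^ 2 := setLIntegral_mono' hSm hjump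
        _ ≤ ∫⁻ y, ‖w (y + h) - w y‖ₑ ^ 2 := setLIntegral_le_lintegral _ _
        _ = eLpNorm (fun y => w (y + h) - w y) 2 volume ^ 2 := lintegral_enorm_sq_eq _ _
        _ ≤ _ := by gcongr; exact hw h
    have hnh : (n : ENNReal) * ‖h‖ₑ = ‖(2 * s) • e‖ₑ := by
      rw [hh, show (2 * s) • e = (n : ℝ) • (2 * t) • e by rw [smul_smul, ← hnt]; ring_nf,
        enorm_smul (n : ℝ)]
      congr 1
      simp [Real.enorm_natCast]
    calc (n : ENNReal) * (J ^ 2 * volume K) ≤ n * (J ^ 2 * (n * volume S)) := by gcongr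
      _ = n ^ 2 * (J ^ 2 * volume S) := by ring
      _ ≤ n ^ 2 * (‖h‖ₑ * C) ^ 2 := by gcongr
      _ = D := by rw [hD, ← hnh]; ring
  obtain ⟨n, hn⟩ := ENNReal.exists_nat_mul_gt (a := J ^ 2 * volume K) (b := D)
    (mul_ne_zero (pow_ne_zero 2 hJ0) hV.ne') hDtop
  have hn0 : n ≠ 0 := by
    rintro rfl
    simp at hn
  exact absurd (main n hn0) (not_le.2 hn)

/-! ### Continuity across faces -/

namespace Tet

theorem eventually_bary_pos {T : Tet} {a : E3} {x : E3}
    (hx : ∀ b ∈ T.verts.erase a, 0 < T.bary b x) :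
    ∀ᶠ y in 𝓝 x, ∀ b ∈ T.verts.erase a, 0 < T.bary b y := by
  rw [Filter.eventually_all_finset]
  intro b hb
  exact (T.isPolyFun_bary b).continuous.tendsto x (Ioi_mem_nhds (hx b hb))

theorem mem_interior_of_erase {T : Tet} {a y : E3}
    (h : ∀ b ∈ T.verts.erase a, 0 < T.bary b y) (ha : 0 < T.bary a y) : y ∈ interior T.carrier :=
  T.mem_interior.2 fun b hb => by
    by_cases hab : b = a
    · rwa [hab]
    · exact h b (Finset.mem_erase.2 ⟨hab, hb⟩)

/-- A polynomial function that vanishes in the relative interior of a face vanishes on its plane. -/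
theorem eq_zero_on_plane {T : Tet} {a : E3} (ha : a ∈ T.verts) {f : E3 → ℝ} (hf : IsPolyFun f)
    (h : ∀ x, T.bary a x = 0 → (∀ b ∈ T.verts.erase a, 0 < T.bary b x) → f x = 0) {x : E3}
    (hx : T.bary a x = 0) : f x = 0 := by
  obtain ⟨b, hb, hab⟩ := T.exists_ne a
  set π := planeProj (T.baryAff a) (a - b) with hπ
  have hπ0 : ∀ x, T.bary a (π x) = 0 := fun x => by
    rw [← coe_baryAff]
    exact apply_planeProj (by rw [← inner_grad, T.inner_grad_sub_vertex ha hb hab]) x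
  have hπx : ∀ x, T.bary a x = 0 → π x = x := fun x hx => by
    rw [hπ, planeProj_apply, coe_baryAff, hx, zero_smul, sub_zero]
  have hU : IsOpen {x | ∀ b ∈ T.verts.erase a, 0 < T.bary b (π x)} := by
    simp only [Set.ofPred_forall]
    refine isOpen_biInter_finset fun b _ => isOpen_lt continuous_const ?_
    exact (T.isPolyFun_bary b).continuous.comp π.continuous_of_finiteDimensional
  have hc : T.bary a (faceCenter (T.verts.erase a)) = 0 := by
    rw [T.bary_faceCenter (Finset.erase_subset _ _) (T.card_erase ha), if_neg (by simp)]
  have h0 := (hf.comp_affine π).eq_of_eqOn (.const 0) hU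
    ⟨faceCenter (T.verts.erase a), fun b hb => by
      rw [hπx _ hc, T.bary_faceCenter (Finset.erase_subset _ _) (T.card_erase ha), if_pos hb]
      norm_num⟩
    (fun y hy => h _ (hπ0 y) hy)
  have := congrFun h0 x
  rwa [hπx x hx] at this

end Tet

namespace IsTriangulation

variable {𝒯 : Finset Tet} {Ω : Set E3} {S T : Tet} {v : E3 → ℝ}

theorem interior_subset (h𝒯 : IsTriangulation 𝒯 Ω) (hΩ : interior (closure Ω) = Ω) (hT : T ∈ 𝒯) :
    interior T.carrier ⊆ Ω := by
  rw [← hΩ, ← h𝒯.cover]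
  exact interior_mono (subset_biUnion_of_mem (u := fun T : Tet => T.carrier) hT)

/-- Elements of `H¹₀(Ω)` are continuous across interior faces. -/
theorem piece_eq_piece (h𝒯 : IsTriangulation 𝒯 Ω) (hΩ : interior (closure Ω) = Ω)
    (hv : MemH10 Ω v) (hS : S ∈ 𝒯) (hT : T ∈ 𝒯) {a c : E3} (h : S.IsOpposite T a c)
    (hpS : IsPolyFun (S.piece v)) (hpT : IsPolyFun (T.piece v))
    (hvS : EqOn v (S.piece v) (interior S.carrier)) (hvT : EqOn v (T.piece v) (interior T.carrier))
    {x : E3} (hx : S.bary a x = 0) : S.piece v x = T.piece v x := by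
  refine sub_eq_zero.1 (S.eq_zero_on_plane h.left_mem (hpS.sub hpT) (fun x hx hxF => ?_) hx)
  have hΩo : IsOpen Ω := hΩ ▸ isOpen_interior
  obtain ⟨C, hC, hw⟩ := hv.exists_translate_le hΩo.measurableSet
  obtain ⟨b, hb, hab⟩ := S.exists_ne a
  have hxtri : x ∈ triangle (S.verts.erase a) :=
    (S.mem_triangle h.left_mem).2 ⟨hx, fun b hb => (hxF b hb).le⟩
  have hxT : ∀ b ∈ T.verts.erase c, 0 < T.bary b x := by
    intro b hb
    rw [← h.erase_eq] at hb
    rw [← Tet.bary_eq_of_common_face (Finset.erase_subset a S.verts)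
      (h.erase_eq ▸ Finset.erase_subset c T.verts) (S.card_erase h.left_mem) hxtri hb]
    exact hxF b hb
  refine sub_eq_zero.2 (eq_of_translate_le hC hw (L := S.baryAff a) (e := a - b)
    (by rw [← Tet.inner_grad, S.inner_grad_sub_vertex h.left_mem hb hab]) hpS.continuous
    hpT.continuous (by rwa [Tet.coe_baryAff]) ?_ ?_)
  · filter_upwards [Tet.eventually_bary_pos hxF] with y hy hpos
    rw [Tet.coe_baryAff] at hpos
    have hyS := Tet.mem_interior_of_erase hy hpos
    rw [indicator_of_mem (h𝒯.interior_subset hΩ hS hyS), hvS hyS]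
  · filter_upwards [Tet.eventually_bary_pos hxT] with y hy hneg
    rw [Tet.coe_baryAff] at hneg
    have hyT := Tet.mem_interior_of_erase hy
      (by rw [h.bary_eq y]; exact mul_pos_of_neg_of_neg h.neg hneg)
    rw [indicator_of_mem (h𝒯.interior_subset hΩ hT hyT), hvT hyT]

/-- Elements of `H¹₀(Ω)` vanish on boundary faces. -/
theorem piece_eq_zero (h𝒯 : IsTriangulation 𝒯 Ω) (hΩ : interior (closure Ω) = Ω)
    (hv : MemH10 Ω v) (hS : S ∈ 𝒯) {a : E3} (ha : a ∈ S.verts)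
    (hbd : ∀ T ∈ 𝒯, S.verts.erase a ⊆ T.verts → T = S) (hpS : IsPolyFun (S.piece v))
    (hvS : EqOn v (S.piece v) (interior S.carrier)) {x : E3} (hx : S.bary a x = 0) :
    S.piece v x = 0 := by
  refine S.eq_zero_on_plane ha hpS (fun x hx hxF => ?_) hx
  have hΩo : IsOpen Ω := hΩ ▸ isOpen_interior
  obtain ⟨C, hC, hw⟩ := hv.exists_translate_le hΩo.measurableSet
  obtain ⟨b, hb, hab⟩ := S.exists_ne a
  have hxS : x ∈ S.carrier := S.mem_carrier.2 fun b hb => by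
    by_cases hba : b = a
    · rw [hba, hx]
    · exact (hxF b (Finset.mem_erase.2 ⟨hba, hb⟩)).le
  have hfar : ∀ᶠ y in 𝓝 x, ∀ T ∈ 𝒯, T ≠ S → y ∉ T.carrier := by
    rw [Filter.eventually_all_finset]
    intro T hT
    by_cases hTS : T = S
    · simp [hTS]
    have hxT : x ∉ T.carrier := by
      intro hxT
      obtain ⟨d, hdF, hdT⟩ : ∃ d ∈ S.verts.erase a, d ∉ T.verts := by
        by_contra! h
        exact hTS (hbd T hT h)
      have h1 : x ∈ S.carrier ∩ T.carrier := ⟨hxS, hxT⟩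
      rw [h𝒯.face_to_face S hS T hT] at h1
      have h2 : x ∈ triangle (S.verts.erase d) := by
        refine convexHull_mono (fun b hb => ?_) h1
        rw [Finset.coe_erase]
        exact ⟨hb.1, fun h => hdT (h ▸ hb.2)⟩
      exact (hxF d hdF).ne' ((S.mem_triangle (Finset.mem_of_mem_erase hdF)).1 h2).1
    filter_upwards [T.isCompact_carrier.isClosed.isOpen_compl.mem_nhds hxT] with y hy _
    exact hy
  refine eq_of_translate_le hC hw (L := S.baryAff a) (e := a - b) (q := fun _ => 0)
    (by rw [← Tet.inner_grad, S.inner_grad_sub_vertex ha hb hab]) hpS.continuous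
    continuous_const (by rwa [Tet.coe_baryAff]) ?_ ?_
  · filter_upwards [Tet.eventually_bary_pos hxF] with y hy hpos
    rw [Tet.coe_baryAff] at hpos
    have hyS := Tet.mem_interior_of_erase hy hpos
    rw [indicator_of_mem (h𝒯.interior_subset hΩ hS hyS), hvS hyS]
  · filter_upwards [hfar] with y hy hneg
    rw [Tet.coe_baryAff] at hneg
    refine indicator_of_notMem (fun hyΩ => ?_) _
    have h1 := subset_closure hyΩ
    rw [← h𝒯.cover, mem_iUnion₂] at h1
    obtain ⟨T, hT, hyT⟩ := h1
    by_cases hTS : T = S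
    · rw [hTS] at hyT
      exact absurd (S.mem_carrier.1 hyT a ha) (not_le.2 hneg)
    · exact hy T hT hTS hyT

end IsTriangulation

/-! ### Cancellation of the fluxes across the faces -/

/-- The flux of the Miranda–Talenti field of `v|_T` through the face opposite to `a`, up to a
constant factor. -/
def mtFlux (v : E3 → ℝ) (T : Tet) (a : E3) : ℝ :=
  volume.real T.carrier *
    ⨍ x in triangle (T.verts.erase a), ∑ i, T.grad a i * mtField (T.piece v) i x ∂μHE[2]

theorem Tet.isOuterUnitNormal {T : Tet} {a : E3} (ha : a ∈ T.verts) :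
    IsOuterUnitNormal T (T.verts.erase a) (-(‖T.grad a‖⁻¹ • T.grad a)) := by
  have hN := norm_pos_iff.2 (T.grad_ne_zero ha)
  have h0 : ∀ x ∈ T.verts.erase a, T.bary a x = 0 := fun x hx =>
    T.bary_of_ne (Finset.mem_of_mem_erase hx) (Finset.ne_of_mem_erase hx).symm
  refine ⟨?_, fun x hx y hy => ?_, fun x hx b hb hbF => ?_⟩
  · rw [norm_neg, norm_smul, norm_inv, norm_norm, inv_mul_cancel₀ hN.ne']
  · rw [inner_neg_left, real_inner_smul_left, T.inner_grad_sub, h0 x hx, h0 y hy]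
    simp
  · obtain rfl : b = a := by
      by_contra hab
      exact hbF (Finset.mem_erase.2 ⟨hab, hb⟩)
    rw [inner_neg_left, real_inner_smul_left, T.inner_grad_sub, h0 x hx, T.bary_self hb]
    simpa using hN

theorem Tet.eq_mul_of_eq_zero_on_plane {T : Tet} {a : E3} (ha : a ∈ T.verts) {f : E3 → ℝ}
    (hf : IsPolyFun f) (h : ∀ x, T.bary a x = 0 → f x = 0) :
    ∃ g, IsPolyFun g ∧ f = T.bary a * g := by
  obtain ⟨b, hb, hab⟩ := T.exists_ne a
  obtain ⟨k, hf⟩ := hf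
  obtain ⟨g, hg, h⟩ := exists_eq_mul_of_eq_zero (L := T.baryAff a) (e := a - b)
    (by rw [← inner_grad, T.inner_grad_sub_vertex ha hb hab]) hf (by rwa [coe_baryAff])
  rw [coe_baryAff] at h
  exact ⟨g, ⟨_, hg⟩, funext h⟩

section

variable {𝒯 : Finset Tet} {Ω : Set E3} {ℓ : ℕ}
  {B : ∀ (T : Tet) (F : T.Face), FaceBubbleData ℓ T F.1} {v : E3 → ℝ}

/-- The fluxes through an interior face from its two sides cancel: their sum is the moment of the
jump of the normal derivative against the tangential Laplacian, which has degree `ℓ - 2` on the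
face. -/
theorem mtFlux_add_eq_zero (h𝒯 : IsTriangulation 𝒯 Ω) (hΩ : interior (closure Ω) = Ω)
    (hv : MemH10 Ω v) (hp : ∀ T ∈ 𝒯, ∃ p ∈ shapeSpace ℓ T (B T), EqOn v p (interior T.carrier))
    (hE : C1AtEdges 𝒯 v) (hM : NormalMomentContinuity 𝒯 (ℓ - 2) v) {S T : Tet} (hS : S ∈ 𝒯)
    (hT : T ∈ 𝒯) {a c : E3} (h : S.IsOpposite T a c) : mtFlux v S a + mtFlux v T c = 0 := by
  obtain ⟨hvS, hSp, -⟩ := S.exists_piece_eq_add (hp S hS)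
  obtain ⟨hvT, hTp, p, hp, q, hq, hpq⟩ := T.exists_piece_eq_add (hp T hT)
  have hST : S ≠ T := by
    rintro rfl
    have h1 := h.neg
    by_cases hac : a = c
    · rw [← hac, S.bary_self h.left_mem] at h1
      linarith
    · rw [S.bary_of_ne h.left_mem (Ne.symm hac)] at h1
      exact lt_irrefl _ h1
  set F := S.verts.erase a with hF
  have hFS : F ⊆ S.verts := Finset.erase_subset _ _
  have hFT : F ⊆ T.verts := hF.trans h.erase_eq ▸ Finset.erase_subset _ _
  have hcard : F.card = 3 := S.card_erase h.left_mem
  set N := S.grad a with hN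
  have hN0 : 0 < ‖N‖ := norm_pos_iff.2 (S.grad_ne_zero h.left_mem)
  have hL : ∀ w, pd w (S.bary a) = fun _ => inner ℝ N w := fun w => S.pd_bary w a
  have hLp := S.isPolyFun_bary a
  obtain ⟨g, hg, hdg⟩ := S.eq_mul_of_eq_zero_on_plane h.left_mem (hSp.sub hTp)
    (fun x hx => sub_eq_zero.2 (h𝒯.piece_eq_piece hΩ hv hS hT h hSp hTp hvS hvT hx))
  have hpST : S.piece v = T.piece v + S.bary a * g := by rw [← hdg]; abel
  have hF0 : ∀ x ∈ triangle F, S.bary a x = 0 := fun x hx =>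
    ((S.mem_triangle h.left_mem).1 hx).1
  have hmeas : MeasurableSet (triangle F) := (Tet.isCompact_triangle F).measurableSet
  have hint : ∀ g : E3 → ℝ, Continuous g → IntegrableOn g (triangle F) μHE[2] :=
    fun g hg => S.integrableOn_triangle hFS hcard hg
  have hjump : ∀ n, ∀ x ∈ triangle F, normalJump v S T n x = inner ℝ N n * g x := by
    intro n x hx
    rw [← pd_mul_of_eq_zero hLp hg hL n (hF0 x hx), ← hdg, pd_sub n hSp hTp]
    rfl
  have hg0 : ∀ b ∈ F, ∀ d ∈ F, ∀ x ∈ segment ℝ b d, g x = 0 := by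
    intro b hb d hd x hx
    have h1 := congrArg (fun L => L N)
      (hE S hS T hT b (hFS hb) (hFT hb) d (hFS hd) (hFT hd) x hx).2
    have h2 : normalJump v S T N x = 0 := sub_eq_zero.2 h1
    rw [hjump N x (triangle_segment hb hd hx), real_inner_self_eq_norm_sq] at h2
    exact (mul_eq_zero.1 h2).resolve_left (by positivity)
  have hgu : ∀ u ∈ polyFun (ℓ - 2), ∫ x in triangle F, g x * u x ∂μHE[2] = 0 := by
    intro u hu
    have h1 := hM F S T _ ⟨hS, hT, hST, hFS, hFT, hcard, S.isOuterUnitNormal h.left_mem⟩ u hu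
    rw [setIntegral_congr_fun (g := fun x => -‖N‖ * (g x * u x)) hmeas, integral_const_mul] at h1
    · exact (mul_eq_zero.1 h1).resolve_left (by simpa using hN0.ne')
    · intro x hx
      simp only [hjump _ x hx, inner_neg_right, inner_smul_right, ← hN, real_inner_self_eq_norm_sq]
      field_simp
  have hqp := Tet.isPolyFun_of_mem_bubbleSpan hq
  have hlap : ∀ x ∈ triangle F, tangentLaplacian N (T.piece v) x = tangentLaplacian N p x := by
    intro x hx
    obtain ⟨η, hη, hqη⟩ := S.eq_mul_of_eq_zero_on_plane h.left_mem hqp (fun x hx =>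
      Tet.bubble_eq_zero hq h.right_mem (by rw [h.bary_eq, hx, mul_zero]))
    rw [hpq, tangentLaplacian_add ⟨_, hp⟩ hqp, Pi.add_apply, hqη,
      tangentLaplacian_mul_eq_zero hLp hη hL (hF0 x hx), add_zero]
  have hcS : Continuous fun x => ∑ i, N i * mtField (S.piece v) i x :=
    continuous_finsetSum _ fun i _ => continuous_const.mul (isPolyFun_mtField hSp i).continuous
  have hcT : Continuous fun x => ∑ i, N i * mtField (T.piece v) i x :=
    continuous_finsetSum _ fun i _ => continuous_const.mul (isPolyFun_mtField hTp i).continuous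
  have hgd : ∀ j, IsPolyFun (g * pd (stdVec j) (T.piece v)) := fun j => hg.mul (hTp.pd _)
  have hlapc : Continuous (tangentLaplacian N p) :=
    IsPolyFun.continuous ⟨_, tangentLaplacian_mem_polyFun N hp⟩
  have hgc := hg.continuous
  have hzero : ∫ x in triangle F, (∑ i, N i * mtField (S.piece v) i x -
      ∑ i, N i * mtField (T.piece v) i x) ∂μHE[2] = 0 := by
    rw [setIntegral_congr_fun (g := fun x =>
      ∑ j, pd (tangentVec N j) (g * pd (stdVec j) (T.piece v)) x -
        2 * (g x * tangentLaplacian N p x)) hmeas]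
    · rw [integral_sub
          (hint _ (continuous_finsetSum _ fun j _ => ((hgd j).pd _).continuous))
          (hint _ (by fun_prop)), integral_const_mul,
        hgu _ (tangentLaplacian_mem_polyFun N hp), integral_finsetSum _
          (fun j _ => hint _ ((hgd j).pd _).continuous), mul_zero, sub_zero]
      refine Finset.sum_eq_zero fun j _ => ?_
      refine S.setIntegral_pd_face h.left_mem (inner_tangentVec N j) (hgd j) ?_
      intro b hb d hd x hx
      rw [Pi.mul_apply, hg0 b hb d hd x hx, zero_mul]
    · intro x hx
      simp only
      rw [hpST, mtField_jump hLp hg hTp hL (hF0 x hx), hlap x hx]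
  rw [integral_sub (hint _ hcS) (hint _ hcT)] at hzero
  have hgrad : ∀ i, volume.real T.carrier * T.grad c i = -(volume.real S.carrier * N i) := by
    intro i
    have := congrArg (fun w : E3 => w i) h.volume_smul_grad
    simp only [PiLp.smul_apply, PiLp.neg_apply, smul_eq_mul] at this
    rw [hN, this, neg_neg]
  have hflux : mtFlux v T c = -(volume.real S.carrier *
      ⨍ x in triangle F, ∑ i, N i * mtField (T.piece v) i x ∂μHE[2]) := by
    have hpt : ∀ x, volume.real T.carrier * ∑ i, T.grad c i * mtField (T.piece v) i x =
        -volume.real S.carrier * ∑ i, N i * mtField (T.piece v) i x := fun x => by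
      rw [Finset.mul_sum, Finset.mul_sum]
      refine Finset.sum_congr rfl fun i _ => ?_
      rw [← mul_assoc, hgrad i]
      ring
    have hI := congrArg (fun f => ∫ x in triangle F, f x ∂μHE[2]) (funext hpt)
    simp only [integral_const_mul] at hI
    rw [mtFlux, ← h.erase_eq, ← hF, setAverage_eq, setAverage_eq, smul_eq_mul, smul_eq_mul]
    linear_combination ((μHE[2] : Measure E3).real (triangle F))⁻¹ * hI
  rw [hflux, mtFlux, ← hF, setAverage_eq, setAverage_eq, smul_eq_mul, smul_eq_mul]
  linear_combination volume.real S.carrier *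
    ((μHE[2] : Measure E3).real (triangle F))⁻¹ * hzero

/-- The flux through a boundary face vanishes: the field is quadratic in the derivatives, and `v`
has only a normal derivative there. -/
theorem mtFlux_eq_zero (h𝒯 : IsTriangulation 𝒯 Ω) (hΩ : interior (closure Ω) = Ω)
    (hv : MemH10 Ω v) (hp : ∀ T ∈ 𝒯, ∃ p ∈ shapeSpace ℓ T (B T), EqOn v p (interior T.carrier))
    {S : Tet} (hS : S ∈ 𝒯) {a : E3} (ha : a ∈ S.verts)
    (hbd : ∀ T ∈ 𝒯, S.verts.erase a ⊆ T.verts → T = S) : mtFlux v S a = 0 := by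
  obtain ⟨hvS, hSp, -⟩ := S.exists_piece_eq_add (hp S hS)
  obtain ⟨g, hg, hdg⟩ := S.eq_mul_of_eq_zero_on_plane ha hSp
    (fun x hx => h𝒯.piece_eq_zero hΩ hv hS ha hbd hSp hvS hx)
  have hz : ∀ x ∈ triangle (S.verts.erase a), ∑ i, S.grad a i * mtField (S.piece v) i x = 0 := by
    intro x hx
    have h0 : IsPolyFun 0 := .const 0
    have h1 := mtField_jump (N := S.grad a) (S.isPolyFun_bary a) hg h0 (fun w => S.pd_bary w a)
      ((S.mem_triangle ha).1 hx).1
    simpa [← hdg, mtField, tangentLaplacian, pd_zero] using h1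
  rw [mtFlux, setAverage_eq, setIntegral_eq_zero_of_forall_eq_zero hz]
  simp

theorem sum_mtFlux_eq_zero (h𝒯 : IsTriangulation 𝒯 Ω) (hΩ : interior (closure Ω) = Ω)
    (hv : MemH10 Ω v) (hp : ∀ T ∈ 𝒯, ∃ p ∈ shapeSpace ℓ T (B T), EqOn v p (interior T.carrier))
    (hE : C1AtEdges 𝒯 v) (hM : NormalMomentContinuity 𝒯 (ℓ - 2) v) :
    ∑ T ∈ 𝒯, ∑ a ∈ T.verts, mtFlux v T a = 0 := by
  classical
  rw [Finset.sum_sigma']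
  set P := 𝒯.sigma fun T => T.verts with hP
  rw [← Finset.sum_fiberwise_of_maps_to (t := P.image fun z => z.1.verts.erase z.2)
    (g := fun z => z.1.verts.erase z.2) (fun z hz => Finset.mem_image_of_mem _ hz)]
  refine Finset.sum_eq_zero fun F _ => ?_
  set Q := P.filter fun z => z.1.verts.erase z.2 = F with hQ
  have hQmem : ∀ z ∈ Q, z.1 ∈ 𝒯 ∧ z.2 ∈ z.1.verts ∧ z.1.verts.erase z.2 = F := fun z hz => by
    rw [hQ, Finset.mem_filter, hP, Finset.mem_sigma] at hz
    exact ⟨hz.1.1, hz.1.2, hz.2⟩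
  have hopp : ∀ y ∈ Q, ∀ z ∈ Q, y ≠ z → y.1.IsOpposite z.1 y.2 z.2 := by
    rintro ⟨S, a⟩ hy ⟨T, c⟩ hz hyz
    obtain ⟨hS, ha, hSF⟩ := hQmem _ hy
    obtain ⟨hT, hc, hTF⟩ := hQmem _ hz
    refine h𝒯.isOpposite hS hT ?_ ha hc (hSF.trans hTF.symm)
    rintro rfl
    refine hyz ?_
    have : a = c := by
      by_contra hac
      have h1 : a ∈ S.verts.erase c := Finset.mem_erase.2 ⟨hac, ha⟩
      rw [show S.verts.erase c = S.verts.erase a from hTF.trans hSF.symm] at h1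
      simp at h1
    rw [this]
  by_cases hne : Q.Nonempty
  swap
  · rw [Finset.not_nonempty_iff_eq_empty.1 hne, Finset.sum_empty]
  obtain ⟨y, hy⟩ := hne
  obtain ⟨hyS, hya, hyF⟩ := hQmem y hy
  by_cases hz : ∃ z ∈ Q, y ≠ z
  · obtain ⟨z, hz, hyz⟩ := hz
    have hyzo := hopp y hy z hz hyz
    have hQ2 : Q = {y, z} := by
      refine Finset.Subset.antisymm (fun r hr => ?_) (Finset.insert_subset hy (by simpa using hz))
      by_contra hrn
      simp only [Finset.mem_insert, Finset.mem_singleton, not_or] at hrn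
      -- three elements cannot lie on pairwise different sides of a plane
      have h1 := (hopp r hr y hy hrn.1).neg
      have h2 := (hopp r hr z hz hrn.2).neg
      rw [hyzo.bary_eq r.2] at h2
      exact absurd h2 (not_lt.2 (mul_pos_of_neg_of_neg hyzo.neg h1).le)
    rw [hQ2, Finset.sum_pair hyz]
    exact mtFlux_add_eq_zero h𝒯 hΩ hv hp hE hM hyS (hQmem z hz).1 hyzo
  · push Not at hz
    rw [Finset.sum_eq_single y (fun z hzQ hzy => absurd (hz z hzQ) hzy.symm)
      (fun h => absurd hy h)]
    refine mtFlux_eq_zero h𝒯 hΩ hv hp hyS hya fun T hT hFT => ?_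
    obtain ⟨c, hc, -, hFc⟩ := T.exists_eq_erase hFT (y.1.card_erase hya)
    have : (⟨T, c⟩ : Σ _ : Tet, E3) ∈ Q := by
      rw [hQ, Finset.mem_filter, hP, Finset.mem_sigma]
      exact ⟨⟨hT, hc⟩, hFc.symm.trans hyF⟩
    rw [hz _ this]

end

/-! ### The norms of the piecewise derivatives -/

/-- The squared `L²` norm of a function that is defined element by element is the sum over the
elements. The interiors are disjoint, and the boundaries are null sets. -/
theorem eLpNorm_piecewise_sq {𝒯 : Finset Tet} {Ω : Set E3} (h𝒯 : IsTriangulation 𝒯 Ω)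
    (hΩ : interior (closure Ω) = Ω) {V : Type*} [NormedAddCommGroup V] {f : E3 → V}
    {Q : Tet → E3 → ℝ} (hQ : ∀ T ∈ 𝒯, Continuous (Q T))
    (hf : ∀ T ∈ 𝒯, ∀ x ∈ interior T.carrier, ‖f x‖ ^ 2 = Q T x) :
    eLpNorm (fun x => ∑ T ∈ 𝒯, (interior T.carrier).indicator f x) 2 (volume.restrict Ω) ^ 2 =
      ENNReal.ofReal (∑ T ∈ 𝒯, ∫ x in T.carrier, Q T x) := by
  have h1 := eLpNorm_nnreal_pow_eq_lintegral
    (f := fun x => ∑ T ∈ 𝒯, (interior T.carrier).indicator f x) (μ := volume.restrict Ω) (p := 2)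
    two_ne_zero
  have hpt : ∀ x, ‖∑ T ∈ 𝒯, (interior T.carrier).indicator f x‖ₑ ^ 2 =
      ∑ T ∈ 𝒯, (interior T.carrier).indicator (fun x => ENNReal.ofReal (Q T x)) x := by
    intro x
    by_cases hx : ∃ T ∈ 𝒯, x ∈ interior T.carrier
    · obtain ⟨T, hT, hxT⟩ := hx
      have hne : ∀ S ∈ 𝒯, S ≠ T → x ∉ interior S.carrier := fun S hS hST hxS =>
        Set.disjoint_left.1 (h𝒯.disjoint_interior hS hT hST) hxS hxT
      rw [Finset.sum_eq_single T (fun S hS hST => indicator_of_notMem (hne S hS hST) _)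
          (fun h => absurd hT h),
        Finset.sum_eq_single T (fun S hS hST => indicator_of_notMem (hne S hS hST) _)
          (fun h => absurd hT h), indicator_of_mem hxT, indicator_of_mem hxT, ← hf T hT x hxT,
        ← ofReal_norm, ENNReal.ofReal_pow (norm_nonneg _)]
    · push Not at hx
      rw [Finset.sum_eq_zero fun T hT => indicator_of_notMem (hx T hT) _,
        Finset.sum_eq_zero fun T hT => indicator_of_notMem (hx T hT) _]
      simp
  have hnn : ∀ T ∈ 𝒯, ∀ x ∈ interior T.carrier, 0 ≤ Q T x := fun T hT x hx => by
    rw [← hf T hT x hx]; positivity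
  have hT : ∀ T ∈ 𝒯, ∫⁻ x in Ω, (interior T.carrier).indicator
      (fun x => ENNReal.ofReal (Q T x)) x = ENNReal.ofReal (∫ x in T.carrier, Q T x) := by
    intro T hT
    rw [lintegral_indicator isOpen_interior.measurableSet,
      Measure.restrict_restrict isOpen_interior.measurableSet,
      inter_eq_left.2 (h𝒯.interior_subset hΩ hT),
      ← setIntegral_congr_set (interior_ae_eq_of_null_frontier (T.convex_carrier.addHaar_frontier _)),
      ofReal_integral_eq_lintegral_ofReal]
    · exact ((hQ T hT).continuousOn.integrableOn_compact T.isCompact_carrier).mono_set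
        _root_.interior_subset
    · exact (ae_restrict_iff' isOpen_interior.measurableSet).2 (ae_of_all _ (hnn T hT))
  have hint : ∀ T ∈ 𝒯, 0 ≤ ∫ x in T.carrier, Q T x := by
    intro T hT
    rw [← setIntegral_congr_set
      (interior_ae_eq_of_null_frontier (T.convex_carrier.addHaar_frontier _))]
    exact setIntegral_nonneg isOpen_interior.measurableSet (hnn T hT)
  calc eLpNorm (fun x => ∑ T ∈ 𝒯, (interior T.carrier).indicator f x) 2 (volume.restrict Ω) ^ 2
      = ∫⁻ x in Ω, ‖∑ T ∈ 𝒯, (interior T.carrier).indicator f x‖ₑ ^ 2 := by simpa using h1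
    _ = ∑ T ∈ 𝒯, ∫⁻ x in Ω, (interior T.carrier).indicator
          (fun x => ENNReal.ofReal (Q T x)) x := by
        simp only [hpt]
        refine lintegral_finsetSum' _ fun T hT => Measurable.aemeasurable ?_
        exact ((hQ T hT).measurable.ennreal_ofReal).indicator isOpen_interior.measurableSet
    _ = _ := by
        rw [Finset.sum_congr rfl hT, ENNReal.ofReal_sum_of_nonneg hint]

theorem partial2_eq_of_eqOn {U : Set E3} (hU : IsOpen U) {v p : E3 → ℝ} (h : EqOn v p U)
    {x : E3} (hx : x ∈ U) (i j : Fin 3) : partial2 v i j x = partial2 p i j x := by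
  have h1 : ∀ y ∈ U, fderiv ℝ v y = fderiv ℝ p y := fun y hy =>
    (Filter.eventuallyEq_of_mem (hU.mem_nhds hy) h).fderiv_eq
  unfold partial2
  rw [Filter.EventuallyEq.fderiv_eq]
  filter_upwards [hU.mem_nhds hx] with y hy
  rw [h1 y hy]

end

theorem mainTheorem2 (Ω : Set E3) (hΩ : interior (closure Ω) = Ω)
    (𝒯 : Finset Tet) (h𝒯 : IsTriangulation 𝒯 Ω) (ℓ : ℕ) (hℓ : 5 ≤ ℓ)
    (B : ∀ (T : Tet) (F : T.Face), FaceBubbleData ℓ T F.1) :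
    (∀ v ∈ feSpace ℓ Ω 𝒯 B, NormalMomentContinuity 𝒯 (ℓ - 2) v) ∧
      StrongDiscreteMirandaTalenti Ω 𝒯 (feSpace ℓ Ω 𝒯 B) := by
  have hM : ∀ v ∈ feSpace ℓ Ω 𝒯 B, NormalMomentContinuity 𝒯 (ℓ - 2) v := fun v hv =>
    normalMomentContinuity_of_pieces hℓ hv.2.1 hv.2.2.2.1 hv.2.2.2.2
  refine ⟨hM, fun v hv => ?_⟩
  have hMv := hM v hv
  obtain ⟨hH, hp, -, hE, -⟩ := hv
  have hpoly : ∀ T ∈ 𝒯, IsPolyFun (T.piece v) := fun T hT => (T.exists_piece_eq_add (hp T hT)).2.1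
  have hpar : ∀ T ∈ 𝒯, ∀ x ∈ interior T.carrier, ∀ i j,
      partial2 v i j x = partial2 (T.piece v) i j x := fun T hT x hx i j =>
    partial2_eq_of_eqOn isOpen_interior (T.exists_piece_eq_add (hp T hT)).1 hx i j
  have hc : ∀ T ∈ 𝒯, ∀ i j, Continuous (partial2 (T.piece v) i j) := fun T hT i j =>
    (((hpoly T hT).pd (stdVec j)).pd (stdVec i)).continuous
  have hH2 := eLpNorm_piecewise_sq h𝒯 hΩ
    (f := fun y => WithLp.toLp 2 fun ij : Fin 3 × Fin 3 => partial2 v ij.1 ij.2 y)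
    (Q := fun T x => ∑ i, ∑ j, partial2 (T.piece v) i j x ^ 2)
    (fun T hT => continuous_finsetSum _ fun i _ => continuous_finsetSum _ fun j _ =>
      (hc T hT i j).pow 2)
    (fun T hT x hx => by
      rw [EuclideanSpace.norm_sq_eq, Fintype.sum_prod_type]
      simp only [hpar T hT x hx, Real.norm_eq_abs, sq_abs])
  have hL2 := eLpNorm_piecewise_sq h𝒯 hΩ (f := fun y => ∑ i : Fin 3, partial2 v i i y)
    (Q := fun T x => (∑ i, partial2 (T.piece v) i i x) ^ 2)
    (fun T hT => (continuous_finsetSum _ fun i _ => hc T hT i i).pow 2)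
    (fun T hT x hx => by simp only [hpar T hT x hx, Real.norm_eq_abs, sq_abs])
  have hsum : ∑ T ∈ 𝒯, ∫ x in T.carrier, ∑ i, ∑ j, partial2 (T.piece v) i j x ^ 2 =
      ∑ T ∈ 𝒯, ∫ x in T.carrier, (∑ i, partial2 (T.piece v) i i x) ^ 2 := by
    rw [← sub_eq_zero, ← Finset.sum_sub_distrib]
    have h1 : ∀ T ∈ 𝒯, (∫ x in T.carrier, ∑ i, ∑ j, partial2 (T.piece v) i j x ^ 2) -
        ∫ x in T.carrier, (∑ i, partial2 (T.piece v) i i x) ^ 2 =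
        -3 * ∑ a ∈ T.verts, mtFlux v T a := by
      intro T hT
      rw [← integral_sub, setIntegral_hessian_sub_laplacian T (hpoly T hT), mul_assoc,
        Finset.mul_sum]
      · rfl
      · exact (continuous_finsetSum _ fun i _ => continuous_finsetSum _ fun j _ =>
          (hc T hT i j).pow 2).continuousOn.integrableOn_compact T.isCompact_carrier
      · exact ((continuous_finsetSum _ fun i _ =>
          hc T hT i i).pow 2).continuousOn.integrableOn_compact T.isCompact_carrier
    rw [Finset.sum_congr rfl h1, ← Finset.mul_sum,
      sum_mtFlux_eq_zero h𝒯 hΩ hH hp hE hMv, mul_zero]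
  refine (ENNReal.pow_le_pow_left_iff two_ne_zero).1 (le_of_eq ?_)
  exact hH2.trans ((congrArg ENNReal.ofReal hsum).trans hL2.symm)
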